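/- Let $N\ge 1$, $Q=(0,1)^N$. For $s\in[0,1)$ and a vector field $v\in C_c^\infty(Q;\mathbb R^N)$ put $$\operatorname{div}^s v:=\Big[\big(1-\tfrac1N\big)s+\tfrac1N\Big]\sum_{i=1}^N\partial^s_{i,R}v_i,\qquad d^s_Rw(x)=-\frac1{\Gamma(1-s)}\frac{d}{dx}\int_x^1\frac{w(t)}{(t-x)^s}\,dt ,$$ where $\partial^s_{i,R}$ is $d^s_R$ acting in the variable $x_i$ (so $d_R^0w=w$). For $k\in\mathbb N_0$, $\operatorname{div}^k$ is the $k$-fold divergence. For $p\in[1,\infty]$, $|\cdot|^*_{\ell^p}$ is the norm dual to the entrywise $\ell^p$ norm. For $r=\lfloor r\rfloor+s\ge0$ with $s\in[0,1)$ and $u\in L^1(Q)$ let $$TV^r_{\ell^p}(u):=\sup\Big\{\int_Q u\,\operatorname{div}^s[\operatorname{div}^{\lfloor r\rfloor}\varphi]\,dx:\ \varphi\in C_c^\infty(Q;\mathbb R^{N^{\lfloor r\rfloor+1}}),\ |\varphi|^*_{\ell^p}\le1\Big\}\in[0,\infty],$$ and for $k\in\mathbb N_0$ let $$\overline{TV}{}^k_{\ell^p}(u):=\sup\Big\{\int_Q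 u\,\operatorname{div}^{k}\varphi\,dx:\ \varphi\in C_c^\infty(Q;\mathbb R^{N^{k}}),\ |\varphi|^*_{\ell^p}\le1\Big\}$$ be the classical total variation of order $k$ (the $L^1$ norm if $k=0$); put $\overline{TV}{}^r_{\ell^p}:=TV^r_{\ell^p}$ if $r$ is not an integer. Let $BV^r(Q)$ be the set of $u\in L^1(Q)$ with $TV^r_{\ell^p}(u)<\infty$ for all $p\in[1,\infty]$, and $BV(Q)$ the classical space of functions of bounded variation. Let $SV^r(Q)$ be the set of $u\in L^1(Q)$ such that for every $p\in[1,\infty]$ we have $TV^r_{\ell^p}(u)<\infty$ and there are $v_j\in C^\infty(Q)\cap L^1(Q)$ with $TV^r_{\ell^p}(v_j)<\infty$, $v_j\to u$ in $L^1(Q)$ and $TV^r_{\ell^p}(v_j)\to TV^r_{\ell^p}(u)$. For $u\in BV(Q)$ let $T[u]$ be its trace on $\partial Q$. Let $r_n>0$ with $r_n\to r\ge0$, let $p_n\in[1,\infty]$ with $p_n\to p\in[1,\infty]$, let $u_n\in L^1(Q)$, and suppose that for some $q\in(1,\infty]$ $$\sup_n\big\{\|u_n\|_{L^q(Q)}+TV^{r_n}_{\ell^{m_n}}(u_n)\big\}<\infty,$$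 where the exponents $m_n\in[1,\infty]$ are arbitrary (for instance $m_n=2$ or $m_n=p_n$). Then there are $u\in BV^r(Q)\cap L^q(Q)$ and a subsequence $(u_{n_j})$ with the following properties. 1. $u_{n_j}\rightharpoonup u$ weakly in $L^q(Q)$ (weakly-$*$ if $q=\infty$), and $$\liminf_{n\to\infty}TV^{r_n}_{\ell^{p_n}}(u_n)\ \ge\ TV^r_{\ell^p}(u).$$ If moreover $N=1$, or $p=1$, or $r$ is not an integer, or $r_n\le r$ for all large $n$, then also $\liminf_{n\to\infty}\overline{TV}{}^{r_n}_{\ell^{p_n}}(u_n)\ge\overline{TV}{}^r_{\ell^p}(u)$. 2. If in addition $r>0$, $u_n\in BV(Q)\cap SV^{r_n}(Q)$ for all $n$, and $\sup_n\|T[u_n]\|_{L^\infty(\partial Q)}<\infty$ (in particular if $u_n\in IM(Q)\cap SV^{r_n}(Q)$, where $IM(Q)=\{u\in BV(Q):\|T[u]\|_{L^\infty(\partial Q)}\le1\}$), then $u_{n_j}\to u$ strongly in $L^1(Q)$. -/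

import Mathlib

open MeasureTheory Filter Topology Set
open scoped ENNReal ContDiff

noncomputable section

namespace FracTV

/-- The open unit cube `Q = (0,1)^N`. -/
def Q (N : ℕ) : Set (Fin N → ℝ) := Set.pi Set.univ (fun _ => Set.Ioo (0 : ℝ) 1)

/-- Lebesgue measure on the cube. -/
abbrev μQ (N : ℕ) : Measure (Fin N → ℝ) := volume.restrict (Q N)

/-- `f ∈ C_c^∞(Q)`. -/
def IsTest {N : ℕ} (f : (Fin N → ℝ) → ℝ) : Prop :=
  ContDiff ℝ ∞ f ∧ HasCompactSupport f ∧ tsupport f ⊆ Q N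

/-- `|y|^*_{ℓ^p} ≤ 1`, where `|·|^*_{ℓ^p}` is the norm dual to the `ℓ^p` norm on `ℝ^ι`
(entrywise for tensors). -/
def DualNormLeOne {ι : Type} [Fintype ι] (p : ℝ≥0∞) (y : ι → ℝ) : Prop :=
  ∀ x : ι → ℝ, ‖WithLp.toLp p x‖ ≤ 1 → ∑ j, x j * y j ≤ 1

/-- Right-sided Riemann-Liouville derivative on `(0,1)` of order `s ∈ [0,1)`:
`-(1/Γ(1-s)) d/dx ∫_x^1 w(t) (t-x)^{-s} dt`. -/
def rlRight (s : ℝ) (w : ℝ → ℝ) (x : ℝ) : ℝ :=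
  -(1 / Real.Gamma (1 - s)) * deriv (fun y => ∫ t in y..1, w t / (t - y) ^ s) x

/-- The fractional partial derivative `∂^s_{i,R}`. -/
def fracPartial {N : ℕ} (s : ℝ) (i : Fin N) (f : (Fin N → ℝ) → ℝ) (x : Fin N → ℝ) : ℝ :=
  rlRight s (fun t => f (Function.update x i t)) (x i)

/-- The partial derivative `∂_i`. -/
def partialD {N : ℕ} (i : Fin N) (f : (Fin N → ℝ) → ℝ) (x : Fin N → ℝ) : ℝ :=
  fderiv ℝ f x (Pi.single i 1)

/-- The iterated divergence `div^k` of a tensor field with `N^k` entries: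
`div^{k+1} ψ = ∑_i ∂_i (div^k ψ_i)`, where `ψ_i` is the `i`-th row. -/
def iterDiv {N : ℕ} : (k : ℕ) → ((Fin k → Fin N) → (Fin N → ℝ) → ℝ) → (Fin N → ℝ) → ℝ
  | 0, ψ => ψ Fin.elim0
  | k + 1, ψ => fun x => ∑ i, partialD i (iterDiv k (fun J => ψ (Fin.cons i J))) x

/-- The scaled fractional divergence
`div^s v = [(1 - 1/N) s + 1/N] ∑_i ∂^s_{i,R} v_i` of a vector field. -/
def fracDiv {N : ℕ} (s : ℝ) (v : Fin N → (Fin N → ℝ) → ℝ) (x : Fin N → ℝ) : ℝ :=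
  ((1 - 1 / (N : ℝ)) * s + 1 / (N : ℝ)) * ∑ i, fracPartial s i (v i) x

/-- `div^s [div^k φ]` for a tensor field with `N^{k+1}` entries. -/
def fracIterDiv {N : ℕ} (s : ℝ) (k : ℕ) (φ : (Fin (k + 1) → Fin N) → (Fin N → ℝ) → ℝ) :
    (Fin N → ℝ) → ℝ :=
  fracDiv s (fun i => iterDiv k (fun J => φ (Fin.cons i J)))

/-- Admissible test tensor fields with `N^m` entries: `φ ∈ C_c^∞(Q)`, `|φ|^*_{ℓ^p} ≤ 1`. -/
def Admissible {N : ℕ} (p : ℝ≥0∞) (m : ℕ) (φ : (Fin m → Fin N) → (Fin N → ℝ) → ℝ) : Prop :=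
  (∀ J, IsTest (φ J)) ∧ ∀ x, DualNormLeOne p (fun J => φ J x)

/-- The classical total variation `TV^k_{ℓ^p}(u)` of integer order `k`. -/
def intTV {N : ℕ} (p : ℝ≥0∞) (k : ℕ) (u : (Fin N → ℝ) → ℝ) : ℝ≥0∞ :=
  ⨆ (φ : (Fin k → Fin N) → (Fin N → ℝ) → ℝ) (_ : Admissible p k φ),
    ENNReal.ofReal (∫ x in Q N, u x * iterDiv k φ x)

/-- The `r`-order total variation `TV^r_{ℓ^p}(u)`, for real `r = ⌊r⌋ + s ≥ 0`, `s ∈ [0,1)`. -/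
def fracTV {N : ℕ} (p : ℝ≥0∞) (r : ℝ) (u : (Fin N → ℝ) → ℝ) : ℝ≥0∞ :=
  ⨆ (φ : (Fin (⌊r⌋₊ + 1) → Fin N) → (Fin N → ℝ) → ℝ) (_ : Admissible p (⌊r⌋₊ + 1) φ),
    ENNReal.ofReal (∫ x in Q N, u x * fracIterDiv (r - ⌊r⌋₊) ⌊r⌋₊ φ x)

open Classical in
/-- The variant of `TV^r_{ℓ^p}` that is the classical total variation at integer orders
(the `L^1` norm at order `0`). It coincides with `fracTV` at the other orders. -/
def mixedTV {N : ℕ} (p : ℝ≥0∞) (r : ℝ) (u : (Fin N → ℝ) → ℝ) : ℝ≥0∞ :=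
  if r = ⌊r⌋₊ then intTV p ⌊r⌋₊ u else fracTV p r u

/-- The space `BV^r(Q)`. -/
def BVr (N : ℕ) (r : ℝ) : Set ((Fin N → ℝ) → ℝ) :=
  {u | IntegrableOn u (Q N) ∧ ∀ p : ℝ≥0∞, 1 ≤ p → fracTV p r u < ⊤}

/-- The classical space `BV(Q)`. -/
def BV (N : ℕ) : Set ((Fin N → ℝ) → ℝ) :=
  {u | IntegrableOn u (Q N) ∧ intTV 2 1 u < ⊤}

/-- Strict convergence `v_n → u` with respect to the `TV^r_{ℓ^p}` seminorm. -/
def StrictConv {N : ℕ} (p : ℝ≥0∞) (r : ℝ) (v : ℕ → (Fin N → ℝ) → ℝ)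
    (u : (Fin N → ℝ) → ℝ) : Prop :=
  (∀ n, IntegrableOn (v n) (Q N) ∧ fracTV p r (v n) < ⊤) ∧
  IntegrableOn u (Q N) ∧ fracTV p r u < ⊤ ∧
  Tendsto (fun n => eLpNorm (v n - u) 1 (μQ N)) atTop (𝓝 0) ∧
  Tendsto (fun n => fracTV p r (v n)) atTop (𝓝 (fracTV p r u))

/-- The space `SV^r(Q)`: the intersection over `p ∈ [1,∞]` of the closures of `C^∞(Q)` under
strict convergence. -/
def SVr (N : ℕ) (r : ℝ) : Set ((Fin N → ℝ) → ℝ) :=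
  {u | ∀ p : ℝ≥0∞, 1 ≤ p → ∃ v : ℕ → (Fin N → ℝ) → ℝ,
    (∀ n, ContDiffOn ℝ ∞ (v n) (Q N)) ∧ StrictConv p r v u}

/-- `T` is a boundary trace of `u`: for `H^{N-1}`-a.e. `x₀ ∈ ∂Q`,
`⨍_{B(x₀,ε) ∩ Q} |u - T(x₀)| → 0` as `ε → 0`, with Euclidean balls `B`. -/
def IsTrace {N : ℕ} (u T : (Fin N → ℝ) → ℝ) : Prop :=
  ∀ᵐ x₀ ∂((μH[(N : ℝ) - 1] : Measure (Fin N → ℝ)).restrict (frontier (Q N))),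
    Tendsto (fun ε : ℝ => ⨍ y in {y | ∑ i, (y i - x₀ i) ^ 2 < ε ^ 2} ∩ Q N, |u y - T x₀|)
      (𝓝[>] 0) (𝓝 0)

/-- Functions of `BV(Q)` with `‖T[u]‖_{L^∞(∂Q)} ≤ M`. The space `IM(Q)` is the case `M = 1`. -/
def IM (N : ℕ) (M : ℝ) : Set ((Fin N → ℝ) → ℝ) :=
  {u | u ∈ BV N ∧ ∃ T, IsTrace u T ∧
    ∀ᵐ x₀ ∂((μH[(N : ℝ) - 1] : Measure (Fin N → ℝ)).restrict (frontier (Q N))), |T x₀| ≤ M}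

/-- Weak convergence in `L^q(Q)`, `q ∈ (1,∞]` (weak-* if `q = ∞`): testing against `L^{q'}(Q)`. -/
def WeakConv {N : ℕ} (q : ℝ≥0∞) (v : ℕ → (Fin N → ℝ) → ℝ) (u : (Fin N → ℝ) → ℝ) : Prop :=
  (∀ n, MemLp (v n) q (μQ N)) ∧ MemLp u q (μQ N) ∧
  ∀ q' : ℝ≥0∞, q⁻¹ + q'⁻¹ = 1 → ∀ g : (Fin N → ℝ) → ℝ, MemLp g q' (μQ N) →
    Tendsto (fun n => ∫ x in Q N, v n x * g x) atTop (𝓝 (∫ x in Q N, u x * g x))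

end FracTV

end

/-!
An `L^q` bound with `q > 1` gives a weakly convergent subsequence, so for lower semicontinuity it
suffices that each test integrand depends continuously, in the uniform norm, on the order.
Integrating by parts twice, `∂^s_{i,R} f` is the integral of `∂_i² f` against the one-sided kernel
`t^{1-s} / Γ(2-s)`; this formula makes sense up to `s = 1`, where it gives `-∂_i f`, so that the
order may converge to an integer from either side. At an integer order the factor `1/N` in `div^0`
is the only difference between the fractional and the classical variation, which therefore agree up
to the factor `N^{1/p-1}`; this is where the side condition on `N`, `p` and the orders enters. A
bound for one `ℓ^m` norm bounds all of them, by equivalence of norms.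

For strong convergence, test fields with a single entry bound `∫ u ∂_i^{⌊r⌋} ∂^s_{i,R} g`. A
localized Riemann-Liouville kernel is a parametrix for this operator in direction `i`, up to an
integrable error, which turns the bound into an estimate of `∫ u (g - g(· - h e_i))` that is uniform
over orders in a compact subset of `(0,∞)`. By duality `u_n` is then uniformly close in `L^1` of an
inner cube to its mollification, and mollifications converge strongly. Hölder's inequality and the
`L^q` bound keep mass away from the boundary.
-/

noncomputable section

namespace FracTV

section WeakCompactness

variable {α : Type*} [MeasurableSpace α] {μ : Measure α} [IsFiniteMeasure μ] {q q' : ℝ≥0∞}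
  {v : α → ℝ}

theorem sum_indicatorConstLp_eq_biUnion {ι : Type*} {f : ι → Set α}
    (hf : ∀ i, MeasurableSet (f i)) (hd : Pairwise (Function.onFun Disjoint f)) (s : Finset ι) :
    ∑ i ∈ s, indicatorConstLp q' (hf i) (measure_ne_top μ (f i)) (1 : ℝ)
      = indicatorConstLp q' (s.measurableSet_biUnion fun i _ => hf i)
          (measure_ne_top μ (⋃ i ∈ s, f i)) 1 := by
  classical
  induction s using Finset.induction_on with
  | empty =>
    rw [Finset.sum_empty, eq_comm]
    convert! indicatorConstLp_empty (μ := μ) (p := q') (c := (1 : ℝ)) using 2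
    simp
  | insert a s ha ih =>
    have hdisj : Disjoint (f a) (⋃ i ∈ s, f i) :=
      Set.disjoint_iUnion₂_right.2 fun i hi => hd (by rintro rfl; exact ha hi)
    rw [Finset.sum_insert ha, ih, ← indicatorConstLp_disjoint_union (hf a) _
      (measure_ne_top _ _) (measure_ne_top _ _) hdisj]
    congr 1
    simp

theorem hasSum_indicatorConstLp_iUnion [Fact (1 ≤ q')] (hq' : q' ≠ ⊤) {f : ℕ → Set α}
    (hf : ∀ i, MeasurableSet (f i)) (hd : Pairwise (Function.onFun Disjoint f)) :
    HasSum (fun i => indicatorConstLp q' (hf i) (measure_ne_top μ (f i)) (1 : ℝ))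
      (indicatorConstLp q' (MeasurableSet.iUnion hf) (measure_ne_top μ (⋃ i, f i)) 1) := by
  have hsymm : ∀ s : Finset ℕ, μ (symmDiff (⋃ i ∈ s, f i) (⋃ i, f i))
      = μ (⋃ i, f i) - ∑ i ∈ s, μ (f i) := fun s => by
    have hsub : ⋃ i ∈ s, f i ⊆ ⋃ i, f i := Set.iUnion₂_subset fun i _ => Set.subset_iUnion f i
    rw [symmDiff_of_le hsub, measure_sdiff hsub
      (s.measurableSet_biUnion fun i _ => hf i).nullMeasurableSet (measure_ne_top _ _),
      measure_biUnion_finset (fun i _ j _ hij => hd hij) fun i _ => hf i]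
  have hsum : HasSum (fun i => μ (f i)) (μ (⋃ i, f i)) :=
    measure_iUnion hd hf ▸ ENNReal.summable.hasSum
  simp_rw [HasSum, sum_indicatorConstLp_eq_biUnion hf hd]
  refine tendsto_indicatorConstLp_set hq' ?_
  simpa [hsymm] using ENNReal.Tendsto.sub (tendsto_const_nhds (x := μ (⋃ i, f i))) hsum
    (Or.inl (measure_ne_top _ _))

theorem exists_density_of_strongDual [Fact (1 ≤ q')] (hq' : q' ≠ ⊤)
    (Λ : StrongDual ℝ (Lp ℝ q' μ)) :
    ∃ v : α → ℝ, Measurable v ∧ Integrable v μ ∧ ∀ (A : Set α) (hA : MeasurableSet A),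
      Λ (indicatorConstLp q' hA (measure_ne_top μ A) 1) = ∫ x in A, v x ∂μ := by
  classical
  let ν : SignedMeasure α :=
    { measureOf' := fun A => if hA : MeasurableSet A then
        Λ (indicatorConstLp q' hA (measure_ne_top μ A) 1) else 0
      empty' := by simp [indicatorConstLp_empty]
      not_measurable' := fun A hA => by simp [hA]
      m_iUnion' := fun f hf hd => by
        simp only [hf, MeasurableSet.iUnion hf, dite_true]
        exact Λ.hasSum (hasSum_indicatorConstLp_iUnion hq' hf hd) }
  have hν : ∀ (A : Set α) (hA : MeasurableSet A),
      ν A = Λ (indicatorConstLp q' hA (measure_ne_top μ A) 1) := fun A hA => dif_pos hA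
  have hac : ν ≪ᵥ μ.toENNRealVectorMeasure := by
    refine VectorMeasure.AbsolutelyContinuous.mk fun A hA hμA => ?_
    rw [Measure.toENNRealVectorMeasure_apply_measurable hA] at hμA
    have hzero : indicatorConstLp q' hA (measure_ne_top μ A) (1 : ℝ) = 0 :=
      (Lp.eq_zero_iff_ae_eq_zero).2 (indicatorConstLp_coeFn.trans (indicator_meas_zero hμA))
    rw [hν A hA, hzero, map_zero]
  refine ⟨ν.rnDeriv μ, ν.measurable_rnDeriv μ, ν.integrable_rnDeriv μ, fun A hA => ?_⟩
  rw [← hν A hA, ← withDensityᵥ_apply (ν.integrable_rnDeriv μ) hA,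
    ν.withDensityᵥ_rnDeriv_eq μ hac]

omit [IsFiniteMeasure μ] in
theorem integrable_mul_simpleFunc (hv : Integrable v μ) (f : SimpleFunc α ℝ) :
    Integrable (fun x => v x * f x) μ :=
  have ⟨_, hC⟩ := f.exists_forall_norm_le
  hv.mul_bdd f.aestronglyMeasurable (Eventually.of_forall hC)

theorem strongDual_simpleFunc_eq [Fact (1 ≤ q')] {Λ : StrongDual ℝ (Lp ℝ q' μ)}
    (hv : Integrable v μ) (h : ∀ (A : Set α) (hA : MeasurableSet A),
      Λ (indicatorConstLp q' hA (measure_ne_top μ A) 1) = ∫ x in A, v x ∂μ)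
    (f : SimpleFunc α ℝ) :
    Λ ((f.memLp_of_isFiniteMeasure q' μ).toLp f) = ∫ x, v x * f x ∂μ := by
  induction f using SimpleFunc.induction with
  | @const c s hs =>
    have hsmul : ((SimpleFunc.piecewise s hs (SimpleFunc.const α c)
        (SimpleFunc.const α 0)).memLp_of_isFiniteMeasure q' μ).toLp _
        = c • indicatorConstLp q' hs (measure_ne_top μ s) (1 : ℝ) := by
      rw [indicatorConstLp, ← MemLp.toLp_const_smul]
      refine MemLp.toLp_congr _ _ (Eventually.of_forall fun x => ?_)
      by_cases hx : x ∈ s <;> simp [hx]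
    rw [hsmul, map_smul, h s hs, smul_eq_mul, ← integral_const_mul, ← integral_indicator hs]
    refine integral_congr_ae (Eventually.of_forall fun x => ?_)
    by_cases hx : x ∈ s <;> simp [hx, mul_comm]
  | @add f g _ hf hg =>
    have hadd : ((f + g).memLp_of_isFiniteMeasure q' μ).toLp (f + g)
        = (f.memLp_of_isFiniteMeasure q' μ).toLp f + (g.memLp_of_isFiniteMeasure q' μ).toLp g :=
      (MemLp.toLp_add (f.memLp_of_isFiniteMeasure q' μ) (g.memLp_of_isFiniteMeasure q' μ)).symm
    rw [hadd, map_add, hf, hg,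
      ← integral_add (integrable_mul_simpleFunc hv f) (integrable_mul_simpleFunc hv g)]
    simp only [SimpleFunc.coe_add, Pi.add_apply, mul_add]

theorem memLp_top_of_forall_abs_setIntegral_le (hv : Integrable v μ) {C : ℝ}
    (hC : ∀ A, MeasurableSet A → |∫ x in A, v x ∂μ| ≤ C * μ.real A) : MemLp v ⊤ μ := by
  have hle : ∀ A, MeasurableSet A → |∫ x in A, v x ∂μ| ≤ ∫ _ in A, C ∂μ := fun A hA => by
    simpa [mul_comm] using hC A hA
  have hub : v ≤ᵐ[μ] fun _ => C := ae_le_of_forall_setIntegral_le hv (integrable_const C)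
    fun A hA _ => (le_abs_self _).trans (hle A hA)
  have hlb : (fun x => -v x) ≤ᵐ[μ] fun _ => C :=
    ae_le_of_forall_setIntegral_le hv.neg (integrable_const C) fun A hA _ => by
      rw [integral_neg]
      exact (neg_le_abs _).trans (hle A hA)
  refine memLp_top_of_bound hv.aestronglyMeasurable C ?_
  filter_upwards [hub, hlb] with x hub hlb
  exact abs_le.2 ⟨by linarith, hub⟩

theorem rpow_inv_le_of_le_mul_rpow_inv {a b I C : ℝ} (hab : a.HolderConjugate b) (hI : 0 ≤ I)
    (hC : 0 ≤ C) (h : I ≤ C * I ^ b⁻¹) : I ^ a⁻¹ ≤ C := by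
  rcases hI.eq_or_lt with rfl | hI
  · rwa [Real.zero_rpow hab.inv_ne_zero]
  · refine le_of_mul_le_mul_right ?_ (Real.rpow_pos_of_pos hI b⁻¹)
    rwa [← Real.rpow_add hI, hab.inv_add_inv_eq_one, Real.rpow_one]

theorem eLpNorm_simpleFunc_le_of_forall_integral_mul_le [ENNReal.HolderConjugate q q']
    (hq : q ≠ ⊤) (hq' : q' ≠ ⊤) (hvm : Measurable v) (hv : Integrable v μ) {C : ℝ} (hC0 : 0 ≤ C)
    (hC : ∀ f : SimpleFunc α ℝ, ∫ x, v x * f x ∂μ ≤ C * (eLpNorm f q' μ).toReal)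
    {w : SimpleFunc α ℝ} (hw : ∀ x, 0 ≤ w x) (hwv : ∀ x, w x ≤ |v x|) :
    eLpNorm w q μ ≤ ENNReal.ofReal C := by
  have hconj : q.toReal.HolderConjugate q'.toReal :=
    ENNReal.HolderConjugate.toReal_of_ne_top hq hq'
  have hq0 : q ≠ 0 := fun h => by simpa [h] using hconj.pos
  have hq'0 : q' ≠ 0 := fun h => by simpa [h] using hconj.symm.pos
  set a := q.toReal
  set b := q'.toReal
  -- The extremal test function in Hölder's inequality is `sign v * w ^ (q - 1)`.
  let sgn : SimpleFunc α ℝ := SimpleFunc.piecewise {x | 0 ≤ v x}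
    (measurableSet_le measurable_const hvm) (SimpleFunc.const α 1) (SimpleFunc.const α (-1))
  have hsgn : ∀ x, v x * sgn x = |v x| ∧ |sgn x| = 1 := fun x => by
    by_cases hx : 0 ≤ v x
    · simp [sgn, hx, abs_of_nonneg]
    · simp [sgn, hx, abs_of_neg (not_le.1 hx)]
  let g : SimpleFunc α ℝ := sgn * w.map (fun t => t ^ (a - 1))
  have hg : ∀ x, g x = sgn x * w x ^ (a - 1) := fun x => rfl
  have hgpow : ∀ x, ‖g x‖ ^ b = w x ^ a := fun x => by
    rw [hg, norm_mul, Real.norm_eq_abs, (hsgn x).2, one_mul,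
      Real.norm_of_nonneg (Real.rpow_nonneg (hw x) _), ← Real.rpow_mul (hw x),
      hconj.sub_one_mul_conj]
  have hgnorm : (eLpNorm g q' μ).toReal = (∫ x, w x ^ a ∂μ) ^ b⁻¹ := by
    rw [(g.memLp_of_isFiniteMeasure q' μ).eLpNorm_eq_integral_rpow_norm hq'0 hq',
      ENNReal.toReal_ofReal (by positivity)]
    exact congrArg (fun F : α → ℝ => (∫ x, F x ∂μ) ^ b⁻¹) (funext hgpow)
  have hpow : ∀ x, w x ^ a ≤ v x * g x := fun x => calc
    w x ^ a = w x * w x ^ (a - 1) := by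
      rw [← Real.rpow_one_add' (hw x) (by linarith [hconj.pos]), add_sub_cancel]
    _ ≤ |v x| * w x ^ (a - 1) := mul_le_mul_of_nonneg_right (hwv x) (Real.rpow_nonneg (hw x) _)
    _ = v x * g x := by rw [hg, ← (hsgn x).1, mul_assoc]
  have hle : ∫ x, w x ^ a ∂μ ≤ C * (∫ x, w x ^ a ∂μ) ^ b⁻¹ :=
    (integral_mono (w.map fun t => t ^ a).integrable_of_isFiniteMeasure
      (integrable_mul_simpleFunc hv g) hpow).trans (hgnorm ▸ hC g)
  rw [(w.memLp_of_isFiniteMeasure q μ).eLpNorm_eq_integral_rpow_norm hq0 hq]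
  simp_rw [Real.norm_of_nonneg (hw _)]
  exact ENNReal.ofReal_le_ofReal (rpow_inv_le_of_le_mul_rpow_inv hconj
    (integral_nonneg fun x => Real.rpow_nonneg (hw x) _) hC0 hle)

theorem memLp_of_forall_integral_mul_simpleFunc_le [ENNReal.HolderConjugate q q'] (hq' : q' ≠ ⊤)
    (hvm : Measurable v) (hv : Integrable v μ) {C : ℝ} (hC0 : 0 ≤ C)
    (hC : ∀ f : SimpleFunc α ℝ, |∫ x, v x * f x ∂μ| ≤ C * (eLpNorm f q' μ).toReal) :
    MemLp v q μ := by
  rcases eq_or_ne q ⊤ with rfl | hq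
  · obtain rfl : q' = 1 := by
      simpa using (ENNReal.holderConjugate_iff (p := ⊤) (q := q')).1 inferInstance
    refine memLp_top_of_forall_abs_setIntegral_le hv (C := C) fun A hA => ?_
    have h := hC (SimpleFunc.piecewise A hA (SimpleFunc.const α 1) (SimpleFunc.const α 0))
    have hind : ⇑(SimpleFunc.piecewise A hA (SimpleFunc.const α 1) (SimpleFunc.const α (0 : ℝ)))
        = A.indicator fun _ => 1 := by
      ext x
      by_cases hx : x ∈ A <;> simp [hx]
    rw [hind, eLpNorm_indicator_const hA one_ne_zero ENNReal.one_ne_top] at h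
    simpa [← indicator_mul_right, integral_indicator hA, Measure.real] using h
  · let w : ℕ → SimpleFunc α ℝ := fun n =>
      (SimpleFunc.eapprox (fun x => ‖v x‖ₑ) n).map ENNReal.toReal
    have hlim : ∀ x, Tendsto (fun n => w n x) atTop (𝓝 |v x|) := fun x => by
      simpa [w] using! (ENNReal.tendsto_toReal (enorm_ne_top (x := v x))).comp
        (SimpleFunc.tendsto_eapprox hvm.enorm x)
    have hwv : ∀ n x, w n x ≤ |v x| := fun n x => by
      simpa [w] using ENNReal.toReal_mono (enorm_ne_top (x := v x))
        ((le_iSup _ n).trans_eq (SimpleFunc.iSup_eapprox_apply hvm.enorm x))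
    have hw : ∀ n, eLpNorm (w n) q μ ≤ ENNReal.ofReal C := fun n =>
      eLpNorm_simpleFunc_le_of_forall_integral_mul_le hq hq' hvm hv hC0
        (fun f => (le_abs_self _).trans (hC f)) (fun x => ENNReal.toReal_nonneg) (hwv n)
    refine ⟨hvm.aestronglyMeasurable, ?_⟩
    calc eLpNorm v q μ = eLpNorm (fun x => |v x|) q μ := (eLpNorm_norm v).symm
      _ ≤ liminf (fun n => eLpNorm (w n) q μ) atTop := Lp.eLpNorm_lim_le_liminf_eLpNorm
          (fun n => (w n).aestronglyMeasurable) _ (Eventually.of_forall hlim)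
      _ ≤ liminf (fun _ : ℕ => ENNReal.ofReal C) atTop :=
          liminf_le_liminf (Eventually.of_forall hw)
      _ < ⊤ := by simp

omit [IsFiniteMeasure μ] in
theorem lpPairing_toLp_eq_integral [Fact (1 ≤ q)] [Fact (1 ≤ q')] [ENNReal.HolderConjugate q q']
    {g : α → ℝ} (hv : MemLp v q μ) (hg : MemLp g q' μ) :
    (ContinuousLinearMap.mul ℝ ℝ).lpPairing μ q q' (hv.toLp v) (hg.toLp g)
      = ∫ x, v x * g x ∂μ := by
  rw [ContinuousLinearMap.lpPairing_eq_integral]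
  refine integral_congr_ae ?_
  filter_upwards [hv.coeFn_toLp, hg.coeFn_toLp] with x hvx hgx
  simp [hvx, hgx]

theorem exists_eq_lpPairing_of_strongDual [Fact (1 ≤ q')] [Fact (1 ≤ q)]
    [ENNReal.HolderConjugate q q'] (hq' : q' ≠ ⊤) (Λ : StrongDual ℝ (Lp ℝ q' μ)) :
    ∃ (v : α → ℝ) (hv : MemLp v q μ),
      Λ = (ContinuousLinearMap.mul ℝ ℝ).lpPairing μ q q' (hv.toLp v) := by
  obtain ⟨v, hvm, hvint, hΛ⟩ := exists_density_of_strongDual hq' Λ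
  have hsimple := strongDual_simpleFunc_eq hvint hΛ
  have hv : MemLp v q μ := by
    refine memLp_of_forall_integral_mul_simpleFunc_le hq' hvm hvint (norm_nonneg Λ) fun f => ?_
    rw [← hsimple f, ← Lp.norm_toLp]
    exact Λ.le_opNorm _
  refine ⟨v, hv, DFunLike.ext' ((Lp.simpleFunc.denseRange hq').equalizer Λ.continuous
    (ContinuousLinearMap.continuous _) (funext fun f => ?_))⟩
  have hf : (f : Lp ℝ q' μ) = ((Lp.simpleFunc.toSimpleFunc f).memLp_of_isFiniteMeasure q' μ).toLp _
      := congrArg Subtype.val (Lp.simpleFunc.toLp_toSimpleFunc f).symm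
  simp only [Function.comp_apply]
  rw [hf, hsimple, lpPairing_toLp_eq_integral hv]

theorem exists_weakly_convergent_subseq [IsSeparable μ] (hq : 1 < q) {u : ℕ → α → ℝ}
    (hu : ∀ n, AEStronglyMeasurable (u n) μ) {C : ℝ≥0∞} (hC : C ≠ ⊤)
    (hb : ∀ n, eLpNorm (u n) q μ ≤ C) :
    ∃ (v : α → ℝ) (σ : ℕ → ℕ), StrictMono σ ∧ MemLp v q μ ∧
      ∀ q' : ℝ≥0∞, q⁻¹ + q'⁻¹ = 1 → ∀ g : α → ℝ, MemLp g q' μ →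
        Tendsto (fun n => ∫ x, u (σ n) x * g x ∂μ) atTop (𝓝 (∫ x, v x * g x ∂μ)) := by
  have hmem : ∀ n, MemLp (u n) q μ := fun n => ⟨hu n, (hb n).trans_lt hC.lt_top⟩
  have : ENNReal.HolderConjugate q (1 - q⁻¹)⁻¹ :=
    ENNReal.HolderConjugate.inv_one_sub_inv' hq.le
  set q₁ := (1 - q⁻¹)⁻¹
  have : Fact (1 ≤ q) := ⟨hq.le⟩
  have : Fact (1 ≤ q₁) := ⟨ENNReal.HolderConjugate.one_le q₁ q⟩
  have : Fact (q₁ ≠ ⊤) := ⟨((ENNReal.HolderConjugate.lt_top_iff_one_lt q₁ q).2 hq).ne⟩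
  let B := (ContinuousLinearMap.mul ℝ ℝ).lpPairing μ q q₁
  have hball : ∀ n, StrongDual.toWeakDual (B ((hmem n).toLp (u n))) ∈
      WeakDual.toStrongDual ⁻¹' Metric.closedBall (0 : StrongDual ℝ (Lp ℝ q₁ μ))
        (‖B‖ * C.toReal) := fun n => by
    simp only [mem_preimage, Metric.mem_closedBall, dist_zero_right]
    refine (B.le_opNorm _).trans (mul_le_mul_of_nonneg_left ?_ (norm_nonneg _))
    rw [Lp.norm_toLp]
    exact ENNReal.toReal_mono hC (hb n)
  obtain ⟨Λ, _, σ, hσ, hlim⟩ := WeakDual.isSeqCompact_closedBall ℝ (Lp ℝ q₁ μ) 0 _ hball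
  obtain ⟨v, hv, hΛ⟩ :=
    exists_eq_lpPairing_of_strongDual (q := q) Fact.out (WeakDual.toStrongDual Λ)
  refine ⟨v, σ, hσ, hv, fun q' hq' g hg => ?_⟩
  have : ENNReal.HolderConjugate q q' := ENNReal.holderConjugate_iff.2 hq'
  obtain rfl : q₁ = q' := ENNReal.HolderConjugate.unique q q₁ q'
  have hΛg : Λ (hg.toLp g) = ∫ x, v x * g x ∂μ :=
    (DFunLike.congr_fun hΛ (hg.toLp g)).trans (lpPairing_toLp_eq_integral hv hg)
  rw [← hΛg]
  exact (((WeakDual.eval_continuous (𝕜 := ℝ) (hg.toLp g)).tendsto Λ).comp hlim).congr fun n =>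
    lpPairing_toLp_eq_integral (hmem (σ n)) hg

end WeakCompactness

section DualNorm

variable {ι : Type} [Fintype ι] {p q : ℝ≥0∞}

theorem norm_toLp_rpow_toReal (hp : 0 < p.toReal) (x : ι → ℝ) :
    ‖WithLp.toLp p x‖ ^ p.toReal = ∑ i, |x i| ^ p.toReal := by
  rw [PiLp.norm_eq_sum hp, one_div, Real.rpow_inv_rpow _ hp.ne']
  · rfl
  · exact Finset.sum_nonneg fun i _ => by positivity

theorem norm_toLp_le_of_sum_rpow_le (hp : 0 < p.toReal) {x : ι → ℝ} {M : ℝ} (hM : 0 ≤ M)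
    (h : ∑ i, |x i| ^ p.toReal ≤ M ^ p.toReal) : ‖WithLp.toLp p x‖ ≤ M := by
  have hnorm : 0 ≤ ‖WithLp.toLp p x‖ := by
    rw [PiLp.norm_eq_sum hp]
    exact Real.rpow_nonneg (Finset.sum_nonneg fun i _ => by positivity) _
  rwa [← Real.rpow_le_rpow_iff hnorm hM hp, norm_toLp_rpow_toReal hp]

theorem norm_toLp_const_mul (hp : 1 ≤ p) (c : ℝ) (x : ι → ℝ) :
    ‖WithLp.toLp p (fun j => c * x j)‖ = |c| * ‖WithLp.toLp p x‖ := by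
  have : Fact (1 ≤ p) := ⟨hp⟩
  exact norm_smul c (WithLp.toLp p x)

theorem norm_toLp_eq_toReal_eLpNorm (hp : 1 ≤ p) (x : ι → ℝ) :
    ‖WithLp.toLp p x‖ = (eLpNorm x p (@Measure.count ι ⊤)).toReal := by
  let _ : MeasurableSpace ι := ⊤
  rcases eq_or_ne p ⊤ with rfl | hpt
  · rw [PiLp.norm_eq_ciSup, eLpNorm_exponent_top, eLpNormEssSup_count, ENNReal.toReal_iSup]
    · simp
    · simp
  · have hp0 : p ≠ 0 := (zero_lt_one.trans_le hp).ne'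
    have hpr : 0 < p.toReal := ENNReal.toReal_pos hp0 hpt
    rw [PiLp.norm_eq_sum hpr, eLpNorm_eq_lintegral_rpow_enorm_toReal hp0 hpt, lintegral_count,
      tsum_fintype, ← ENNReal.toReal_rpow, ENNReal.toReal_sum]
    · simp [← ENNReal.toReal_rpow]
    · exact fun a _ => ENNReal.rpow_ne_top_of_nonneg hpr.le enorm_ne_top

theorem norm_toLp_anti (hq : 1 ≤ q) (hqp : q ≤ p) (x : ι → ℝ) :
    ‖WithLp.toLp p x‖ ≤ ‖WithLp.toLp q x‖ := by
  have : Fact (1 ≤ q) := ⟨hq⟩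
  set M := ‖WithLp.toLp q x‖
  have hxM : ∀ i, |x i| ≤ M := fun i => PiLp.norm_apply_le (WithLp.toLp q x) i
  have hM : 0 ≤ M := norm_nonneg _
  rcases eq_or_ne p ⊤ with rfl | hpt
  · rw [PiLp.norm_eq_ciSup]
    exact Real.iSup_le hxM hM
  have hqr : 0 < q.toReal :=
    ENNReal.toReal_pos (zero_lt_one.trans_le hq).ne' (ne_top_of_le_ne_top hpt hqp)
  have hle : q.toReal ≤ p.toReal := ENNReal.toReal_mono hpt hqp
  have hsplit : ∀ {t : ℝ}, 0 ≤ t → t ^ (p.toReal - q.toReal) * t ^ q.toReal = t ^ p.toReal :=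
    fun ht => by rw [← Real.rpow_add_of_nonneg ht (sub_nonneg.2 hle) hqr.le, sub_add_cancel]
  refine norm_toLp_le_of_sum_rpow_le (hqr.trans_le hle) hM ?_
  calc ∑ i, |x i| ^ p.toReal = ∑ i, |x i| ^ (p.toReal - q.toReal) * |x i| ^ q.toReal :=
        Finset.sum_congr rfl fun i _ => (hsplit (abs_nonneg _)).symm
    _ ≤ ∑ i, M ^ (p.toReal - q.toReal) * |x i| ^ q.toReal := by
        gcongr with i
        exact hxM i
    _ = M ^ p.toReal := by rw [← Finset.mul_sum, ← norm_toLp_rpow_toReal hqr, hsplit hM]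

theorem norm_toLp_le_card_rpow_mul_of_le (hp : 1 ≤ p) (hpq : p ≤ q) (x : ι → ℝ) :
    ‖WithLp.toLp p x‖ ≤
      (Fintype.card ι : ℝ) ^ ((p⁻¹).toReal - (q⁻¹).toReal) * ‖WithLp.toLp q x‖ := by
  let _ : MeasurableSpace ι := ⊤
  have hq : 1 ≤ q := hp.trans hpq
  have hinv : (q⁻¹).toReal ≤ (p⁻¹).toReal :=
    ENNReal.toReal_mono (by simpa using (zero_lt_one.trans_le hp).ne') (ENNReal.inv_le_inv.2 hpq)
  have hfin : eLpNorm x q Measure.count * Measure.count (univ : Set ι) ^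
      (1 / p.toReal - 1 / q.toReal) ≠ ⊤ := by
    refine ENNReal.mul_ne_top
      ((eLpNorm_count_lt_top (zero_lt_one.trans_le hq).ne').2 fun i => enorm_lt_top).ne
      (ENNReal.rpow_ne_top_of_nonneg (by simpa using hinv) ?_)
    rw [Measure.count_univ]
    simp
  rw [norm_toLp_eq_toReal_eLpNorm hp, norm_toLp_eq_toReal_eLpNorm hq]
  refine (ENNReal.toReal_mono hfin (eLpNorm_le_eLpNorm_mul_rpow_measure_univ hpq
    (measurable_of_finite x).aestronglyMeasurable)).trans_eq ?_
  rw [ENNReal.toReal_mul, ← ENNReal.toReal_rpow, Measure.count_univ, mul_comm]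
  simp

theorem norm_toLp_le_card_rpow_abs_mul [Nonempty ι] (hp : 1 ≤ p) (hq : 1 ≤ q) (x : ι → ℝ) :
    ‖WithLp.toLp p x‖ ≤
      (Fintype.card ι : ℝ) ^ |(p⁻¹).toReal - (q⁻¹).toReal| * ‖WithLp.toLp q x‖ := by
  have hcard : (1 : ℝ) ≤ Fintype.card ι := by exact_mod_cast Fintype.card_pos
  have : Fact (1 ≤ q) := ⟨hq⟩
  rcases le_total q p with h | h
  · exact (norm_toLp_anti hq h x).trans
      (le_mul_of_one_le_left (norm_nonneg _) (Real.one_le_rpow hcard (abs_nonneg _)))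
  · refine (norm_toLp_le_card_rpow_mul_of_le hp h x).trans ?_
    gcongr
    exact le_abs_self _

theorem DualNormLeOne.of_transpose {κ : Type} [Fintype κ] {y : κ → ℝ} (hy : DualNormLeOne q y)
    {z : ι → ℝ} (A : (ι → ℝ) → κ → ℝ)
    (hA : ∀ x, ‖WithLp.toLp q (A x)‖ ≤ ‖WithLp.toLp p x‖)
    (hz : ∀ x, ∑ i, x i * z i = ∑ j, A x j * y j) : DualNormLeOne p z := fun x hx =>
  (hz x).trans_le (hy _ ((hA x).trans hx))

theorem DualNormLeOne.of_norm_le {y : ι → ℝ} (hy : DualNormLeOne q y) {C : ℝ} (hC : 0 < C)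
    (h : ∀ x : ι → ℝ, ‖WithLp.toLp q x‖ ≤ C * ‖WithLp.toLp p x‖) (hq : 1 ≤ q) :
    DualNormLeOne p (fun j => C⁻¹ * y j) := by
  refine hy.of_transpose (fun x j => C⁻¹ * x j) (fun x => ?_)
    fun x => Finset.sum_congr rfl fun j _ => by ring
  rw [norm_toLp_const_mul hq, abs_of_pos (inv_pos.2 hC), inv_mul_le_iff₀ hC]
  exact h x

theorem DualNormLeOne.neg (hp : 1 ≤ p) {y : ι → ℝ} (hy : DualNormLeOne p y) :
    DualNormLeOne p (fun j => -y j) :=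
  hy.of_transpose (fun x j => -1 * x j)
    (fun x => by rw [norm_toLp_const_mul hp, abs_neg, abs_one, one_mul])
    fun x => Finset.sum_congr rfl fun j _ => by ring

theorem dualNormLeOne_single [DecidableEq ι] (hp : 1 ≤ p) (j : ι) {a : ℝ} (ha : |a| ≤ 1) :
    DualNormLeOne p (fun i => if i = j then a else 0) := by
  intro x hx
  have : Fact (1 ≤ p) := ⟨hp⟩
  have hj : |x j| ≤ 1 := (PiLp.norm_apply_le (WithLp.toLp p x) j).trans hx
  simp only [mul_ite, mul_zero, Finset.sum_ite_eq', Finset.mem_univ, if_true]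
  calc x j * a ≤ |x j * a| := le_abs_self _
    _ = |x j| * |a| := abs_mul _ _
    _ ≤ 1 := mul_le_one₀ hj (abs_nonneg _) ha

end DualNorm

section Tensor

variable {N k : ℕ} {p : ℝ≥0∞}

theorem sum_fin_succ_eq {M : Type*} [AddCommMonoid M] (f : (Fin (k + 1) → Fin N) → M) :
    ∑ J, f J = ∑ i, ∑ J : Fin k → Fin N, f (Fin.cons i J) := by
  rw [← Fintype.sum_prod_type']
  exact (Fintype.sum_equiv (Fin.consEquiv fun _ => Fin N) _ _ fun _ => rfl).symm

/-- The factor `N^{1/p-1}` with `fracTV p k = N^{1/p-1} intTV p k` at integer orders `k`. -/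
def intRatio (N : ℕ) (p : ℝ≥0∞) : ℝ := (N : ℝ) ^ ((p⁻¹).toReal - 1)

theorem intRatio_pos (hN : 1 ≤ N) (p : ℝ≥0∞) : 0 < intRatio N p :=
  Real.rpow_pos_of_pos (by exact_mod_cast hN) _

theorem intRatio_le_one (hN : 1 ≤ N) (hp : 1 ≤ p) : intRatio N p ≤ 1 := by
  have : (p⁻¹).toReal ≤ 1 :=
    ENNReal.toReal_mono ENNReal.one_ne_top (ENNReal.inv_le_one.2 hp)
  exact Real.rpow_le_one_of_one_le_of_nonpos (by exact_mod_cast hN) (by linarith)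

theorem intRatio_rpow_toReal (N : ℕ) (hp : 0 < p.toReal) :
    intRatio N p ^ p.toReal = (N : ℝ) ^ (1 - p.toReal) := by
  rw [intRatio, ← Real.rpow_mul N.cast_nonneg, ENNReal.toReal_inv, sub_mul,
    inv_mul_cancel₀ hp.ne', one_mul]

theorem norm_toLp_tail_div_le (hN : 1 ≤ N) (hp : 1 ≤ p) (x : (Fin k → Fin N) → ℝ) :
    ‖WithLp.toLp p (fun J : Fin (k + 1) → Fin N => x (Fin.tail J) / N)‖ ≤
      intRatio N p * ‖WithLp.toLp p x‖ := by
  have hN0 : (0 : ℝ) < N := by exact_mod_cast hN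
  have : Fact (1 ≤ p) := ⟨hp⟩
  have hM : 0 ≤ intRatio N p * ‖WithLp.toLp p x‖ :=
    mul_nonneg (intRatio_pos hN p).le (norm_nonneg _)
  rcases eq_or_ne p ⊤ with rfl | hpt
  · rw [PiLp.norm_eq_ciSup]
    refine Real.iSup_le (fun J => ?_) hM
    simp only [intRatio, ENNReal.inv_top, ENNReal.toReal_zero, zero_sub, Real.rpow_neg_one,
      norm_div, RCLike.norm_natCast]
    rw [div_eq_inv_mul]
    gcongr
    exact PiLp.norm_apply_le (WithLp.toLp (⊤ : ℝ≥0∞) x) (Fin.tail J)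
  · have hpr : 0 < p.toReal := ENNReal.toReal_pos (zero_lt_one.trans_le hp).ne' hpt
    refine norm_toLp_le_of_sum_rpow_le hpr hM (le_of_eq ?_)
    rw [Real.mul_rpow (intRatio_pos hN p).le (norm_nonneg _), norm_toLp_rpow_toReal hpr,
      intRatio_rpow_toReal N hpr, sum_fin_succ_eq, Real.rpow_sub hN0, Real.rpow_one]
    simp only [Fin.tail_cons, abs_div, Nat.abs_cast, Real.div_rpow (abs_nonneg _) hN0.le,
      ← Finset.sum_div, Finset.sum_const, Finset.card_univ, Fintype.card_fin, nsmul_eq_mul]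
    ring

theorem norm_toLp_sum_cons_le (hN : 1 ≤ N) (hp : 1 ≤ p) (y : (Fin (k + 1) → Fin N) → ℝ) :
    ‖WithLp.toLp p (fun J : Fin k → Fin N => ∑ i, y (Fin.cons i J))‖ ≤
      (intRatio N p)⁻¹ * ‖WithLp.toLp p y‖ := by
  have : Fact (1 ≤ p) := ⟨hp⟩
  have hM : 0 ≤ (intRatio N p)⁻¹ * ‖WithLp.toLp p y‖ :=
    mul_nonneg (inv_pos.2 (intRatio_pos hN p)).le (norm_nonneg _)
  rcases eq_or_ne p ⊤ with rfl | hpt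
  · rw [PiLp.norm_eq_ciSup]
    refine Real.iSup_le (fun J => ?_) hM
    have hbound : ∀ i, ‖y (Fin.cons i J)‖ ≤ ‖WithLp.toLp (⊤ : ℝ≥0∞) y‖ := fun i =>
      PiLp.norm_apply_le (WithLp.toLp (⊤ : ℝ≥0∞) y) (Fin.cons i J)
    refine (norm_sum_le_of_le Finset.univ fun i _ => hbound i).trans_eq ?_
    simp [intRatio, Real.rpow_neg_one]
  · have hpr : 0 < p.toReal := ENNReal.toReal_pos (zero_lt_one.trans_le hp).ne' hpt
    have hp1 : 1 ≤ p.toReal := ENNReal.toReal_mono hpt hp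
    refine norm_toLp_le_of_sum_rpow_le hpr hM ?_
    rw [Real.mul_rpow (inv_pos.2 (intRatio_pos hN p)).le (norm_nonneg _),
      norm_toLp_rpow_toReal hpr, Real.inv_rpow (intRatio_pos hN p).le,
      intRatio_rpow_toReal N hpr, ← Real.rpow_neg N.cast_nonneg, neg_sub, sum_fin_succ_eq,
      Finset.sum_comm, Finset.mul_sum]
    refine Finset.sum_le_sum fun J _ => ?_
    calc |∑ i, y (Fin.cons i J)| ^ p.toReal ≤ (∑ i, |y (Fin.cons i J)|) ^ p.toReal :=
          Real.rpow_le_rpow (abs_nonneg _) (Finset.abs_sum_le_sum_abs _ _) hpr.le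
      _ ≤ (N : ℝ) ^ (p.toReal - 1) * ∑ i, |y (Fin.cons i J)| ^ p.toReal := by
          simpa using Real.rpow_sum_le_const_mul_sum_rpow Finset.univ
            (f := fun i : Fin N => y (Fin.cons i J)) hp1

theorem DualNormLeOne.average (hN : 1 ≤ N) (hp : 1 ≤ p) {y : (Fin (k + 1) → Fin N) → ℝ}
    (hy : DualNormLeOne p y) :
    DualNormLeOne p (fun J : Fin k → Fin N =>
      (intRatio N p)⁻¹ * (1 / (N : ℝ) * ∑ i, y (Fin.cons i J))) := by
  have hc := intRatio_pos hN p
  refine hy.of_transpose (fun x J => (intRatio N p)⁻¹ * (x (Fin.tail J) / N)) (fun x => ?_)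
    fun x => ?_
  · rw [norm_toLp_const_mul hp, abs_of_pos (inv_pos.2 hc), inv_mul_le_iff₀ hc]
    exact norm_toLp_tail_div_le hN hp x
  · rw [sum_fin_succ_eq, Finset.sum_comm]
    simp only [Fin.tail_cons, Finset.mul_sum]
    exact Finset.sum_congr rfl fun J _ => Finset.sum_congr rfl fun i _ => by ring

theorem DualNormLeOne.tail (hN : 1 ≤ N) (hp : 1 ≤ p) {y : (Fin k → Fin N) → ℝ}
    (hy : DualNormLeOne p y) :
    DualNormLeOne p (fun J : Fin (k + 1) → Fin N => intRatio N p * y (Fin.tail J)) := by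
  have hc := intRatio_pos hN p
  refine hy.of_transpose (fun x J => intRatio N p * ∑ i, x (Fin.cons i J)) (fun x => ?_)
    fun x => ?_
  · rw [norm_toLp_const_mul hp, abs_of_pos hc, ← le_inv_mul_iff₀ hc]
    exact norm_toLp_sum_cons_le hN hp x
  · rw [sum_fin_succ_eq, Finset.sum_comm]
    simp only [Fin.tail_cons, Finset.mul_sum, Finset.sum_mul]
    exact Finset.sum_congr rfl fun J _ => Finset.sum_congr rfl fun i _ => by ring

end Tensor

section TestFunctions

variable {N k : ℕ} {f g : (Fin N → ℝ) → ℝ} {i : Fin N}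

theorem isOpen_Q : IsOpen (Q N) := isOpen_set_pi finite_univ fun _ _ => isOpen_Ioo

theorem measurableSet_Q : MeasurableSet (Q N) := isOpen_Q.measurableSet

theorem volume_Q : volume (Q N) = 1 := by
  rw [Q, Real.volume_pi_Ioo]
  simp

instance : IsProbabilityMeasure (μQ N) := ⟨by simp [volume_Q]⟩

theorem pos_of_mem_Q {x : Fin N → ℝ} (hx : x ∈ Q N) (i : Fin N) : 0 < x i := (hx i (mem_univ i)).1

theorem add_smul_single_notMem_Q {x : Fin N → ℝ} (hx : 0 < x i) {t : ℝ} (ht : 1 ≤ t) :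
    x + t • (Pi.single i 1 : Fin N → ℝ) ∉ Q N := by
  intro h
  have hlt : x i + t < 1 := by simpa using (h i (mem_univ i)).2
  linarith

theorem contDiff_partialD (hf : ContDiff ℝ ∞ f) (i : Fin N) : ContDiff ℝ ∞ (partialD i f) :=
  (hf.fderiv_right (m := ∞) (by simp)).clm_apply contDiff_const

theorem partialD_const_mul (hf : ContDiff ℝ ∞ f) (c : ℝ) (i : Fin N) :
    partialD i (fun x => c * f x) = fun x => c * partialD i f x := by
  ext x
  simp only [partialD, fderiv_const_mul ((hf.differentiable (by simp)) x)]
  rfl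

theorem partialD_sum {ι : Type*} (s : Finset ι) {F : ι → (Fin N → ℝ) → ℝ}
    (hF : ∀ j ∈ s, ContDiff ℝ ∞ (F j)) (i : Fin N) :
    partialD i (fun x => ∑ j ∈ s, F j x) = fun x => ∑ j ∈ s, partialD i (F j) x := by
  ext x
  simp only [partialD]
  rw [fderiv_fun_sum fun j hj => ((hF j hj).differentiable (by simp)) x, sum_apply]

theorem hasDerivAt_comp_add_smul_single (hf : ContDiff ℝ ∞ f) (x : Fin N → ℝ) (i : Fin N) (t : ℝ) :
    HasDerivAt (fun t : ℝ => f (x + t • Pi.single i 1))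
      (partialD i f (x + t • Pi.single i 1)) t := by
  have hline : HasDerivAt (fun t : ℝ => x + t • (Pi.single i 1 : Fin N → ℝ))
      (Pi.single i 1 : Fin N → ℝ) t := by
    simpa using ((hasDerivAt_id t).smul_const (Pi.single i 1 : Fin N → ℝ)).const_add x
  exact ((hf.differentiable (by simp)) _).hasFDerivAt.comp_hasDerivAt t hline

theorem contDiff_iterDiv : ∀ {k : ℕ} {φ : (Fin k → Fin N) → (Fin N → ℝ) → ℝ},
    (∀ J, ContDiff ℝ ∞ (φ J)) → ContDiff ℝ ∞ (iterDiv k φ)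
  | 0, _, h => h _
  | _ + 1, _, h => ContDiff.sum fun i _ =>
      contDiff_partialD (contDiff_iterDiv fun J => h (Fin.cons i J)) i

theorem iterDiv_const_mul (c : ℝ) : ∀ {k : ℕ} {φ : (Fin k → Fin N) → (Fin N → ℝ) → ℝ},
    (∀ J, ContDiff ℝ ∞ (φ J)) → iterDiv k (fun J x => c * φ J x) = fun x => c * iterDiv k φ x
  | 0, _, _ => rfl
  | k + 1, φ, h => by
    ext x
    simp only [iterDiv, Finset.mul_sum]
    refine Finset.sum_congr rfl fun i _ => ?_
    rw [iterDiv_const_mul c fun J => h (Fin.cons i J),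
      partialD_const_mul (contDiff_iterDiv fun J => h (Fin.cons i J))]

theorem iterDiv_sum {ι : Type*} (s : Finset ι) : ∀ {k : ℕ}
    {φ : ι → (Fin k → Fin N) → (Fin N → ℝ) → ℝ}, (∀ j J, ContDiff ℝ ∞ (φ j J)) →
    iterDiv k (fun J x => ∑ j ∈ s, φ j J x) = fun x => ∑ j ∈ s, iterDiv k (φ j) x
  | 0, _, _ => rfl
  | k + 1, φ, h => by
    ext x
    simp only [iterDiv]
    rw [Finset.sum_comm]
    refine Finset.sum_congr rfl fun i _ => ?_
    rw [iterDiv_sum s fun j J => h j (Fin.cons i J),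
      partialD_sum s fun j _ => contDiff_iterDiv fun J => h j (Fin.cons i J)]

theorem IsTest.hasCompactSupport (hf : IsTest f) : HasCompactSupport f := hf.2.1

theorem IsTest.continuous (hf : IsTest f) : Continuous f := hf.1.continuous

theorem IsTest.eq_zero (hf : IsTest f) {x : Fin N → ℝ} (hx : x ∉ Q N) : f x = 0 :=
  image_eq_zero_of_notMem_tsupport fun h => hx (hf.2.2 h)

theorem IsTest.exists_bound (hf : IsTest f) : ∃ C, 0 ≤ C ∧ ∀ x, |f x| ≤ C := by
  obtain ⟨C, hC⟩ := hf.hasCompactSupport.exists_bound_of_continuous hf.continuous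
  exact ⟨C, (norm_nonneg _).trans (hC 0), hC⟩

theorem IsTest.partialD (hf : IsTest f) (i : Fin N) : IsTest (partialD i f) :=
  ⟨contDiff_partialD hf.1 i, hf.hasCompactSupport.fderiv_apply (𝕜 := ℝ) _,
    (tsupport_fderiv_apply_subset ℝ _).trans hf.2.2⟩

theorem IsTest.zero : IsTest (fun _ : Fin N → ℝ => (0 : ℝ)) :=
  ⟨contDiff_const, HasCompactSupport.zero, by simp [tsupport]⟩

theorem IsTest.add (hf : IsTest f) (hg : IsTest g) : IsTest (fun x => f x + g x) :=
  ⟨hf.1.add hg.1, hf.2.1.add hg.2.1, (tsupport_add f g).trans (union_subset hf.2.2 hg.2.2)⟩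

theorem IsTest.const_mul (hf : IsTest f) (c : ℝ) : IsTest (fun x => c * f x) :=
  ⟨contDiff_const.mul hf.1, hf.2.1.mul_left, tsupport_mul_subset_right.trans hf.2.2⟩

theorem IsTest.neg (hf : IsTest f) : IsTest (fun x => -f x) := by
  simpa using hf.const_mul (-1)

theorem IsTest.sum {ι : Type*} (s : Finset ι) {F : ι → (Fin N → ℝ) → ℝ}
    (hF : ∀ j ∈ s, IsTest (F j)) : IsTest (fun x => ∑ j ∈ s, F j x) := by
  classical
  induction s using Finset.induction_on with
  | empty => simpa using IsTest.zero
  | insert a s ha ih =>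
    simp_rw [Finset.sum_insert ha]
    exact (hF a (Finset.mem_insert_self a s)).add
      (ih fun j hj => hF j (Finset.mem_insert_of_mem hj))

theorem IsTest.iterDiv : ∀ {k : ℕ} {φ : (Fin k → Fin N) → (Fin N → ℝ) → ℝ},
    (∀ J, IsTest (φ J)) → IsTest (iterDiv k φ)
  | 0, _, h => h _
  | _ + 1, _, h => IsTest.sum _ fun i _ => (IsTest.iterDiv fun J => h (Fin.cons i J)).partialD i

end TestFunctions

section RiemannLiouville

variable {s : ℝ} {w w' w'' : ℝ → ℝ} {x : ℝ}

theorem intervalIntegrable_rpow_neg_mul {g : ℝ → ℝ} (hs : s < 1) (hg : Continuous g) (a b : ℝ) :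
    IntervalIntegrable (fun τ : ℝ => τ ^ (-s) * g τ) volume a b :=
  (intervalIntegral.intervalIntegrable_rpow' (by linarith)).mul_continuousOn hg.continuousOn

theorem integral_div_rpow_sub_eq (hs : s < 1) (hw : Continuous w) (hw0 : ∀ t, 1 ≤ t → w t = 0)
    {y : ℝ} (hy : y ∈ Ioo (0 : ℝ) 1) :
    ∫ t in y..1, w t / (t - y) ^ s = ∫ τ in (0 : ℝ)..1, τ ^ (-s) * w (y + τ) := by
  have hint : ∀ a b, IntervalIntegrable (fun τ : ℝ => τ ^ (-s) * w (y + τ)) volume a b :=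
    intervalIntegrable_rpow_neg_mul hs (hw.comp (continuous_const.add continuous_id))
  have hshift : ∫ t in y..1, w t / (t - y) ^ s
      = ∫ τ in (0 : ℝ)..(1 - y), τ ^ (-s) * w (y + τ) := by
    have hsub := intervalIntegral.integral_comp_sub_right (a := y) (b := 1)
      (fun τ => τ ^ (-s) * w (y + τ)) y
    rw [sub_self] at hsub
    rw [← hsub]
    refine intervalIntegral.integral_congr fun t ht => ?_
    rw [uIcc_of_le hy.2.le] at ht
    simp only [add_sub_cancel]
    rw [Real.rpow_neg (sub_nonneg.2 ht.1), div_eq_inv_mul]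
  have htail : ∫ τ in (1 - y)..1, τ ^ (-s) * w (y + τ) = 0 := by
    rw [← intervalIntegral.integral_zero (μ := volume) (a := 1 - y) (b := 1)]
    refine intervalIntegral.integral_congr fun t ht => ?_
    rw [uIcc_of_le (by linarith [hy.1])] at ht
    simp only [hw0 (y + t) (by linarith [ht.1]), mul_zero]
  rw [hshift, ← intervalIntegral.integral_add_adjacent_intervals (hint 0 (1 - y)) (hint (1 - y) 1),
    htail, add_zero]

theorem hasDerivAt_integral_rpow_neg_mul (hs : s < 1) (hw : ∀ t, HasDerivAt w (w' t) t)
    (hw'c : Continuous w') {C : ℝ} (hC : ∀ t, |w' t| ≤ C) :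
    HasDerivAt (fun y => ∫ τ in (0 : ℝ)..1, τ ^ (-s) * w (y + τ))
      (∫ τ in (0 : ℝ)..1, τ ^ (-s) * w' (x + τ)) x := by
  have hwc : Continuous w := continuous_iff_continuousAt.2 fun t => (hw t).continuousAt
  have hint : ∀ (g : ℝ → ℝ), Continuous g → ∀ y,
      IntervalIntegrable (fun τ => τ ^ (-s) * g (y + τ)) volume 0 1 := fun g hg y =>
    intervalIntegrable_rpow_neg_mul hs (hg.comp (continuous_const.add continuous_id)) 0 1
  refine (intervalIntegral.hasDerivAt_integral_of_dominated_loc_of_deriv_le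
    (bound := fun τ => τ ^ (-s) * C) (F := fun y τ => τ ^ (-s) * w (y + τ))
    (F' := fun y τ => τ ^ (-s) * w' (y + τ)) univ_mem
    (Eventually.of_forall fun y => (hint w hwc y).def'.1) (hint w hwc x)
    (hint w' hw'c x).def'.1 ?_ (intervalIntegrable_rpow_neg_mul hs continuous_const 0 1) ?_).2
  · refine Eventually.of_forall fun t ht y _ => ?_
    rw [uIoc_of_le zero_le_one] at ht
    rw [norm_mul, Real.norm_of_nonneg (Real.rpow_nonneg ht.1.le _)]
    exact mul_le_mul_of_nonneg_left (hC _) (Real.rpow_nonneg ht.1.le _)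
  · exact Eventually.of_forall fun t _ y _ => ((hw (y + t)).comp_add_const y t).const_mul _

theorem integral_rpow_neg_mul_deriv_eq (hs : s < 1) (hw' : ∀ t, HasDerivAt w' (w'' t) t)
    (hw''c : Continuous w'') (hx : w' (x + 1) = 0) :
    ∫ τ in (0 : ℝ)..1, τ ^ (-s) * w' (x + τ)
      = -(1 - s)⁻¹ * ∫ τ in (0 : ℝ)..1, τ ^ (1 - s) * w'' (x + τ) := by
  have hs' : 1 - s ≠ 0 := by linarith
  have hw'c : Continuous w' := continuous_iff_continuousAt.2 fun t => (hw' t).continuousAt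
  have hparts := intervalIntegral.integral_mul_deriv_eq_deriv_mul_of_hasDerivAt (a := 0) (b := 1)
    (u := fun τ => w' (x + τ)) (u' := fun τ => w'' (x + τ))
    (v := fun τ => (1 - s)⁻¹ * τ ^ (1 - s)) (v' := fun τ => τ ^ (-s))
    (hw'c.comp (continuous_const.add continuous_id)).continuousOn
    (continuousOn_const.mul (Real.continuous_rpow_const (by linarith)).continuousOn)
    (fun t _ => (hw' (x + t)).comp_const_add x t)
    (fun t ht => by
      simp only [zero_le_one, inf_of_le_left, sup_of_le_right] at ht
      convert! (Real.hasDerivAt_rpow_const (x := t) (p := 1 - s) (Or.inl ht.1.ne')).const_mul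
        (1 - s)⁻¹ using 1
      rw [inv_mul_cancel_left₀ hs', sub_sub_cancel_left])
    ((hw''c.comp (continuous_const.add continuous_id)).intervalIntegrable _ _)
    (intervalIntegral.intervalIntegrable_rpow' (by linarith))
  simp only [hx, Real.zero_rpow hs', zero_mul, mul_zero, sub_self, zero_sub] at hparts
  calc ∫ τ in (0 : ℝ)..1, τ ^ (-s) * w' (x + τ) = ∫ τ in (0 : ℝ)..1, w' (x + τ) * τ ^ (-s) := by
        simp only [mul_comm]
    _ = _ := by
        rw [hparts, ← intervalIntegral.integral_neg, ← intervalIntegral.integral_const_mul]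
        congr 1
        ext
        ring

-- The right-hand side makes sense, and is continuous in `s`, up to and including `s = 1`.
theorem rlRight_eq (hs : s < 1) (hw : ∀ t, HasDerivAt w (w' t) t)
    (hw' : ∀ t, HasDerivAt w' (w'' t) t) (hw''c : Continuous w'') (hw0 : ∀ t, 1 ≤ t → w t = 0)
    (hw0' : ∀ t, 1 ≤ t → w' t = 0) {C : ℝ} (hC : ∀ t, |w' t| ≤ C) (hx : x ∈ Ioo (0 : ℝ) 1) :
    rlRight s w x = (Real.Gamma (2 - s))⁻¹ * ∫ τ in (0 : ℝ)..1, τ ^ (1 - s) * w'' (x + τ) := by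
  have hwc : Continuous w := continuous_iff_continuousAt.2 fun t => (hw t).continuousAt
  have hw'c : Continuous w' := continuous_iff_continuousAt.2 fun t => (hw' t).continuousAt
  have hlocal : (fun y => ∫ t in y..1, w t / (t - y) ^ s) =ᶠ[𝓝 x]
      fun y => ∫ τ in (0 : ℝ)..1, τ ^ (-s) * w (y + τ) := by
    filter_upwards [Ioo_mem_nhds hx.1 hx.2] with y hy using integral_div_rpow_sub_eq hs hwc hw0 hy
  have hΓ : Real.Gamma (2 - s) = (1 - s) * Real.Gamma (1 - s) := by
    rw [← Real.Gamma_add_one (by linarith)]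
    congr 1
    ring
  rw [rlRight, hlocal.deriv_eq, (hasDerivAt_integral_rpow_neg_mul hs hw hw'c hC).deriv,
    integral_rpow_neg_mul_deriv_eq hs hw' hw''c (hw0' _ (by linarith [hx.1])), hΓ, mul_inv, one_div]
  ring

end RiemannLiouville

section DirConv

variable {N : ℕ} {f : (Fin N → ℝ) → ℝ} {i : Fin N} {K : ℝ → ℝ}

/-- Correlation with the kernel `K` in the `i`-th coordinate direction. -/
def dirConv (K : ℝ → ℝ) (i : Fin N) (f : (Fin N → ℝ) → ℝ) (x : Fin N → ℝ) : ℝ :=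
  ∫ t, K t * f (x + t • Pi.single i 1)

/-- The kernel `t^{a-1} / Γ(a)` of the Riemann-Liouville integral of order `a`, cut off at `t = 1`;
test functions on the cube do not see the cut-off. -/
def rlKernel (a : ℝ) : ℝ → ℝ := indicator (Ioc 0 1) fun t => (Real.Gamma a)⁻¹ * t ^ (a - 1)

theorem integrable_rlKernel {a : ℝ} (ha : 0 < a) : Integrable (rlKernel a) := by
  rw [rlKernel, integrable_indicator_iff measurableSet_Ioc]
  have hpow := intervalIntegral.intervalIntegrable_rpow' (a := 0) (b := 1) (r := a - 1)
    (by linarith)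
  rw [intervalIntegrable_iff_integrableOn_Ioc_of_le zero_le_one] at hpow
  exact hpow.const_mul _

theorem dirConv_rlKernel (a : ℝ) (f : (Fin N → ℝ) → ℝ) (i : Fin N) (x : Fin N → ℝ) :
    dirConv (rlKernel a) i f x
      = (Real.Gamma a)⁻¹ * ∫ t in (0 : ℝ)..1, t ^ (a - 1) * f (x + t • Pi.single i 1) := by
  rw [dirConv, intervalIntegral.integral_of_le zero_le_one, ← integral_const_mul,
    ← integral_indicator measurableSet_Ioc]
  congr 1
  ext t
  by_cases ht : t ∈ Ioc (0 : ℝ) 1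
  · simp [rlKernel, ht, mul_assoc]
  · simp [rlKernel, ht]

theorem hasDerivAt_comp_update (hf : ContDiff ℝ ∞ f) (x : Fin N → ℝ) (i : Fin N) (t : ℝ) :
    HasDerivAt (fun t => f (Function.update x i t)) (partialD i f (Function.update x i t)) t :=
  ((hf.differentiable (by simp)) _).hasFDerivAt.comp_hasDerivAt t (hasDerivAt_update x i t)

theorem fracPartial_eq_dirConv {s : ℝ} (hs : s < 1) (hf : IsTest f) (i : Fin N)
    {x : Fin N → ℝ} (hx : x ∈ Q N) :
    fracPartial s i f x = dirConv (rlKernel (2 - s)) i (partialD i (partialD i f)) x := by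
  have hf' := hf.partialD i
  have hupdate : ∀ t, Function.update x i (x i + t) = x + t • (Pi.single i 1 : Fin N → ℝ) := by
    intro t
    ext j
    rcases eq_or_ne j i with rfl | h
    · simp
    · simp [h]
  have hnot : ∀ t, 1 ≤ t → Function.update x i t ∉ Q N := fun t ht h => by
    have hlt : t < 1 := by simpa using (h i (mem_univ i)).2
    linarith
  obtain ⟨C, -, hC⟩ := hf'.exists_bound
  rw [fracPartial, rlRight_eq hs (hasDerivAt_comp_update hf.1 x i)
    (hasDerivAt_comp_update hf'.1 x i) ((hf'.partialD i).continuous.comp (by fun_prop))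
    (fun t ht => hf.eq_zero (hnot t ht)) (fun t ht => hf'.eq_zero (hnot t ht))
    (fun t => hC _) (hx i (mem_univ i)), dirConv_rlKernel]
  simp only [hupdate, show 2 - s - 1 = 1 - s by ring]

theorem continuous_add_smul_single (x : Fin N → ℝ) (i : Fin N) :
    Continuous fun t : ℝ => x + t • (Pi.single i 1 : Fin N → ℝ) := by fun_prop

theorem integrable_dirConv_integrand (hK : Integrable K) (hf : Continuous f) {C : ℝ}
    (hC : ∀ x, |f x| ≤ C) (i : Fin N) (x : Fin N → ℝ) :
    Integrable fun t => K t * f (x + t • Pi.single i 1) :=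
  hK.mul_bdd (hf.comp (continuous_add_smul_single x i)).aestronglyMeasurable
    (Eventually.of_forall fun _ => hC _)

theorem hasFDerivAt_dirConv (hK : Integrable K) (hf : ContDiff ℝ ∞ f) (hc : HasCompactSupport f)
    (i : Fin N) (x : Fin N → ℝ) :
    HasFDerivAt (dirConv K i f) (∫ t, K t • fderiv ℝ f (x + t • Pi.single i 1)) x := by
  have hfd : Continuous (fderiv ℝ f) := hf.continuous_fderiv (by simp)
  obtain ⟨C, hC⟩ := hc.exists_bound_of_continuous hf.continuous
  obtain ⟨C', hC'⟩ := (hc.fderiv (𝕜 := ℝ)).exists_bound_of_continuous hfd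
  have hmeas : AEStronglyMeasurable (fun t : ℝ => fderiv ℝ f (x + t • Pi.single i 1)) volume :=
    (hfd.comp (continuous_add_smul_single x i)).aestronglyMeasurable
  refine hasFDerivAt_integral_of_dominated_of_fderiv_le (bound := fun t => ‖K t‖ * C')
    (F' := fun x t => K t • fderiv ℝ f (x + t • Pi.single i 1)) univ_mem
    (Eventually.of_forall fun y => (integrable_dirConv_integrand hK hf.continuous hC i y).1)
    (integrable_dirConv_integrand hK hf.continuous hC i x)
    (hK.1.smul hmeas) ?_ (hK.norm.mul_const C') ?_
  · refine Eventually.of_forall fun t y _ => ?_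
    rw [norm_smul]
    exact mul_le_mul_of_nonneg_left (hC' _) (norm_nonneg _)
  · exact Eventually.of_forall fun t y _ =>
      (((hf.differentiable (by simp)) _).hasFDerivAt.comp y
        ((hasFDerivAt_id y).add_const (t • Pi.single i 1))).const_mul (K t)

theorem fderiv_dirConv_apply (hK : Integrable K) (hf : ContDiff ℝ ∞ f) (hc : HasCompactSupport f)
    (i : Fin N) (x y : Fin N → ℝ) :
    fderiv ℝ (dirConv K i f) x y = dirConv K i (fun z => fderiv ℝ f z y) x := by
  have hfd : Continuous (fderiv ℝ f) := hf.continuous_fderiv (by simp)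
  obtain ⟨C', hC'⟩ := (hc.fderiv (𝕜 := ℝ)).exists_bound_of_continuous hfd
  rw [(hasFDerivAt_dirConv hK hf hc i x).fderiv, ContinuousLinearMap.integral_apply]
  · rfl
  · exact hK.smul_bdd C' (hfd.comp (continuous_add_smul_single x i)).aestronglyMeasurable
      (Eventually.of_forall fun _ => hC' _)

theorem partialD_dirConv (hK : Integrable K) (hf : ContDiff ℝ ∞ f) (hc : HasCompactSupport f)
    (i j : Fin N) : partialD j (dirConv K i f) = dirConv K i (partialD j f) :=
  funext fun x => fderiv_dirConv_apply hK hf hc i x _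

theorem contDiff_dirConv (hK : Integrable K) (hf : ContDiff ℝ ∞ f) (hc : HasCompactSupport f)
    (i : Fin N) : ContDiff ℝ ∞ (dirConv K i f) := by
  rw [contDiff_infty]
  intro n
  induction n generalizing f with
  | zero =>
    rw [Nat.cast_zero, contDiff_zero]
    exact continuous_iff_continuousAt.2 fun x => (hasFDerivAt_dirConv hK hf hc i x).continuousAt
  | succ n ih =>
    rw [Nat.cast_succ, contDiff_succ_iff_fderiv_apply]
    refine ⟨fun x => (hasFDerivAt_dirConv hK hf hc i x).differentiableAt, by simp, fun y => ?_⟩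
    simp_rw [fderiv_dirConv_apply hK hf hc]
    exact ih ((hf.fderiv_right (m := ∞) (by simp)).clm_apply contDiff_const)
      (hc.fderiv_apply (𝕜 := ℝ) y)

theorem abs_dirConv_le (hK : Integrable K) {C : ℝ} (hC : ∀ x, |f x| ≤ C) (i : Fin N)
    (x : Fin N → ℝ) : |dirConv K i f x| ≤ (∫ t, |K t|) * C := by
  rw [← integral_mul_const]
  refine norm_integral_le_of_norm_le (f := fun t => K t * f (x + t • Pi.single i 1))
    (hK.abs.mul_const C) (Eventually.of_forall fun t => ?_)
  rw [norm_mul]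
  exact mul_le_mul_of_nonneg_left (hC _) (abs_nonneg _)

end DirConv

section UniformConvergence

variable {ι α : Type*} {l : Filter ι}

theorem tendstoUniformly_iff_tendsto_sub {F : ι → α → ℝ} {F₀ : α → ℝ} :
    TendstoUniformly F F₀ l ↔ Tendsto (fun q : ι × α => F q.1 q.2 - F₀ q.2) (l ×ˢ ⊤) (𝓝 0) := by
  rw [tendstoUniformly_iff_tendsto, uniformity_eq_comap_nhds_zero, tendsto_comap_iff]
  rfl

theorem tendstoUniformly_mul_of_bounded {c : ι → ℝ} {c₀ : ℝ} {F : ι → α → ℝ} {F₀ : α → ℝ}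
    (hc : Tendsto c l (𝓝 c₀)) (hF : TendstoUniformly F F₀ l) (hF₀ : ∃ B, ∀ x, |F₀ x| ≤ B) :
    TendstoUniformly (fun n x => c n * F n x) (fun x => c₀ * F₀ x) l := by
  obtain ⟨B, hB⟩ := hF₀
  have hc' : Tendsto (fun q : ι × α => c q.1) (l ×ˢ ⊤) (𝓝 c₀) := hc.comp tendsto_fst
  rw [tendstoUniformly_iff_tendsto_sub] at hF ⊢
  have hbdd : Tendsto (fun q : ι × α => (c q.1 - c₀) * F₀ q.2) (l ×ˢ ⊤) (𝓝 0) := by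
    refine squeeze_zero_norm (a := fun q => |c q.1 - c₀| * B) (fun q => ?_) ?_
    · rw [norm_mul]
      exact mul_le_mul_of_nonneg_left (hB _) (abs_nonneg _)
    · simpa using (hc'.sub_const c₀).abs.mul_const B
  have hsum := (hc'.mul hF).add hbdd
  rw [mul_zero, add_zero] at hsum
  exact hsum.congr fun q => by ring

theorem tendstoUniformly_sum {κ : Type*} (s : Finset κ) {F : κ → ι → α → ℝ} {F₀ : κ → α → ℝ}
    (hF : ∀ j ∈ s, TendstoUniformly (F j) (F₀ j) l) :
    TendstoUniformly (fun n x => ∑ j ∈ s, F j n x) (fun x => ∑ j ∈ s, F₀ j x) l := by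
  simp only [tendstoUniformly_iff_tendsto_sub, ← Finset.sum_sub_distrib] at hF ⊢
  simpa using tendsto_finsetSum s hF

theorem exists_bound_sum {κ : Type*} (s : Finset κ) {F : κ → α → ℝ}
    (hF : ∀ j ∈ s, ∃ B, ∀ x, |F j x| ≤ B) : ∃ B, ∀ x, |∑ j ∈ s, F j x| ≤ B := by
  choose! B hB using hF
  exact ⟨∑ j ∈ s, B j, fun x =>
    (Finset.abs_sum_le_sum_abs _ _).trans (Finset.sum_le_sum fun j hj => hB j hj x)⟩

end UniformConvergence

section ExtendedDivergence

variable {N k : ℕ} {f : (Fin N → ℝ) → ℝ} {i : Fin N} {ι : Type*} {l : Filter ι}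

theorem abs_rlKernel_le {a B : ℝ} (ha : 1 ≤ a) (hB : (Real.Gamma a)⁻¹ ≤ B) (t : ℝ) :
    |rlKernel a t| ≤ (Ioc (0 : ℝ) 1).indicator (fun _ => B) t := by
  have hΓ : 0 < (Real.Gamma a)⁻¹ := inv_pos.2 (Real.Gamma_pos_of_pos (by linarith))
  by_cases ht : t ∈ Ioc (0 : ℝ) 1
  · simp only [rlKernel, indicator_of_mem ht]
    rw [abs_of_nonneg (mul_nonneg hΓ.le (Real.rpow_nonneg ht.1.le _))]
    exact (mul_le_of_le_one_right hΓ.le (Real.rpow_le_one ht.1.le ht.2 (by linarith))).trans hB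
  · simp [rlKernel, indicator_of_notMem ht]

theorem tendsto_inv_Gamma {a : ι → ℝ} {a₀ : ℝ} (ha₀ : 0 < a₀) (hlim : Tendsto a l (𝓝 a₀)) :
    Tendsto (fun n => (Real.Gamma (a n))⁻¹) l (𝓝 (Real.Gamma a₀)⁻¹) := by
  have hcont : ContinuousAt Real.Gamma a₀ := (Real.differentiableAt_Gamma fun m => by
    have : (0 : ℝ) ≤ m := m.cast_nonneg
    linarith).continuousAt
  exact (hcont.tendsto.comp hlim).inv₀ (Real.Gamma_pos_of_pos ha₀).ne'

theorem tendsto_rlKernel {a : ι → ℝ} {a₀ : ℝ} (ha₀ : 0 < a₀) (hlim : Tendsto a l (𝓝 a₀)) (t : ℝ) :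
    Tendsto (fun n => rlKernel (a n) t) l (𝓝 (rlKernel a₀ t)) := by
  by_cases ht : t ∈ Ioc (0 : ℝ) 1
  · simp only [rlKernel, indicator_of_mem ht]
    exact (tendsto_inv_Gamma ha₀ hlim).mul
      ((Real.continuousAt_const_rpow ht.1.ne').tendsto.comp (hlim.sub_const 1))
  · simp [rlKernel, indicator_of_notMem ht, tendsto_const_nhds]

theorem tendsto_integral_abs_rlKernel_sub [l.IsCountablyGenerated] {a : ι → ℝ} {a₀ : ℝ}
    (ha₀ : 1 ≤ a₀) (ha : ∀ᶠ n in l, 1 ≤ a n) (hlim : Tendsto a l (𝓝 a₀)) :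
    Tendsto (fun n => ∫ t, |rlKernel (a n) t - rlKernel a₀ t|) l (𝓝 0) := by
  set B := (Real.Gamma a₀)⁻¹ + 1
  let dom : ℝ → ℝ := (Ioc (0 : ℝ) 1).indicator fun _ => B
  have hdom : Integrable dom :=
    (integrable_indicator_iff measurableSet_Ioc).2 (integrableOn_const (by simp))
  have hB : ∀ᶠ n in l, (Real.Gamma (a n))⁻¹ ≤ B := by
    filter_upwards [(tendsto_inv_Gamma (by linarith) hlim).eventually
      (gt_mem_nhds (lt_add_one _))] with n hn using hn.le
  rw [show (0 : ℝ) = ∫ _ : ℝ, (0 : ℝ) by simp]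
  refine tendsto_integral_filter_of_dominated_convergence (fun t => dom t + dom t) ?_ ?_
    (hdom.add hdom) (Eventually.of_forall fun t => ?_)
  · filter_upwards [ha] with n hn
    exact ((integrable_rlKernel (by linarith)).sub (integrable_rlKernel (by linarith))).abs.1
  · filter_upwards [ha, hB] with n hn hnB
    refine Eventually.of_forall fun t => ?_
    rw [Real.norm_eq_abs, abs_abs]
    exact (abs_sub _ _).trans (add_le_add (abs_rlKernel_le hn hnB t)
      (abs_rlKernel_le ha₀ (lt_add_one _).le t))
  · simpa using ((tendsto_rlKernel (by linarith) hlim t).sub_const (rlKernel a₀ t)).abs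

theorem abs_dirConv_sub_le {K K' : ℝ → ℝ} (hK : Integrable K) (hK' : Integrable K')
    (hf : Continuous f) {C : ℝ} (hC : ∀ x, |f x| ≤ C) (i : Fin N) (x : Fin N → ℝ) :
    |dirConv K i f x - dirConv K' i f x| ≤ (∫ t, |K t - K' t|) * C := by
  have hsub : dirConv K i f x - dirConv K' i f x = dirConv (fun t => K t - K' t) i f x := by
    simp only [dirConv, sub_mul]
    rw [← integral_sub (integrable_dirConv_integrand hK hf hC i x)
      (integrable_dirConv_integrand hK' hf hC i x)]
  rw [hsub]
  exact abs_dirConv_le (hK.sub hK') hC i x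

theorem tendstoUniformly_dirConv {K : ι → ℝ → ℝ} {K₀ : ℝ → ℝ} (hK : ∀ᶠ n in l, Integrable (K n))
    (hK₀ : Integrable K₀) (hlim : Tendsto (fun n => ∫ t, |K n t - K₀ t|) l (𝓝 0))
    (hf : Continuous f) (hbdd : ∃ C, ∀ x, |f x| ≤ C) (i : Fin N) :
    TendstoUniformly (fun n => dirConv (K n) i f) (dirConv K₀ i f) l := by
  obtain ⟨C, hC⟩ := hbdd
  have hlimC : Tendsto (fun n => (∫ t, |K n t - K₀ t|) * C) l (𝓝 0) := by
    simpa using hlim.mul_const C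
  rw [Metric.tendstoUniformly_iff]
  intro ε hε
  filter_upwards [hK, hlimC.eventually (gt_mem_nhds hε)] with n hKn hn x
  rw [dist_comm]
  exact (abs_dirConv_sub_le hKn hK₀ hf hC i x).trans_lt hn

theorem dirConv_rlKernel_one_partialD (hf : IsTest f) {x : Fin N → ℝ} (hx : 0 < x i) :
    dirConv (rlKernel 1) i (partialD i f) x = -f x := by
  rw [dirConv_rlKernel]
  simp only [Real.Gamma_one, inv_one, one_mul, sub_self, Real.rpow_zero]
  rw [intervalIntegral.integral_eq_sub_of_hasDerivAt (f := fun t => f (x + t • Pi.single i 1))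
    (fun t _ => hasDerivAt_comp_add_smul_single hf.1 x i t)
    (((hf.partialD i).continuous.comp (continuous_add_smul_single x i)).intervalIntegrable _ _),
    hf.eq_zero (add_smul_single_notMem_Q hx le_rfl)]
  simp

theorem dirConv_rlKernel_succ_partialD (hf : IsTest f) {x : Fin N → ℝ} (hx : 0 < x i) {a : ℝ}
    (ha : 1 ≤ a) :
    dirConv (rlKernel (a + 1)) i (partialD i f) x = -dirConv (rlKernel a) i f x := by
  have ha0 : a ≠ 0 := by linarith
  have hpow : Continuous fun t : ℝ => t ^ (a - 1) := Real.continuous_rpow_const (by linarith)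
  have hparts := intervalIntegral.integral_mul_deriv_eq_deriv_mul_of_hasDerivAt (a := 0) (b := 1)
    (u := fun t : ℝ => t ^ a) (u' := fun t => a * t ^ (a - 1))
    (v := fun t => f (x + t • Pi.single i 1))
    (v' := fun t => partialD i f (x + t • Pi.single i 1))
    (Real.continuous_rpow_const (by linarith)).continuousOn
    (hf.continuous.comp (continuous_add_smul_single x i)).continuousOn
    (fun t _ => Real.hasDerivAt_rpow_const (Or.inr ha))
    (fun t _ => hasDerivAt_comp_add_smul_single hf.1 x i t)
    ((hpow.const_mul a).intervalIntegrable _ _)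
    (((hf.partialD i).continuous.comp (continuous_add_smul_single x i)).intervalIntegrable _ _)
  rw [hf.eq_zero (add_smul_single_notMem_Q hx le_rfl), Real.zero_rpow ha0] at hparts
  simp only [mul_zero, zero_mul, sub_zero, zero_sub, mul_assoc a] at hparts
  rw [dirConv_rlKernel, dirConv_rlKernel, Real.Gamma_add_one ha0, add_sub_cancel_right, hparts,
    intervalIntegral.integral_const_mul, mul_inv]
  field_simp

/-- The operator `div^s div^k`, with the fractional derivatives written as fractional integrals of
second derivatives: this makes sense also for `s = 1`, where it is `-div^{k+1}`. -/
def extDiv (s : ℝ) (k : ℕ) (φ : (Fin (k + 1) → Fin N) → (Fin N → ℝ) → ℝ) (x : Fin N → ℝ) : ℝ :=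
  ((1 - 1 / (N : ℝ)) * s + 1 / (N : ℝ)) * ∑ i, dirConv (rlKernel (2 - s)) i
    (partialD i (partialD i (iterDiv k fun J => φ (Fin.cons i J)))) x

variable {s : ℝ} {φ : (Fin (k + 1) → Fin N) → (Fin N → ℝ) → ℝ}

theorem fracIterDiv_eq_extDiv (hs : s < 1) (hφ : ∀ J, IsTest (φ J)) {x : Fin N → ℝ}
    (hx : x ∈ Q N) : fracIterDiv s k φ x = extDiv s k φ x := by
  simp only [fracIterDiv, fracDiv, extDiv]
  congr 1
  exact Finset.sum_congr rfl fun i _ =>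
    fracPartial_eq_dirConv hs (IsTest.iterDiv fun J => hφ (Fin.cons i J)) i hx

theorem extDiv_zero (hφ : ∀ J, IsTest (φ J)) {x : Fin N → ℝ} (hx : x ∈ Q N) :
    extDiv 0 k φ x = 1 / (N : ℝ) * ∑ i, iterDiv k (fun J => φ (Fin.cons i J)) x := by
  simp only [extDiv, mul_zero, zero_add]
  congr 1
  refine Finset.sum_congr rfl fun i _ => ?_
  have ht := IsTest.iterDiv fun J => hφ (Fin.cons i J)
  rw [show (2 - 0 : ℝ) = 1 + 1 by norm_num, dirConv_rlKernel_succ_partialD (ht.partialD i)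
    (pos_of_mem_Q hx i) le_rfl, dirConv_rlKernel_one_partialD ht (pos_of_mem_Q hx i), neg_neg]

theorem extDiv_one (hφ : ∀ J, IsTest (φ J)) {x : Fin N → ℝ} (hx : x ∈ Q N) :
    extDiv 1 k φ x = -iterDiv (k + 1) φ x := by
  simp only [extDiv, mul_one, sub_add_cancel, one_mul, iterDiv, ← Finset.sum_neg_distrib]
  refine Finset.sum_congr rfl fun i _ => ?_
  have ht := IsTest.iterDiv fun J => hφ (Fin.cons i J)
  rw [show (2 - 1 : ℝ) = 1 by norm_num, dirConv_rlKernel_one_partialD (ht.partialD i)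
    (pos_of_mem_Q hx i)]

theorem dirConv_const_mul (K : ℝ → ℝ) (i : Fin N) (c : ℝ) (f : (Fin N → ℝ) → ℝ)
    (x : Fin N → ℝ) : dirConv K i (fun x => c * f x) x = c * dirConv K i f x := by
  simp only [dirConv, mul_left_comm _ c, integral_const_mul]

theorem extDiv_const_mul (s c : ℝ) (hφ : ∀ J, IsTest (φ J)) (x : Fin N → ℝ) :
    extDiv s k (fun J x => c * φ J x) x = c * extDiv s k φ x := by
  simp only [extDiv, Finset.mul_sum]
  refine Finset.sum_congr rfl fun i _ => ?_
  have ht := IsTest.iterDiv fun J => hφ (Fin.cons i J)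
  rw [iterDiv_const_mul c fun J => (hφ (Fin.cons i J)).1, partialD_const_mul ht.1,
    partialD_const_mul (ht.partialD i).1, dirConv_const_mul]
  ring

theorem continuous_extDiv (hs : s ≤ 1) (hφ : ∀ J, IsTest (φ J)) :
    Continuous (extDiv s k φ) := by
  refine continuous_const.mul (continuous_finsetSum _ fun i _ => ?_)
  have ht := ((IsTest.iterDiv fun J => hφ (Fin.cons i J)).partialD i).partialD i
  exact (contDiff_dirConv (integrable_rlKernel (by linarith)) ht.1 ht.2.1 i).continuous

theorem exists_bound_sum_dirConv_rlKernel {F : Fin N → (Fin N → ℝ) → ℝ} (hF : ∀ i, IsTest (F i))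
    {a : ℝ} (ha : 0 < a) : ∃ B, ∀ x, |∑ i, dirConv (rlKernel a) i (F i) x| ≤ B :=
  exists_bound_sum _ fun i _ =>
    let ⟨_, _, hC⟩ := (hF i).exists_bound
    ⟨_, abs_dirConv_le (integrable_rlKernel ha) hC i⟩

theorem exists_bound_extDiv (hs : s ≤ 1) (hφ : ∀ J, IsTest (φ J)) :
    ∃ B, ∀ x, |extDiv s k φ x| ≤ B := by
  obtain ⟨B, hB⟩ := exists_bound_sum_dirConv_rlKernel (a := 2 - s)
    (fun i => ((IsTest.iterDiv fun J => hφ (Fin.cons i J)).partialD i).partialD i) (by linarith)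
  refine ⟨|(1 - 1 / (N : ℝ)) * s + 1 / (N : ℝ)| * B, fun x => ?_⟩
  rw [extDiv, abs_mul]
  exact mul_le_mul_of_nonneg_left (hB x) (abs_nonneg _)

theorem tendstoUniformly_extDiv [l.IsCountablyGenerated] {s : ι → ℝ} {s₀ : ℝ} (hs₀ : s₀ ≤ 1)
    (hs : ∀ᶠ n in l, s n ≤ 1) (hlim : Tendsto s l (𝓝 s₀)) (hφ : ∀ J, IsTest (φ J)) :
    TendstoUniformly (fun n => extDiv (s n) k φ) (extDiv s₀ k φ) l := by
  have ht := fun i => ((IsTest.iterDiv fun J => hφ (Fin.cons i J)).partialD i).partialD i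
  have hK : ∀ᶠ n in l, Integrable (rlKernel (2 - s n)) := by
    filter_upwards [hs] with n hn using integrable_rlKernel (by linarith)
  have hlimK := tendsto_integral_abs_rlKernel_sub (a₀ := 2 - s₀) (by linarith)
    (hs.mono fun n hn => by linarith) (hlim.const_sub 2)
  refine tendstoUniformly_mul_of_bounded
    ((hlim.const_mul (1 - 1 / (N : ℝ))).add_const (1 / (N : ℝ)))
    (tendstoUniformly_sum _ fun i _ => ?_) (exists_bound_sum_dirConv_rlKernel ht (by linarith))
  obtain ⟨C, -, hC⟩ := (ht i).exists_bound
  exact tendstoUniformly_dirConv hK (integrable_rlKernel (by linarith)) hlimK (ht i).continuous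
    ⟨C, hC⟩ i

end ExtendedDivergence

section SplitVariation

variable {N m k : ℕ} {p q : ℝ≥0∞} {s : ℝ}

/-- The total variation of order `k + s`, with `k` and `s` as separate arguments. -/
def splitTV (p : ℝ≥0∞) (s : ℝ) (k : ℕ) (u : (Fin N → ℝ) → ℝ) : ℝ≥0∞ :=
  ⨆ (φ : (Fin (k + 1) → Fin N) → (Fin N → ℝ) → ℝ) (_ : Admissible p (k + 1) φ),
    ENNReal.ofReal (∫ x in Q N, u x * fracIterDiv s k φ x)

theorem fracTV_eq_splitTV (p : ℝ≥0∞) {r : ℝ} (hk : ⌊r⌋₊ = k) (u : (Fin N → ℝ) → ℝ) :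
    fracTV p r u = splitTV p (r - k) k u := by
  subst hk; rfl

theorem setIntegral_mul_fracIterDiv (hs : s < 1) (u : (Fin N → ℝ) → ℝ)
    {φ : (Fin (k + 1) → Fin N) → (Fin N → ℝ) → ℝ} (hφ : ∀ J, IsTest (φ J)) :
    ∫ x in Q N, u x * fracIterDiv s k φ x = ∫ x in Q N, u x * extDiv s k φ x :=
  setIntegral_congr_fun measurableSet_Q fun x hx => by simp only [fracIterDiv_eq_extDiv hs hφ hx]

theorem le_splitTV (hs : s < 1) {u : (Fin N → ℝ) → ℝ}
    {φ : (Fin (k + 1) → Fin N) → (Fin N → ℝ) → ℝ} (hφ : Admissible p (k + 1) φ) :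
    ENNReal.ofReal (∫ x in Q N, u x * extDiv s k φ x) ≤ splitTV p s k u := by
  rw [← setIntegral_mul_fracIterDiv hs u hφ.1]
  exact le_iSup₂ (f := fun φ (_ : Admissible p (k + 1) φ) =>
    ENNReal.ofReal (∫ x in Q N, u x * fracIterDiv s k φ x)) φ hφ

theorem splitTV_le (hs : s < 1) {u : (Fin N → ℝ) → ℝ} {T : ℝ≥0∞}
    (h : ∀ φ : (Fin (k + 1) → Fin N) → (Fin N → ℝ) → ℝ, Admissible p (k + 1) φ →
      ENNReal.ofReal (∫ x in Q N, u x * extDiv s k φ x) ≤ T) : splitTV p s k u ≤ T :=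
  iSup₂_le fun φ hφ => (setIntegral_mul_fracIterDiv hs u hφ.1).symm ▸ h φ hφ

theorem le_intTV {u : (Fin N → ℝ) → ℝ} {φ : (Fin k → Fin N) → (Fin N → ℝ) → ℝ}
    (hφ : Admissible p k φ) :
    ENNReal.ofReal (∫ x in Q N, u x * iterDiv k φ x) ≤ intTV p k u :=
  le_iSup₂ (f := fun φ (_ : Admissible p k φ) =>
    ENNReal.ofReal (∫ x in Q N, u x * iterDiv k φ x)) φ hφ

/-- The factor comparing the constraints `|φ|^*_{ℓ^p} ≤ 1` and `|φ|^*_{ℓ^q} ≤ 1` for tensors with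
`N^m` entries. -/
def cmpFactor (N m : ℕ) (p q : ℝ≥0∞) : ℝ :=
  (((N : ℝ) ^ m) ^ |(q⁻¹).toReal - (p⁻¹).toReal|)⁻¹

theorem cmpFactor_pos (hN : 1 ≤ N) (m : ℕ) (p q : ℝ≥0∞) : 0 < cmpFactor N m p q :=
  inv_pos.2 (Real.rpow_pos_of_pos (pow_pos (by exact_mod_cast hN) _) _)

theorem inv_cmpFactor_le (hN : 1 ≤ N) (m : ℕ) (hp : 1 ≤ p) (hq : 1 ≤ q) :
    (cmpFactor N m p q)⁻¹ ≤ (N : ℝ) ^ m := by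
  have toReal_inv_le_one : ∀ {a : ℝ≥0∞}, 1 ≤ a → (a⁻¹).toReal ≤ 1 := fun ha =>
    ENNReal.toReal_mono ENNReal.one_ne_top (ENNReal.inv_le_one.2 ha)
  have hexp : |(q⁻¹).toReal - (p⁻¹).toReal| ≤ 1 :=
    abs_sub_le_of_nonneg_of_le ENNReal.toReal_nonneg (toReal_inv_le_one hq)
      ENNReal.toReal_nonneg (toReal_inv_le_one hp)
  rw [cmpFactor, inv_inv]
  exact (Real.rpow_le_rpow_of_exponent_le (one_le_pow₀ (by exact_mod_cast hN)) hexp).trans_eq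
    (Real.rpow_one _)

theorem tendsto_cmpFactor (hN : 1 ≤ N) (m : ℕ) {ι : Type*} {l : Filter ι} {P : ι → ℝ≥0∞}
    (hp : p ≠ 0) (hlim : Tendsto P l (𝓝 p)) :
    Tendsto (fun n => cmpFactor N m (P n) p) l (𝓝 1) := by
  have hD : (0 : ℝ) < (N : ℝ) ^ m := pow_pos (by exact_mod_cast hN) _
  have hinv : Tendsto (fun n => ((P n)⁻¹).toReal) l (𝓝 (p⁻¹).toReal) :=
    (ENNReal.tendsto_toReal (ENNReal.inv_ne_top.2 hp)).comp
      ((continuous_inv.tendsto p).comp hlim)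
  have hexp : Tendsto (fun n => |(p⁻¹).toReal - ((P n)⁻¹).toReal|) l (𝓝 0) := by
    simpa using (hinv.const_sub (p⁻¹).toReal).abs
  simpa [cmpFactor, Function.comp_def] using
    ((Real.continuousAt_const_rpow hD.ne').tendsto.comp hexp).inv₀ (by simp)

theorem Admissible.scale (hN : 1 ≤ N) (hp : 1 ≤ p) (hq : 1 ≤ q)
    {φ : (Fin m → Fin N) → (Fin N → ℝ) → ℝ} (hφ : Admissible q m φ) :
    Admissible p m (fun J x => cmpFactor N m p q * φ J x) := by
  have : NeZero N := ⟨by omega⟩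
  refine ⟨fun J => (hφ.1 J).const_mul _, fun x => (hφ.2 x).of_norm_le
    (inv_pos.1 (cmpFactor_pos hN m p q)) (fun y => ?_) hq⟩
  simpa using norm_toLp_le_card_rpow_abs_mul hq hp y

theorem Admissible.neg (hp : 1 ≤ p) {φ : (Fin m → Fin N) → (Fin N → ℝ) → ℝ}
    (hφ : Admissible p m φ) : Admissible p m (fun J x => -φ J x) :=
  ⟨fun J => (hφ.1 J).neg, fun x => (hφ.2 x).neg hp⟩

theorem splitTV_le_mul (hN : 1 ≤ N) (hp : 1 ≤ p) (hq : 1 ≤ q) (hs : s < 1) (k : ℕ)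
    (u : (Fin N → ℝ) → ℝ) :
    splitTV q s k u ≤ ENNReal.ofReal ((N : ℝ) ^ (k + 1)) * splitTV p s k u := by
  refine splitTV_le hs fun φ hφ => ?_
  set c := cmpFactor N (k + 1) p q
  have hc : 0 < c := cmpFactor_pos hN (k + 1) p q
  calc ENNReal.ofReal (∫ x in Q N, u x * extDiv s k φ x)
      = ENNReal.ofReal c⁻¹ *
          ENNReal.ofReal (∫ x in Q N, u x * extDiv s k (fun J x => c * φ J x) x) := by
        rw [← ENNReal.ofReal_mul (inv_nonneg.2 hc.le), ← integral_const_mul]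
        simp only [extDiv_const_mul _ _ hφ.1]
        field_simp
    _ ≤ ENNReal.ofReal ((N : ℝ) ^ (k + 1)) * splitTV p s k u := by
        gcongr
        exacts [inv_cmpFactor_le hN _ hp hq, le_splitTV hs (hφ.scale hN hp hq)]

/-- The average of a tensor field over its first index. -/
def avgFirst (φ : (Fin (k + 1) → Fin N) → (Fin N → ℝ) → ℝ) (J : Fin k → Fin N)
    (x : Fin N → ℝ) : ℝ := 1 / (N : ℝ) * ∑ i, φ (Fin.cons i J) x

theorem isTest_avgFirst {φ : (Fin (k + 1) → Fin N) → (Fin N → ℝ) → ℝ} (hφ : ∀ J, IsTest (φ J))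
    (J : Fin k → Fin N) : IsTest (avgFirst φ J) :=
  (IsTest.sum _ fun i _ => hφ (Fin.cons i J)).const_mul _

theorem iterDiv_avgFirst {φ : (Fin (k + 1) → Fin N) → (Fin N → ℝ) → ℝ} (hφ : ∀ J, IsTest (φ J))
    {x : Fin N → ℝ} (hx : x ∈ Q N) : iterDiv k (avgFirst φ) x = extDiv 0 k φ x := by
  have hsum := iterDiv_sum Finset.univ (k := k) (φ := fun i J x => φ (Fin.cons i J) x)
    fun i J => (hφ (Fin.cons i J)).1
  unfold avgFirst
  rw [extDiv_zero hφ hx, iterDiv_const_mul _ fun J =>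
    (IsTest.sum Finset.univ fun i _ => hφ (Fin.cons i J)).1, hsum]

theorem splitTV_zero_le_mul (hN : 1 ≤ N) (hp : 1 ≤ p) (k : ℕ) (u : (Fin N → ℝ) → ℝ) :
    splitTV p 0 k u ≤ ENNReal.ofReal (intRatio N p) * intTV p k u := by
  have hc := intRatio_pos hN p
  refine splitTV_le zero_lt_one fun φ hφ => ?_
  have havg := isTest_avgFirst hφ.1
  have hadm : Admissible p k (fun J x => (intRatio N p)⁻¹ * avgFirst φ J x) :=
    ⟨fun J => (havg J).const_mul _, fun x => (hφ.2 x).average hN hp⟩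
  have hrescale : ∫ x in Q N, u x * extDiv 0 k φ x = intRatio N p *
      ∫ x in Q N, u x * iterDiv k (fun J x => (intRatio N p)⁻¹ * avgFirst φ J x) x := by
    rw [← integral_const_mul]
    refine setIntegral_congr_fun measurableSet_Q fun x hx => ?_
    simp only [iterDiv_const_mul _ fun J => (havg J).1, iterDiv_avgFirst hφ.1 hx]
    field_simp
  rw [hrescale, ENNReal.ofReal_mul hc.le]
  gcongr
  exact le_intTV hadm

theorem mul_intTV_le_splitTV_zero (hN : 1 ≤ N) (hp : 1 ≤ p) (k : ℕ) (u : (Fin N → ℝ) → ℝ) :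
    ENNReal.ofReal (intRatio N p) * intTV p k u ≤ splitTV p 0 k u := by
  have hc := intRatio_pos hN p
  simp only [intTV, ENNReal.mul_iSup]
  refine iSup₂_le fun ψ hψ => ?_
  have hadm : Admissible p (k + 1)
      (fun (J : Fin (k + 1) → Fin N) x => intRatio N p * ψ (Fin.tail J) x) :=
    ⟨fun J => (hψ.1 _).const_mul _, fun x => (hψ.2 x).tail hN hp⟩
  refine le_trans (le_of_eq ?_) (le_splitTV zero_lt_one hadm)
  rw [← ENNReal.ofReal_mul hc.le, ← integral_const_mul]
  congr 1
  refine setIntegral_congr_fun measurableSet_Q fun x hx => ?_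
  simp only [extDiv_zero hadm.1 hx, Fin.tail_cons, iterDiv_const_mul _ fun J => (hψ.1 J).1]
  have : (N : ℝ) ≠ 0 := by positivity
  simp only [Finset.sum_const, Finset.card_univ, Fintype.card_fin, nsmul_eq_mul]
  field_simp

theorem splitTV_zero (hN : 1 ≤ N) (hp : 1 ≤ p) (k : ℕ) (u : (Fin N → ℝ) → ℝ) :
    splitTV p 0 k u = ENNReal.ofReal (intRatio N p) * intTV p k u :=
  le_antisymm (splitTV_zero_le_mul hN hp k u) (mul_intTV_le_splitTV_zero hN hp k u)

theorem splitTV_zero_le_intTV (hN : 1 ≤ N) (hp : 1 ≤ p) (k : ℕ) (u : (Fin N → ℝ) → ℝ) :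
    splitTV p 0 k u ≤ intTV p k u := by
  rw [splitTV_zero hN hp]
  exact mul_le_of_le_one_left zero_le (ENNReal.ofReal_le_one.2 (intRatio_le_one hN hp))

end SplitVariation

section Semicontinuity

variable {N k : ℕ} {ι : Type*} {l : Filter ι} {u : ι → (Fin N → ℝ) → ℝ} {v : (Fin N → ℝ) → ℝ}

/-- Convergence against bounded continuous functions of a family bounded in `L^1(Q)`. -/
structure WeakL1 (l : Filter ι) (u : ι → (Fin N → ℝ) → ℝ) (v : (Fin N → ℝ) → ℝ) : Prop where
  int : ∀ n, Integrable (u n) (μQ N)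
  bdd : ∃ A, ∀ n, ∫ x in Q N, |u n x| ≤ A
  lim : ∀ g : (Fin N → ℝ) → ℝ, Continuous g → (∃ B, ∀ x, |g x| ≤ B) →
    Tendsto (fun n => ∫ x in Q N, u n x * g x) l (𝓝 (∫ x in Q N, v x * g x))

theorem WeakL1.mono {l' : Filter ι} (h : WeakL1 l u v) (hl : l' ≤ l) : WeakL1 l' u v :=
  ⟨h.int, h.bdd, fun g hg hB => (h.lim g hg hB).mono_left hl⟩

theorem WeakL1.tendsto_integral_mul (h : WeakL1 l u v) {F : ι → (Fin N → ℝ) → ℝ}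
    {F₀ : (Fin N → ℝ) → ℝ} (hF : ∀ᶠ n in l, Continuous (F n)) (hF₀ : Continuous F₀)
    (hB : ∃ B, ∀ x, |F₀ x| ≤ B) (hlim : TendstoUniformly F F₀ l) :
    Tendsto (fun n => ∫ x in Q N, u n x * F n x) l (𝓝 (∫ x in Q N, v x * F₀ x)) := by
  obtain ⟨A, hA⟩ := h.bdd
  have hclose : Tendsto (fun n => ∫ x in Q N, u n x * (F n x - F₀ x)) l (𝓝 0) := by
    rw [Metric.tendsto_nhds]
    intro ε hε
    have hA0 : 0 < |A| + 1 := by positivity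
    filter_upwards [Metric.tendstoUniformly_iff.1 hlim (ε / (|A| + 1)) (by positivity)] with n hn
    rw [dist_zero_right]
    calc ‖∫ x in Q N, u n x * (F n x - F₀ x)‖
        ≤ ∫ x in Q N, ε / (|A| + 1) * |u n x| := by
          refine norm_integral_le_of_norm_le ((h.int n).abs.const_mul _)
            (Eventually.of_forall fun x => ?_)
          rw [norm_mul, mul_comm, Real.norm_eq_abs (u n x), ← dist_eq_norm, dist_comm]
          exact mul_le_mul_of_nonneg_right (hn x).le (abs_nonneg _)
      _ ≤ ε / (|A| + 1) * |A| := by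
          rw [integral_const_mul]
          gcongr
          exact (hA n).trans (le_abs_self A)
      _ < ε := by
          rw [div_mul_eq_mul_div, div_lt_iff₀ hA0]
          linarith
  have hsum := (h.lim F₀ hF₀ hB).add hclose
  rw [add_zero] at hsum
  obtain ⟨B, hB⟩ := hB
  refine hsum.congr' ?_
  filter_upwards [hF, Metric.tendstoUniformly_iff.1 hlim 1 one_pos] with n hFn hn
  have hInt₀ : Integrable (fun x => u n x * F₀ x) (μQ N) :=
    (h.int n).mul_bdd hF₀.aestronglyMeasurable (Eventually.of_forall hB)
  have hIntSub : Integrable (fun x => u n x * (F n x - F₀ x)) (μQ N) :=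
    (h.int n).mul_bdd (hFn.sub hF₀).aestronglyMeasurable
      (Eventually.of_forall fun x => by simpa [dist_comm, Real.dist_eq] using (hn x).le)
  rw [← integral_add hInt₀ hIntSub]
  congr 1; ext x; ring

theorem WeakL1.eventually_lt (h : WeakL1 l u v) {F : ι → (Fin N → ℝ) → ℝ}
    {F₀ : (Fin N → ℝ) → ℝ} (hF : ∀ᶠ n in l, Continuous (F n)) (hF₀ : Continuous F₀)
    (hB : ∃ B, ∀ x, |F₀ x| ≤ B) (hlim : TendstoUniformly F F₀ l) {T : ι → ℝ≥0∞}
    (hT : ∀ᶠ n in l, ENNReal.ofReal (∫ x in Q N, u n x * F n x) ≤ T n)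
    {y : ℝ≥0∞} (hy : y < ENNReal.ofReal (∫ x in Q N, v x * F₀ x)) : ∀ᶠ n in l, y < T n := by
  filter_upwards [(ENNReal.tendsto_ofReal
    (h.tendsto_integral_mul hF hF₀ hB hlim)).eventually (lt_mem_nhds hy), hT]
    with n hyn hTn using hyn.trans_le hTn

variable {P : ι → ℝ≥0∞} {p : ℝ≥0∞}

theorem WeakL1.eventually_lt_splitTV_of_admissible [l.IsCountablyGenerated] (h : WeakL1 l u v)
    (hN : 1 ≤ N) (hP : ∀ n, 1 ≤ P n) (hp : 1 ≤ p) (hlim : Tendsto P l (𝓝 p)) {s : ι → ℝ}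
    {s₀ : ℝ} (hs₀ : s₀ ≤ 1) (hs1 : ∀ᶠ n in l, s n < 1) (hs : Tendsto s l (𝓝 s₀))
    {φ : (Fin (k + 1) → Fin N) → (Fin N → ℝ) → ℝ} (hφ : Admissible p (k + 1) φ) {y : ℝ≥0∞}
    (hy : y < ENNReal.ofReal (∫ x in Q N, v x * extDiv s₀ k φ x)) :
    ∀ᶠ n in l, y < splitTV (P n) (s n) k (u n) := by
  have hs1' : ∀ᶠ n in l, s n ≤ 1 := hs1.mono fun _ => le_of_lt
  have hbdd := exists_bound_extDiv hs₀ hφ.1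
  have hunif := tendstoUniformly_mul_of_bounded
    (tendsto_cmpFactor hN (k + 1) (one_pos.trans_le hp).ne' hlim)
    (tendstoUniformly_extDiv hs₀ hs1' hs hφ.1) hbdd
  simp only [one_mul] at hunif
  refine h.eventually_lt (hs1'.mono fun n hn => (continuous_extDiv hn hφ.1).const_mul _)
    (continuous_extDiv hs₀ hφ.1) hbdd hunif ?_ hy
  filter_upwards [hs1] with n hn
  simpa only [extDiv_const_mul _ _ hφ.1] using
    le_splitTV (u := u n) hn (hφ.scale hN (hP n) hp)

theorem WeakL1.eventually_lt_splitTV [l.IsCountablyGenerated] (h : WeakL1 l u v)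
    (hN : 1 ≤ N) (hP : ∀ n, 1 ≤ P n) (hp : 1 ≤ p) (hlim : Tendsto P l (𝓝 p)) {s : ι → ℝ}
    {s₀ : ℝ} (hs₀ : s₀ < 1) (hs : Tendsto s l (𝓝 s₀)) {y : ℝ≥0∞} (hy : y < splitTV p s₀ k v) :
    ∀ᶠ n in l, y < splitTV (P n) (s n) k (u n) := by
  obtain ⟨φ, hφ, hy⟩ : ∃ φ : (Fin (k + 1) → Fin N) → (Fin N → ℝ) → ℝ, Admissible p (k + 1) φ ∧
      y < ENNReal.ofReal (∫ x in Q N, v x * extDiv s₀ k φ x) := by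
    by_contra! hcon
    exact absurd hy (not_lt.2 (splitTV_le hs₀ hcon))
  exact h.eventually_lt_splitTV_of_admissible hN hP hp hlim hs₀.le
    (hs.eventually (gt_mem_nhds hs₀)) hs hφ hy

theorem WeakL1.eventually_lt_splitTV_one [l.IsCountablyGenerated] (h : WeakL1 l u v)
    (hN : 1 ≤ N) (hP : ∀ n, 1 ≤ P n) (hp : 1 ≤ p) (hlim : Tendsto P l (𝓝 p)) {s : ι → ℝ}
    (hs1 : ∀ᶠ n in l, s n < 1) (hs : Tendsto s l (𝓝 1)) {y : ℝ≥0∞}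
    (hy : y < intTV p (k + 1) v) : ∀ᶠ n in l, y < splitTV (P n) (s n) k (u n) := by
  simp only [intTV, lt_iSup_iff] at hy
  obtain ⟨ψ, hψ, hy⟩ := hy
  refine h.eventually_lt_splitTV_of_admissible hN hP hp hlim le_rfl hs1 hs (hψ.neg hp)
    (hy.trans_eq ?_)
  congr 1
  refine setIntegral_congr_fun measurableSet_Q fun x hx => ?_
  simp only [neg_eq_neg_one_mul (ψ _ _), extDiv_const_mul _ _ hψ.1, extDiv_one hψ.1 hx]
  ring

theorem WeakL1.eventually_lt_intTV (h : WeakL1 l u v) (hN : 1 ≤ N) (hP : ∀ n, 1 ≤ P n)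
    (hp : 1 ≤ p) (hlim : Tendsto P l (𝓝 p)) {y : ℝ≥0∞} (hy : y < intTV p k v) :
    ∀ᶠ n in l, y < intTV (P n) k (u n) := by
  simp only [intTV, lt_iSup_iff] at hy
  obtain ⟨ψ, hψ, hy⟩ := hy
  have ht := IsTest.iterDiv hψ.1
  obtain ⟨C, -, hC⟩ := ht.exists_bound
  have hunif := tendstoUniformly_mul_of_bounded
    (tendsto_cmpFactor hN k (one_pos.trans_le hp).ne' hlim)
    (F := fun _ => iterDiv k ψ)
    (tendstoUniformly_iff_tendsto_sub.2 (by simpa using tendsto_const_nhds)) ⟨C, hC⟩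
  simp only [one_mul] at hunif
  refine h.eventually_lt (Eventually.of_forall fun n => ht.continuous.const_mul _)
    ht.continuous ⟨C, hC⟩ hunif (Eventually.of_forall fun n => ?_) hy
  simpa only [iterDiv_const_mul _ fun J => (hψ.1 J).1] using
    le_intTV (u := u n) (hψ.scale hN (hP n) hp)

end Semicontinuity

section Orders

variable {N k : ℕ} {p q : ℝ≥0∞} {r₀ : ℝ}

theorem fracTV_natCast (hN : 1 ≤ N) (hp : 1 ≤ p) (k : ℕ) (u : (Fin N → ℝ) → ℝ) :
    fracTV p k u = ENNReal.ofReal (intRatio N p) * intTV p k u := by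
  rw [fracTV_eq_splitTV p (Nat.floor_natCast k), sub_self, splitTV_zero hN hp]

theorem mixedTV_natCast (p : ℝ≥0∞) (k : ℕ) (u : (Fin N → ℝ) → ℝ) :
    mixedTV p k u = intTV p k u := by
  simp [mixedTV]

theorem mixedTV_of_forall_ne (h : ∀ k : ℕ, r₀ ≠ k) (u : (Fin N → ℝ) → ℝ) :
    mixedTV p r₀ u = fracTV p r₀ u := by
  simp [mixedTV, h]

theorem fracTV_le_mixedTV (hN : 1 ≤ N) (hp : 1 ≤ p) (r : ℝ) (u : (Fin N → ℝ) → ℝ) :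
    fracTV p r u ≤ mixedTV p r u := by
  by_cases h : ∃ k : ℕ, r = k
  · obtain ⟨k, rfl⟩ := h
    rw [mixedTV_natCast, fracTV_eq_splitTV p (Nat.floor_natCast k), sub_self]
    exact splitTV_zero_le_intTV hN hp k u
  · push Not at h
    rw [mixedTV_of_forall_ne h]

theorem intRatio_mul_mixedTV_le (hN : 1 ≤ N) (hp : 1 ≤ p) (r : ℝ) (u : (Fin N → ℝ) → ℝ) :
    ENNReal.ofReal (intRatio N p) * mixedTV p r u ≤ fracTV p r u := by
  by_cases h : ∃ k : ℕ, r = k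
  · obtain ⟨k, rfl⟩ := h
    rw [mixedTV_natCast, fracTV_natCast hN hp]
  · push Not at h
    rw [mixedTV_of_forall_ne h]
    exact mul_le_of_le_one_left zero_le (ENNReal.ofReal_le_one.2 (intRatio_le_one hN hp))

theorem mixedTV_le_fracTV_of_intRatio_eq_one (hN : 1 ≤ N) (hp : 1 ≤ p) (h : intRatio N p = 1)
    (r : ℝ) (u : (Fin N → ℝ) → ℝ) : mixedTV p r u ≤ fracTV p r u := by
  simpa [h] using intRatio_mul_mixedTV_le hN hp r u

theorem fracTV_le_mul (hN : 1 ≤ N) (hp : 1 ≤ p) (hq : 1 ≤ q) (r : ℝ) (u : (Fin N → ℝ) → ℝ) :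
    fracTV q r u ≤ ENNReal.ofReal ((N : ℝ) ^ (⌊r⌋₊ + 1)) * fracTV p r u :=
  splitTV_le_mul hN hp hq (by linarith [Nat.lt_floor_add_one r]) _ u

variable {ι : Type*} {l : Filter ι} {P : ι → ℝ≥0∞} {r : ι → ℝ} {u : ι → (Fin N → ℝ) → ℝ}
  {v : (Fin N → ℝ) → ℝ} {y : ℝ≥0∞}

theorem tendsto_intRatio (hN : 1 ≤ N) (hp : p ≠ 0) (hlim : Tendsto P l (𝓝 p)) :
    Tendsto (fun n => intRatio N (P n)) l (𝓝 (intRatio N p)) := by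
  have hN0 : (N : ℝ) ≠ 0 := by positivity
  have hinv : Tendsto (fun n => ((P n)⁻¹).toReal) l (𝓝 (p⁻¹).toReal) :=
    (ENNReal.tendsto_toReal (ENNReal.inv_ne_top.2 hp)).comp
      ((continuous_inv.tendsto p).comp hlim)
  exact (Real.continuousAt_const_rpow hN0).tendsto.comp (hinv.sub_const 1)

variable [l.IsCountablyGenerated]

theorem WeakL1.eventually_lt_fracTV_of_le (h : WeakL1 l u v) (hN : 1 ≤ N) (hP : ∀ n, 1 ≤ P n)
    (hp : 1 ≤ p) (hlim : Tendsto P l (𝓝 p)) (hlimr : Tendsto r l (𝓝 r₀))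
    (hy : y < fracTV p r₀ v) :
    ∀ᶠ n in l, (⌊r₀⌋₊ : ℝ) ≤ r n → y < fracTV (P n) (r n) (u n) := by
  rw [fracTV_eq_splitTV p rfl] at hy
  have hsplit := h.eventually_lt_splitTV hN hP hp hlim
    (by linarith [Nat.lt_floor_add_one r₀]) (hlimr.sub_const (⌊r₀⌋₊ : ℝ)) hy
  filter_upwards [hsplit, hlimr.eventually (gt_mem_nhds (Nat.lt_floor_add_one r₀))]
    with n hn hlt hle
  rwa [fracTV_eq_splitTV _ ((Nat.floor_eq_iff ((Nat.cast_nonneg _).trans hle)).2 ⟨hle, hlt⟩)]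

theorem WeakL1.eventually_lt_fracTV_of_lt (h : WeakL1 l u v) (hN : 1 ≤ N) (hP : ∀ n, 1 ≤ P n)
    (hp : 1 ≤ p) (hlim : Tendsto P l (𝓝 p)) (hlimr : Tendsto r l (𝓝 ((k + 1 : ℕ) : ℝ)))
    (hy : y < intTV p (k + 1) v) :
    ∀ᶠ n in l, r n < ((k + 1 : ℕ) : ℝ) → y < fracTV (P n) (r n) (u n) := by
  push_cast at hlimr ⊢
  have hsplit : ∀ᶠ n in l ⊓ 𝓟 {n | r n < k + 1}, y < splitTV (P n) (r n - k) k (u n) := by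
    refine (h.mono inf_le_left).eventually_lt_splitTV_one hN hP hp (hlim.mono_left inf_le_left)
      (eventually_inf_principal.2 (Eventually.of_forall fun n hn => ?_)) ?_ hy
    · linarith [mem_ofPred_eq.mp hn]
    · simpa using (hlimr.mono_left inf_le_left).sub_const (k : ℝ)
  filter_upwards [eventually_inf_principal.1 hsplit,
    hlimr.eventually (lt_mem_nhds (lt_add_one (k : ℝ)))] with n hn hgt hlt
  rw [fracTV_eq_splitTV _ ((Nat.floor_eq_iff ((Nat.cast_nonneg _).trans hgt.le)).2
    ⟨hgt.le, hlt⟩)]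
  exact hn hlt

theorem WeakL1.eventually_lt_fracTV (h : WeakL1 l u v) (hN : 1 ≤ N) (hP : ∀ n, 1 ≤ P n)
    (hp : 1 ≤ p) (hlim : Tendsto P l (𝓝 p)) (hr : ∀ n, 0 ≤ r n) (hr₀ : 0 ≤ r₀)
    (hlimr : Tendsto r l (𝓝 r₀)) (hy : y < fracTV p r₀ v) :
    ∀ᶠ n in l, y < fracTV (P n) (r n) (u n) := by
  have hge := h.eventually_lt_fracTV_of_le hN hP hp hlim hlimr hy
  rcases (Nat.floor_le hr₀).lt_or_eq with hlt | heq
  · filter_upwards [hge, hlimr.eventually (lt_mem_nhds hlt)] with n hn hn' using hn hn'.le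
  rcases hk : ⌊r₀⌋₊ with _ | k
  · filter_upwards [hge] with n hn
    exact hn (by simpa [hk] using hr n)
  · rw [hk] at heq hge
    have hy' : y < intTV p (k + 1) v := by
      rw [← mixedTV_natCast, heq]
      exact hy.trans_le (fracTV_le_mixedTV hN hp _ v)
    filter_upwards [hge, h.eventually_lt_fracTV_of_lt hN hP hp hlim (heq ▸ hlimr) hy']
      with n hn hn'
    exact (le_or_gt _ _).elim hn hn'

theorem WeakL1.eventually_lt_mixedTV_natCast (h : WeakL1 l u v) (hN : 1 ≤ N)
    (hP : ∀ n, 1 ≤ P n) (hp : 1 ≤ p) (hlim : Tendsto P l (𝓝 p)) (hr : ∀ n, 0 ≤ r n)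
    (hlimr : Tendsto r l (𝓝 k)) (hle : ∀ᶠ n in l, r n ≤ k) (hy : y < mixedTV p k v) :
    ∀ᶠ n in l, y < mixedTV (P n) (r n) (u n) := by
  rw [mixedTV_natCast] at hy
  have hlt : ∀ᶠ n in l, r n < k → y < mixedTV (P n) (r n) (u n) := by
    rcases k with _ | k
    · exact Eventually.of_forall fun n hn => absurd (hr n) (by simpa using hn)
    · filter_upwards [h.eventually_lt_fracTV_of_lt hN hP hp hlim hlimr hy] with n hn hlt
      exact (hn hlt).trans_le (fracTV_le_mixedTV hN (hP n) _ _)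
  filter_upwards [hlt, h.eventually_lt_intTV hN hP hp hlim hy, hle] with n hlt hint hle
  rcases hle.lt_or_eq with hn | hn
  · exact hlt hn
  · rwa [hn, mixedTV_natCast]

theorem WeakL1.eventually_lt_mixedTV (h : WeakL1 l u v) (hN : 1 ≤ N) (hP : ∀ n, 1 ≤ P n)
    (hp : 1 ≤ p) (hlim : Tendsto P l (𝓝 p)) (hr : ∀ n, 0 ≤ r n) (hr₀ : 0 ≤ r₀)
    (hlimr : Tendsto r l (𝓝 r₀))
    (hcond : N = 1 ∨ p = 1 ∨ (∀ k : ℕ, r₀ ≠ k) ∨ ∀ᶠ n in l, r n ≤ r₀)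
    (hy : y < mixedTV p r₀ v) : ∀ᶠ n in l, y < mixedTV (P n) (r n) (u n) := by
  have of_le_fracTV : mixedTV p r₀ v ≤ fracTV p r₀ v →
      ∀ᶠ n in l, y < mixedTV (P n) (r n) (u n) := fun hle => by
    filter_upwards [h.eventually_lt_fracTV hN hP hp hlim hr hr₀ hlimr (hy.trans_le hle)]
      with n hn using hn.trans_le (fracTV_le_mixedTV hN (hP n) _ _)
  rcases hcond with rfl | rfl | hnat | hle
  · exact of_le_fracTV (mixedTV_le_fracTV_of_intRatio_eq_one hN hp (by simp [intRatio]) _ _)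
  · exact of_le_fracTV (mixedTV_le_fracTV_of_intRatio_eq_one hN hp (by simp [intRatio]) _ _)
  · exact of_le_fracTV (mixedTV_of_forall_ne hnat v).le
  · by_cases hnat : ∃ k : ℕ, r₀ = k
    · obtain ⟨k, rfl⟩ := hnat
      exact h.eventually_lt_mixedTV_natCast hN hP hp hlim hr hlimr hle hy
    · push Not at hnat
      exact of_le_fracTV (mixedTV_of_forall_ne hnat v).le

end Orders

section Semigroup

theorem ofReal_integral_rpow_mul_rpow_sub {σ : ℝ} (hσ : 0 ≤ σ) (a b : ℝ) :
    ((∫ τ in (0 : ℝ)..σ, τ ^ (a - 1) * (σ - τ) ^ (b - 1) : ℝ) : ℂ)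
      = ∫ τ in (0 : ℝ)..σ, (τ : ℂ) ^ ((a : ℂ) - 1) * ((σ : ℂ) - τ) ^ ((b : ℂ) - 1) := by
  rw [← intervalIntegral.integral_ofReal]
  refine intervalIntegral.integral_congr fun t ht => ?_
  rw [uIcc_of_le hσ] at ht
  simp only [Complex.ofReal_mul]
  rw [Complex.ofReal_cpow ht.1, Complex.ofReal_cpow (sub_nonneg.2 ht.2)]
  push_cast
  rfl

theorem integral_rpow_mul_rpow_sub {a b σ : ℝ} (ha : 0 < a) (hb : 0 < b) (hσ : 0 < σ) :
    ∫ τ in (0 : ℝ)..σ, τ ^ (a - 1) * (σ - τ) ^ (b - 1)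
      = Real.Gamma a * Real.Gamma b / Real.Gamma (a + b) * σ ^ (a + b - 1) := by
  have hpow : (σ : ℂ) ^ ((a : ℂ) + b - 1) = ((σ ^ (a + b - 1) : ℝ) : ℂ) := by
    rw [Complex.ofReal_cpow hσ.le]; push_cast; rfl
  have hbeta := Complex.betaIntegral_scaled a b hσ
  rw [Complex.betaIntegral_eq_Gamma_mul_div _ _ (by simpa) (by simpa),
    ← ofReal_integral_rpow_mul_rpow_sub hσ.le, hpow, ← Complex.ofReal_add, Complex.Gamma_ofReal,
    Complex.Gamma_ofReal, Complex.Gamma_ofReal] at hbeta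
  norm_cast at hbeta
  rw [hbeta, mul_comm]

theorem rlKernel_mul_rlKernel_sub {a b σ : ℝ} (hσ : σ ≤ 1) (τ : ℝ) :
    rlKernel a τ * rlKernel b (σ - τ) = (Ioo (0 : ℝ) σ).indicator (fun τ =>
      (Real.Gamma a)⁻¹ * (Real.Gamma b)⁻¹ * (τ ^ (a - 1) * (σ - τ) ^ (b - 1))) τ := by
  by_cases hτ : τ ∈ Ioo (0 : ℝ) σ
  · have hτ₁ : τ ∈ Ioc (0 : ℝ) 1 := ⟨hτ.1, hτ.2.le.trans hσ⟩
    have hτ₂ : σ - τ ∈ Ioc (0 : ℝ) 1 := ⟨by linarith [hτ.2], by linarith [hτ.1]⟩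
    simp only [rlKernel, indicator_of_mem hτ₁, indicator_of_mem hτ₂, indicator_of_mem hτ]
    ring
  · rw [indicator_of_notMem hτ]
    by_cases hτ₁ : τ ∈ Ioc (0 : ℝ) 1
    · have hτ₂ : σ - τ ∉ Ioc (0 : ℝ) 1 := fun h => hτ ⟨hτ₁.1, by linarith [h.1]⟩
      simp [rlKernel, hτ₂]
    · simp [rlKernel, hτ₁]

theorem integral_rlKernel_mul_rlKernel_sub {a b σ : ℝ} (ha : 0 < a) (hb : 0 < b) (hσ : σ ≤ 1) :
    ∫ τ, rlKernel a τ * rlKernel b (σ - τ) = rlKernel (a + b) σ := by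
  simp only [rlKernel_mul_rlKernel_sub hσ]
  rcases le_or_gt σ 0 with hσ₀ | hσ₀
  · have hσ' : σ ∉ Ioc (0 : ℝ) 1 := fun h => absurd h.1 (not_lt.2 hσ₀)
    simp [rlKernel, hσ', Ioo_eq_empty (not_lt.2 hσ₀)]
  · have hΓ := fun {c : ℝ} (hc : 0 < c) => (Real.Gamma_pos_of_pos hc).ne'
    rw [integral_indicator measurableSet_Ioo, ← integral_Ioc_eq_integral_Ioo,
      ← intervalIntegral.integral_of_le hσ₀.le, intervalIntegral.integral_const_mul,
      integral_rpow_mul_rpow_sub ha hb hσ₀, rlKernel,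
      indicator_of_mem (show σ ∈ Ioc 0 1 from ⟨hσ₀, hσ⟩)]
    field_simp [hΓ ha, hΓ hb, hΓ (add_pos ha hb)]

variable {N : ℕ} {f : (Fin N → ℝ) → ℝ} {i : Fin N}

theorem dirConv_add_smul_single (K : ℝ → ℝ) (i : Fin N) (f : (Fin N → ℝ) → ℝ) (x : Fin N → ℝ)
    (τ : ℝ) : dirConv K i f (x + τ • Pi.single i 1) =
      ∫ σ, K (σ - τ) * f (x + σ • Pi.single i 1) := by
  rw [dirConv, ← integral_sub_right_eq_self _ τ]
  congr 1; ext σ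
  rw [add_assoc, ← add_smul, add_sub_cancel]

theorem dirConv_rlKernel_add {a b : ℝ} (ha : 0 < a) (hb : 0 < b) (hf : IsTest f)
    {x : Fin N → ℝ} (hx : 0 < x i) :
    dirConv (rlKernel a) i (dirConv (rlKernel b) i f) x = dirConv (rlKernel (a + b)) i f x := by
  obtain ⟨C, -, hC⟩ := hf.exists_bound
  let F : ℝ → ℝ := fun t => f (x + t • Pi.single i 1)
  have hF : Continuous F := hf.continuous.comp (continuous_add_smul_single x i)
  have hInt : Integrable (fun z : ℝ × ℝ => rlKernel a z.2 * rlKernel b (z.1 - z.2) * F z.1)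
      (volume.prod volume) :=
    ((integrable_rlKernel ha).convolution_integrand (ContinuousLinearMap.mul ℝ ℝ)
      (integrable_rlKernel hb)).mul_bdd (hF.comp continuous_fst).aestronglyMeasurable
      (Eventually.of_forall fun z => hC _)
  calc dirConv (rlKernel a) i (dirConv (rlKernel b) i f) x
      = ∫ τ, ∫ σ, rlKernel a τ * rlKernel b (σ - τ) * F σ := by
        rw [dirConv]
        simp only [dirConv_add_smul_single, ← integral_const_mul, mul_assoc, F]
    _ = ∫ σ, ∫ τ, rlKernel a τ * rlKernel b (σ - τ) * F σ :=
        integral_integral_swap (f := fun τ σ => rlKernel a τ * rlKernel b (σ - τ) * F σ) hInt.swap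
    _ = ∫ σ, rlKernel (a + b) σ * F σ := by
        congr 1; ext σ
        rw [integral_mul_const]
        rcases le_or_gt σ 1 with hσ | hσ
        · rw [integral_rlKernel_mul_rlKernel_sub ha hb hσ]
        · simp only [F, hf.eq_zero (add_smul_single_notMem_Q hx hσ.le), mul_zero]

theorem IsTest.iterate_partialD (hf : IsTest f) (i : Fin N) (m : ℕ) :
    IsTest ((FracTV.partialD i)^[m] f) :=
  Function.Iterate.rec IsTest hf (fun _ h => h.partialD i) m

theorem dirConv_rlKernel_iterate_partialD (hf : IsTest f) {x : Fin N → ℝ} (hx : 0 < x i) :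
    ∀ m : ℕ, dirConv (rlKernel (m + 1)) i ((partialD i)^[m + 1] f) x = (-1) ^ (m + 1) * f x
  | 0 => by simpa using dirConv_rlKernel_one_partialD hf hx
  | m + 1 => by
    rw [Function.iterate_succ_apply']
    push_cast
    rw [dirConv_rlKernel_succ_partialD (hf.iterate_partialD i _) hx
      (le_add_of_nonneg_left m.cast_nonneg), dirConv_rlKernel_iterate_partialD hf hx m,
      pow_succ (-1 : ℝ) (m + 1)]
    ring

end Semigroup

section CutKernel

/-- The `t`-derivatives of `t^{r-1} χ(t)`, where `χ` is smooth, `0` for `t ≤ η/2` and `1` for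
`t ≥ η`. They are functions of the pair `(r, t)`, so that they can be bounded uniformly in `r`. -/
def cutKernel (η : ℝ) : ℕ → ℝ × ℝ → ℝ
  | 0 => fun z => z.2 ^ (z.1 - 1) * Real.smoothTransition (2 * z.2 / η - 1)
  | j + 1 => fun z => fderiv ℝ (cutKernel η j) z (0, 1)

variable {η : ℝ}

theorem cutKernel_zero_eq_zero (hη : 0 < η) {z : ℝ × ℝ} (hz : z.2 ≤ η / 2) :
    cutKernel η 0 z = 0 := by
  have harg : 2 * z.2 / η - 1 ≤ 0 := by
    rw [sub_nonpos, div_le_one hη]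
    linarith
  simp only [cutKernel]
  rw [Real.smoothTransition.zero_of_nonpos harg, mul_zero]

theorem contDiff_cutKernel_zero (hη : 0 < η) : ContDiff ℝ ∞ (cutKernel η 0) := by
  rw [contDiff_iff_contDiffAt]
  intro z
  rcases lt_or_ge z.2 (η / 2) with hz | hz
  · have hzero : cutKernel η 0 =ᶠ[𝓝 z] fun _ => 0 := by
      filter_upwards [(isOpen_lt continuous_snd continuous_const).mem_nhds hz] with w hw
      exact cutKernel_zero_eq_zero hη (le_of_lt hw)
    exact contDiffAt_const.congr_of_eventuallyEq hzero
  · have hz₀ : z.2 ≠ 0 := by linarith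
    exact (contDiffAt_snd.rpow (contDiffAt_fst.sub contDiffAt_const) hz₀).mul
      (Real.smoothTransition.contDiff.contDiffAt.comp z
        (((contDiffAt_const.mul contDiffAt_snd).div_const η).sub contDiffAt_const))

theorem contDiff_cutKernel (hη : 0 < η) : ∀ j, ContDiff ℝ ∞ (cutKernel η j)
  | 0 => contDiff_cutKernel_zero hη
  | j + 1 => ((contDiff_cutKernel hη j).fderiv_right (m := ∞) (by simp)).clm_apply contDiff_const

theorem cutKernel_eq_zero (hη : 0 < η) : ∀ (j : ℕ) {z : ℝ × ℝ}, z.2 < η / 2 →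
    cutKernel η j z = 0
  | 0, _, hz => cutKernel_zero_eq_zero hη hz.le
  | j + 1, z, hz => by
    have hzero : cutKernel η j =ᶠ[𝓝 z] fun _ => 0 := by
      filter_upwards [(isOpen_lt continuous_snd continuous_const).mem_nhds hz] with w hw
      exact cutKernel_eq_zero hη j hw
    simp [cutKernel, hzero.fderiv_eq]

theorem hasDerivAt_cutKernel (hη : 0 < η) (j : ℕ) (r t : ℝ) :
    HasDerivAt (fun t => cutKernel η j (r, t)) (cutKernel η (j + 1) (r, t)) t :=
  (((contDiff_cutKernel hη j).differentiable (by simp)) (r, t)).hasFDerivAt.comp_hasDerivAt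
    t ((hasDerivAt_const t r).prodMk (hasDerivAt_id t))

theorem exists_cutKernel_bound (hη : 0 < η) (a b : ℝ) (J : ℕ) :
    ∃ S, 0 ≤ S ∧ ∀ j ≤ J, ∀ r ∈ Icc a b, ∀ t ∈ Icc (0 : ℝ) 1, |cutKernel η j (r, t)| ≤ S := by
  have hcompact : ∀ j, ∃ S, ∀ z ∈ Icc a b ×ˢ Icc (0 : ℝ) 1, ‖cutKernel η j z‖ ≤ S := fun j =>
    (isCompact_Icc.prod isCompact_Icc).exists_bound_of_continuousOn
      (contDiff_cutKernel hη j).continuous.continuousOn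
  choose S hS using hcompact
  refine ⟨∑ j ∈ Finset.range (J + 1), |S j|, Finset.sum_nonneg fun _ _ => abs_nonneg _,
    fun j hj r hr t ht => (hS j (r, t) ⟨hr, ht⟩).trans ((le_abs_self _).trans ?_)⟩
  exact Finset.single_le_sum (f := fun j => |S j|) (fun _ _ => abs_nonneg _)
    (Finset.mem_range.2 (by omega))

/-- `t ↦ cutKernel η j (r, t)` restricted to `(0,1]`, for use as a convolution kernel. -/
def cutKernel₁ (η r : ℝ) (j : ℕ) : ℝ → ℝ := indicator (Ioc 0 1) fun t => cutKernel η j (r, t)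

theorem continuous_cutKernel (hη : 0 < η) (r : ℝ) (j : ℕ) :
    Continuous fun t => cutKernel η j (r, t) :=
  (contDiff_cutKernel hη j).continuous.comp (by fun_prop)

theorem integrable_cutKernel₁ (hη : 0 < η) (r : ℝ) (j : ℕ) : Integrable (cutKernel₁ η r j) := by
  rw [cutKernel₁, integrable_indicator_iff measurableSet_Ioc]
  exact (continuous_cutKernel hη r j).integrableOn_Icc.mono_set Ioc_subset_Icc_self

theorem integral_abs_cutKernel₁_le (hη : 0 < η) {r S : ℝ} {j : ℕ}
    (hS : ∀ t ∈ Icc (0 : ℝ) 1, |cutKernel η j (r, t)| ≤ S) : ∫ t, |cutKernel₁ η r j t| ≤ S := by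
  have hle : ∀ t, |cutKernel₁ η r j t| ≤ (Ioc (0 : ℝ) 1).indicator (fun _ => S) t := fun t => by
    by_cases ht : t ∈ Ioc (0 : ℝ) 1
    · simpa only [cutKernel₁, indicator_of_mem ht] using hS t ⟨ht.1.le, ht.2⟩
    · simp [cutKernel₁, ht]
  have hInt : Integrable ((Ioc (0 : ℝ) 1).indicator fun _ => S) :=
    (integrable_indicator_iff measurableSet_Ioc).2 (integrableOn_const (by simp))
  refine (integral_mono (integrable_cutKernel₁ hη r j).abs hInt hle).trans_eq ?_
  rw [integral_indicator measurableSet_Ioc]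
  simp

variable {N : ℕ} {f : (Fin N → ℝ) → ℝ} {i : Fin N}

theorem dirConv_cutKernel₁_eq (η r : ℝ) (j : ℕ) (f : (Fin N → ℝ) → ℝ) (x : Fin N → ℝ) :
    dirConv (cutKernel₁ η r j) i f x
      = ∫ t in (0 : ℝ)..1, cutKernel η j (r, t) * f (x + t • Pi.single i 1) := by
  rw [dirConv, intervalIntegral.integral_of_le zero_le_one, ← integral_indicator measurableSet_Ioc]
  simp only [cutKernel₁, indicator_mul_left]

theorem dirConv_cutKernel₁_partialD (hη : 0 < η) (r : ℝ) (j : ℕ) (hf : IsTest f)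
    {x : Fin N → ℝ} (hx : 0 < x i) :
    dirConv (cutKernel₁ η r j) i (partialD i f) x = -dirConv (cutKernel₁ η r (j + 1)) i f x := by
  rw [dirConv_cutKernel₁_eq, dirConv_cutKernel₁_eq]
  have hparts := intervalIntegral.integral_mul_deriv_eq_deriv_mul (a := 0) (b := 1)
    (u := fun t => cutKernel η j (r, t)) (u' := fun t => cutKernel η (j + 1) (r, t))
    (v := fun t => f (x + t • Pi.single i 1))
    (v' := fun t => partialD i f (x + t • Pi.single i 1))
    (fun t _ => hasDerivAt_cutKernel hη j r t)
    (fun t _ => hasDerivAt_comp_add_smul_single hf.1 x i t)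
    ((continuous_cutKernel hη r (j + 1)).intervalIntegrable _ _)
    (((hf.partialD i).continuous.comp (continuous_add_smul_single x i)).intervalIntegrable _ _)
  rw [hf.eq_zero (add_smul_single_notMem_Q hx le_rfl),
    cutKernel_eq_zero hη j (z := (r, 0)) (by simpa using hη)] at hparts
  simpa using hparts

theorem dirConv_cutKernel₁_iterate_partialD (hη : 0 < η) (r : ℝ) (hf : IsTest f)
    {x : Fin N → ℝ} (hx : 0 < x i) : ∀ m j : ℕ,
    dirConv (cutKernel₁ η r j) i ((partialD i)^[m] f) x
      = (-1) ^ m * dirConv (cutKernel₁ η r (j + m)) i f x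
  | 0, j => by simp
  | m + 1, j => by
    rw [Function.iterate_succ_apply', dirConv_cutKernel₁_partialD hη r j
      (hf.iterate_partialD i m) hx, dirConv_cutKernel₁_iterate_partialD hη r hf hx m (j + 1),
      show j + 1 + m = j + (m + 1) by ring, pow_succ]
    ring

end CutKernel

section Support

variable {N : ℕ} {f : (Fin N → ℝ) → ℝ} {δ ρ : ℝ} {K : ℝ → ℝ}

/-- `f` vanishes outside the closed cube `[δ, 1-δ]^N`. -/
def SuppIn (δ : ℝ) (f : (Fin N → ℝ) → ℝ) : Prop := ∀ x, f x ≠ 0 → ∀ j, δ ≤ x j ∧ x j ≤ 1 - δ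

theorem SuppIn.tsupport_subset (h : SuppIn δ f) :
    tsupport f ⊆ Icc (fun _ => δ) (fun _ => 1 - δ) :=
  closure_minimal (fun x hx => ⟨fun j => (h x hx j).1, fun j => (h x hx j).2⟩) isClosed_Icc

theorem SuppIn.isTest (h : SuppIn δ f) (hδ : 0 < δ) (hf : ContDiff ℝ ∞ f) : IsTest f :=
  ⟨hf, isCompact_Icc.of_isClosed_subset (isClosed_tsupport f) h.tsupport_subset, fun _ hx j _ =>
    ⟨hδ.trans_le ((h.tsupport_subset hx).1 j), ((h.tsupport_subset hx).2 j).trans_lt (by linarith)⟩⟩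

theorem SuppIn.partialD (h : SuppIn δ f) (i : Fin N) : SuppIn δ (partialD i f) := fun _ hx j =>
  have hmem := h.tsupport_subset (tsupport_fderiv_apply_subset ℝ _ (subset_tsupport _ hx))
  ⟨hmem.1 j, hmem.2 j⟩

theorem SuppIn.dirConv (h : SuppIn δ f) (hK : ∀ t, K t ≠ 0 → |t| ≤ ρ) (i : Fin N) :
    SuppIn (δ - ρ) (dirConv K i f) := by
  intro x hx j
  obtain ⟨t, ht⟩ : ∃ t, K t * f (x + t • Pi.single i 1) ≠ 0 := by
    by_contra! hcon
    exact hx (by simp [FracTV.dirConv, hcon])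
  have htρ := abs_le.1 (hK t (left_ne_zero_of_mul ht))
  have hmem := h _ (right_ne_zero_of_mul ht) j
  by_cases hj : j = i
  · subst hj
    simp only [Pi.add_apply, Pi.smul_apply, Pi.single_eq_same, smul_eq_mul, mul_one] at hmem
    constructor <;> linarith
  · simp only [Pi.add_apply, Pi.smul_apply, Pi.single_eq_of_ne hj, smul_zero, add_zero] at hmem
    constructor <;> linarith

end Support

section SingleEntry

variable {N m k : ℕ} {ψ : (Fin N → ℝ) → ℝ} {p : ℝ≥0∞}

/-- The tensor field with `N^m` entries whose only nonzero entry is `ψ`, at `(i, …, i)`. -/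
def singleEntry (i : Fin N) (m : ℕ) (ψ : (Fin N → ℝ) → ℝ) (J : Fin m → Fin N)
    (x : Fin N → ℝ) : ℝ := if J = fun _ => i then ψ x else 0

theorem singleEntry_cons_self (i : Fin N) (m : ℕ) (ψ : (Fin N → ℝ) → ℝ) :
    (fun J => singleEntry i (m + 1) ψ (Fin.cons i J)) = singleEntry i m ψ := by
  have hcons : ∀ J : Fin m → Fin N,
      (Fin.cons i J : Fin (m + 1) → Fin N) = (fun _ => i) ↔ J = fun _ => i := fun J => by
    simp [funext_iff, Fin.forall_fin_succ]
  ext J x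
  simp only [singleEntry, hcons]

theorem singleEntry_cons_of_ne {i j : Fin N} (h : j ≠ i) (m : ℕ) (ψ : (Fin N → ℝ) → ℝ) :
    (fun J => singleEntry i (m + 1) ψ (Fin.cons j J)) = fun _ _ => 0 := by
  have hcons : ∀ J : Fin m → Fin N, (Fin.cons j J : Fin (m + 1) → Fin N) ≠ fun _ => i :=
    fun J hJ => h (by simpa using congrFun hJ 0)
  ext J x
  simp only [singleEntry, hcons, if_false]

theorem partialD_zero (i : Fin N) : partialD i (fun _ => (0 : ℝ)) = fun _ => 0 := by
  ext x; simp [partialD]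

theorem iterDiv_zero (k : ℕ) :
    iterDiv k (fun (_ : Fin k → Fin N) (_ : Fin N → ℝ) => (0 : ℝ)) = fun _ => 0 := by
  simpa using iterDiv_const_mul 0 (φ := fun (_ : Fin k → Fin N) (_ : Fin N → ℝ) => (0 : ℝ))
    fun _ => contDiff_const

theorem iterDiv_singleEntry (i : Fin N) (ψ : (Fin N → ℝ) → ℝ) :
    ∀ k : ℕ, iterDiv k (singleEntry i k ψ) = (partialD i)^[k] ψ
  | 0 => by
    ext x
    simp [iterDiv, singleEntry, Subsingleton.elim (Fin.elim0 : Fin 0 → Fin N) fun _ => i]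
  | k + 1 => by
    ext x
    simp only [iterDiv]
    rw [Finset.sum_eq_single i (fun j _ hj => by
      rw [singleEntry_cons_of_ne hj, iterDiv_zero, partialD_zero]) (by simp),
      singleEntry_cons_self, iterDiv_singleEntry i ψ k, Function.iterate_succ_apply']

theorem extDiv_singleEntry (i : Fin N) (s : ℝ) (k : ℕ) (ψ : (Fin N → ℝ) → ℝ) (x : Fin N → ℝ) :
    extDiv s k (singleEntry i (k + 1) ψ) x = ((1 - 1 / (N : ℝ)) * s + 1 / (N : ℝ)) *
      dirConv (rlKernel (2 - s)) i ((partialD i)^[k + 2] ψ) x := by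
  rw [extDiv, Finset.sum_eq_single i (fun j _ hj => by
    simp [singleEntry_cons_of_ne hj, iterDiv_zero, partialD_zero, dirConv]) (by simp),
    singleEntry_cons_self, iterDiv_singleEntry, ← Function.iterate_succ_apply' (partialD i),
    ← Function.iterate_succ_apply' (partialD i)]

theorem admissible_singleEntry (hp : 1 ≤ p) (hψ : IsTest ψ) (hψ1 : ∀ x, |ψ x| ≤ 1) (i : Fin N)
    (m : ℕ) : Admissible p m (singleEntry i m ψ) := by
  refine ⟨fun J => ?_, fun x => dualNormLeOne_single hp _ (hψ1 x)⟩
  unfold singleEntry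
  split_ifs
  exacts [hψ, IsTest.zero]

theorem one_div_le_weight (hN : 1 ≤ N) {s : ℝ} (hs : 0 ≤ s) :
    1 / (N : ℝ) ≤ (1 - 1 / (N : ℝ)) * s + 1 / (N : ℝ) := by
  have hN1 : (1 : ℝ) ≤ N := by exact_mod_cast hN
  have : 1 / (N : ℝ) ≤ 1 := (div_le_one (by linarith)).2 hN1
  exact le_add_of_nonneg_left (mul_nonneg (by linarith) hs)

theorem integral_mul_dirConv_le_of_splitTV_le (hN : 1 ≤ N) (hp : 1 ≤ p) {s : ℝ} (hs0 : 0 ≤ s)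
    (hs1 : s < 1) {u : (Fin N → ℝ) → ℝ} {C : ℝ} (hC : 0 ≤ C)
    (hTV : splitTV p s k u ≤ ENNReal.ofReal C) (hψ : IsTest ψ) (hψ1 : ∀ x, |ψ x| ≤ 1)
    (i : Fin N) :
    ∫ x in Q N, u x * dirConv (rlKernel (2 - s)) i ((partialD i)^[k + 2] ψ) x ≤ N * C := by
  set I := ∫ x in Q N, u x * dirConv (rlKernel (2 - s)) i ((partialD i)^[k + 2] ψ) x
  have hN0 : (0 : ℝ) < N := by exact_mod_cast hN
  have hwI : ((1 - 1 / (N : ℝ)) * s + 1 / (N : ℝ)) * I ≤ C := by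
    rw [← integral_const_mul]
    simp only [mul_left_comm _ (u _), ← extDiv_singleEntry]
    exact (ENNReal.ofReal_le_ofReal_iff hC).1
      ((le_splitTV hs1 (admissible_singleEntry hp hψ hψ1 i (k + 1))).trans hTV)
  rcases le_or_gt I 0 with hI | hI
  · exact hI.trans (by positivity)
  · have hNI : 1 / (N : ℝ) * I ≤ C :=
      (mul_le_mul_of_nonneg_right (one_div_le_weight hN hs0) hI.le).trans hwI
    rwa [one_div, inv_mul_le_iff₀ hN0] at hNI

theorem iterate_partialD_const_mul (hψ : IsTest ψ) (c : ℝ) (i : Fin N) (m : ℕ) :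
    (partialD i)^[m] (fun x => c * ψ x) = fun x => c * (partialD i)^[m] ψ x := by
  induction m with
  | zero => rfl
  | succ m ih =>
    rw [Function.iterate_succ_apply', ih, Function.iterate_succ_apply',
      partialD_const_mul (hψ.iterate_partialD i m).1]

theorem abs_integral_mul_dirConv_le_of_splitTV_le (hN : 1 ≤ N) (hp : 1 ≤ p) {s : ℝ}
    (hs0 : 0 ≤ s) (hs1 : s < 1) {u : (Fin N → ℝ) → ℝ} {C : ℝ} (hC : 0 ≤ C)
    (hTV : splitTV p s k u ≤ ENNReal.ofReal C) (hψ : IsTest ψ) {A : ℝ} (hA : 0 < A)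
    (hψA : ∀ x, |ψ x| ≤ A) (i : Fin N) :
    |∫ x in Q N, u x * dirConv (rlKernel (2 - s)) i ((partialD i)^[k + 2] ψ) x|
      ≤ A * (N * C) := by
  set I := ∫ x in Q N, u x * dirConv (rlKernel (2 - s)) i ((partialD i)^[k + 2] ψ) x
  have hscaled : ∀ c : ℝ, |c| = A⁻¹ → c * I ≤ N * C := fun c hc => by
    have hcψ : ∀ x, |c * ψ x| ≤ 1 := fun x => by
      rw [abs_mul, hc, inv_mul_le_iff₀ hA, mul_one]
      exact hψA x
    have := integral_mul_dirConv_le_of_splitTV_le hN hp hs0 hs1 hC hTV (hψ.const_mul c) hcψ i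
    simpa only [iterate_partialD_const_mul hψ, dirConv_const_mul, mul_left_comm _ c,
      integral_const_mul] using this
  have hinv : |A⁻¹| = A⁻¹ := abs_of_pos (inv_pos.2 hA)
  rw [abs_le', ← inv_mul_le_iff₀ hA, ← inv_mul_le_iff₀ hA, mul_neg, ← neg_mul]
  exact ⟨hscaled _ hinv, hscaled _ (by rw [abs_neg, hinv])⟩

end SingleEntry

section Parametrix

variable {N : ℕ} {f g G : (Fin N → ℝ) → ℝ} {i : Fin N} {K : ℝ → ℝ} {η r : ℝ} {x : Fin N → ℝ}

theorem iterate_partialD_dirConv (hK : Integrable K) (hf : IsTest f) (i : Fin N) (m : ℕ) :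
    (partialD i)^[m] (dirConv K i f) = dirConv K i ((partialD i)^[m] f) := by
  induction m with
  | zero => rfl
  | succ m ih =>
    have hfm := hf.iterate_partialD i m
    rw [Function.iterate_succ_apply', ih, Function.iterate_succ_apply',
      partialD_dirConv hK hfm.1 hfm.2.1]

theorem continuous_dirConv (hK : Integrable K) (hf : Continuous f) {C : ℝ} (hC : ∀ x, |f x| ≤ C)
    (i : Fin N) : Continuous (dirConv K i f) := by
  refine continuous_of_dominated
    (fun x => (integrable_dirConv_integrand hK hf hC i x).aestronglyMeasurable)
    (fun x => Eventually.of_forall fun t => ?_) (hK.norm.mul_const C)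
    (Eventually.of_forall fun t => by fun_prop)
  rw [norm_mul]
  exact mul_le_mul_of_nonneg_left (hC _) (norm_nonneg _)

theorem dirConv_mul_left (c : ℝ) (K : ℝ → ℝ) (i : Fin N) (f : (Fin N → ℝ) → ℝ) (x : Fin N → ℝ) :
    dirConv (fun t => c * K t) i f x = c * dirConv K i f x := by
  simp only [dirConv, mul_assoc, integral_const_mul]

theorem dirConv_sub (hK : Integrable K) (hf : Continuous f) (hg : Continuous g) {C C' : ℝ}
    (hC : ∀ x, |f x| ≤ C) (hC' : ∀ x, |g x| ≤ C') (i : Fin N) (x : Fin N → ℝ) :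
    dirConv K i (fun y => f y - g y) x = dirConv K i f x - dirConv K i g x := by
  simp only [dirConv, mul_sub]
  exact integral_sub (integrable_dirConv_integrand hK hf hC i x)
    (integrable_dirConv_integrand hK hg hC' i x)

theorem dirConv_rlKernel_congr {a : ℝ} (hfg : ∀ y, 0 < y i → f y = g y) (hx : 0 < x i) :
    dirConv (rlKernel a) i f x = dirConv (rlKernel a) i g x := by
  refine integral_congr_ae (Eventually.of_forall fun t => ?_)
  by_cases ht : t ∈ Ioc (0 : ℝ) 1
  · simp only [hfg (x + t • Pi.single i 1) (by simpa using add_pos hx ht.1)]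
  · simp [rlKernel, ht]

/-- The Riemann-Liouville kernel of order `r`, cut off smoothly at distance `η`. -/
def localKernel (η r : ℝ) (t : ℝ) : ℝ :=
  rlKernel r t * (1 - Real.smoothTransition (2 * t / η - 1))

theorem localKernel_eq_sub (η r t : ℝ) :
    localKernel η r t = rlKernel r t - (Real.Gamma r)⁻¹ * cutKernel₁ η r 0 t := by
  by_cases ht : t ∈ Ioc (0 : ℝ) 1
  · simp only [localKernel, rlKernel, cutKernel₁, indicator_of_mem ht, cutKernel]
    ring
  · simp [localKernel, rlKernel, cutKernel₁, ht]

theorem integrable_localKernel (hη : 0 < η) (hr : 0 < r) : Integrable (localKernel η r) := by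
  rw [funext (localKernel_eq_sub η r)]
  exact (integrable_rlKernel hr).sub ((integrable_cutKernel₁ hη r 0).const_mul _)

theorem localKernel_eq_zero (hη : 0 < η) {t : ℝ} (ht : t ∉ Ioc (0 : ℝ) η) :
    localKernel η r t = 0 := by
  by_cases hpos : 0 < t
  · have hηt : η < t := lt_of_not_ge fun hle => ht ⟨hpos, hle⟩
    have harg : 1 ≤ 2 * t / η - 1 := by
      rw [le_sub_iff_add_le, le_div_iff₀ hη]
      linarith
    rw [localKernel, Real.smoothTransition.one_of_one_le harg, sub_self, mul_zero]
  · rw [localKernel, rlKernel, indicator_of_notMem fun hmem => hpos hmem.1, zero_mul]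

theorem abs_localKernel_le (hη : 0 < η) (hr : 0 < r) (t : ℝ) :
    |localKernel η r t| ≤
      (Ioc (0 : ℝ) η).indicator (fun t => (Real.Gamma r)⁻¹ * t ^ (r - 1)) t := by
  by_cases ht : t ∈ Ioc (0 : ℝ) η
  · have hpow : 0 ≤ (Real.Gamma r)⁻¹ * t ^ (r - 1) :=
      mul_nonneg (inv_pos.2 (Real.Gamma_pos_of_pos hr)).le (Real.rpow_nonneg ht.1.le _)
    have hrl : |rlKernel r t| ≤ (Real.Gamma r)⁻¹ * t ^ (r - 1) := by
      by_cases hmem : t ∈ Ioc (0 : ℝ) 1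
      · rw [rlKernel, indicator_of_mem hmem, abs_of_nonneg hpow]
      · rwa [rlKernel, indicator_of_notMem hmem, abs_zero]
    have hcut : |1 - Real.smoothTransition (2 * t / η - 1)| ≤ 1 := by
      have hle := Real.smoothTransition.le_one (2 * t / η - 1)
      have hnonneg := Real.smoothTransition.nonneg (2 * t / η - 1)
      rw [abs_of_nonneg (by linarith)]
      linarith
    rw [indicator_of_mem ht, localKernel, abs_mul]
    exact (mul_le_of_le_one_right (abs_nonneg _) hcut).trans hrl
  · rw [indicator_of_notMem ht, localKernel_eq_zero hη ht, abs_zero]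

theorem integral_abs_localKernel_le (hη : 0 < η) (hr : 0 < r) :
    ∫ t, |localKernel η r t| ≤ (Real.Gamma r)⁻¹ * (η ^ r / r) := by
  have hpow : IntervalIntegrable (fun t : ℝ => t ^ (r - 1)) volume 0 η :=
    intervalIntegral.intervalIntegrable_rpow' (by linarith)
  rw [intervalIntegrable_iff_integrableOn_Ioc_of_le hη.le] at hpow
  refine (integral_mono (integrable_localKernel hη hr).abs ?_
    (abs_localKernel_le hη hr)).trans_eq ?_
  · rw [integrable_indicator_iff measurableSet_Ioc]
    exact hpow.const_mul _
  · rw [integral_indicator measurableSet_Ioc, integral_const_mul,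
      ← intervalIntegral.integral_of_le hη.le, integral_rpow (Or.inl (by linarith)),
      sub_add_cancel, Real.zero_rpow hr.ne', sub_zero]

theorem dirConv_localKernel (hη : 0 < η) (hr : 0 < r) (hf : Continuous f) {C : ℝ}
    (hC : ∀ x, |f x| ≤ C) (x : Fin N → ℝ) :
    dirConv (localKernel η r) i f x = dirConv (rlKernel r) i f x
      - dirConv (fun t => (Real.Gamma r)⁻¹ * cutKernel₁ η r 0 t) i f x := by
  simp only [dirConv, localKernel_eq_sub, sub_mul]
  exact integral_sub (integrable_dirConv_integrand (integrable_rlKernel hr) hf hC i x)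
    (integrable_dirConv_integrand ((integrable_cutKernel₁ hη r 0).const_mul _) hf hC i x)

theorem dirConv_rlKernel_dirConv_iterate_partialD {s : ℝ} {k : ℕ} (hs : s < 1) (hr : 0 < k + s)
    (hf : IsTest f) (hx : 0 < x i) :
    dirConv (rlKernel (2 - s)) i (dirConv (rlKernel (k + s)) i ((partialD i)^[k + 2] f)) x
      = (-1) ^ k * f x := by
  rw [dirConv_rlKernel_add (by linarith) hr (hf.iterate_partialD i _) hx,
    show 2 - s + (k + s) = ((k + 1 : ℕ) : ℝ) + 1 by push_cast; ring,
    dirConv_rlKernel_iterate_partialD hf hx (k + 1)]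
  ring

theorem dirConv_rlKernel_dirConv_cutKernel₁ (hη : 0 < η) (a r : ℝ) (hG : IsTest G) (hx : 0 < x i)
    (m : ℕ) :
    dirConv (rlKernel a) i (dirConv (cutKernel₁ η r 0) i ((partialD i)^[m] G)) x
      = (-1) ^ m * dirConv (rlKernel a) i (dirConv (cutKernel₁ η r m) i G) x := by
  rw [← dirConv_const_mul]
  refine dirConv_rlKernel_congr (fun y hy => ?_) hx
  rw [dirConv_cutKernel₁_iterate_partialD hη r hG hy, zero_add]

/-- The smoothing error left when `dirConv (localKernel η (k + s)) i` is used to invert the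
derivative of order `k + s` in the direction `i`. -/
def parametrixError (η : ℝ) (k : ℕ) (s : ℝ) (i : Fin N) (G : (Fin N → ℝ) → ℝ) (x : Fin N → ℝ) : ℝ :=
  (Real.Gamma (k + s))⁻¹ *
    dirConv (rlKernel (2 - s)) i (dirConv (cutKernel₁ η (k + s) (k + 3)) i G) x

theorem dirConv_iterate_partialD_localKernel (hη : 0 < η) {s : ℝ} {k : ℕ} (hs : s < 1)
    (hr : 0 < k + s) (hG : IsTest G) (hx : 0 < x i) :
    dirConv (rlKernel (2 - s)) i
      ((partialD i)^[k + 2] (dirConv (localKernel η (k + s)) i (partialD i G))) x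
    = (-1) ^ k * (partialD i G x + parametrixError η k s i G x) := by
  have hF : IsTest ((partialD i)^[k + 2] (partialD i G)) :=
    (hG.partialD i).iterate_partialD i (k + 2)
  obtain ⟨C, -, hC⟩ := hF.exists_bound
  have hK := integrable_rlKernel hr
  have hcut := (integrable_cutKernel₁ hη (k + s) 0).const_mul (Real.Gamma (k + s))⁻¹
  have hsplit : dirConv (localKernel η (k + s)) i ((partialD i)^[k + 2] (partialD i G)) = fun y =>
      dirConv (rlKernel (k + s)) i ((partialD i)^[k + 2] (partialD i G)) y -
        dirConv (fun t => (Real.Gamma (k + s))⁻¹ * cutKernel₁ η (k + s) 0 t) i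
          ((partialD i)^[k + 2] (partialD i G)) y :=
    funext (dirConv_localKernel hη hr hF.continuous hC)
  rw [iterate_partialD_dirConv (integrable_localKernel hη hr) (hG.partialD i), hsplit,
    dirConv_sub (integrable_rlKernel (by linarith)) (continuous_dirConv hK hF.continuous hC i)
      (continuous_dirConv hcut hF.continuous hC i) (abs_dirConv_le hK hC i)
      (abs_dirConv_le hcut hC i),
    dirConv_rlKernel_dirConv_iterate_partialD hs hr (hG.partialD i) hx,
    funext (dirConv_mul_left _ _ i _), dirConv_const_mul, ← Function.iterate_succ_apply,
    show (k + 2).succ = k + 3 from rfl, dirConv_rlKernel_dirConv_cutKernel₁ hη _ _ hG hx,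
    parametrixError]
  ring

theorem integral_abs_rlKernel_le {a : ℝ} (ha : 1 ≤ a) :
    ∫ t, |rlKernel a t| ≤ (Real.Gamma a)⁻¹ := by
  refine (integral_mono (integrable_rlKernel (by linarith)).abs ?_
    (abs_rlKernel_le ha le_rfl)).trans_eq ?_
  · rw [integrable_indicator_iff measurableSet_Ioc]
    exact integrableOn_const (by simp)
  · rw [integral_indicator measurableSet_Ioc]
    simp

theorem exists_inv_Gamma_le {a b : ℝ} (ha : 0 < a) :
    ∃ B, 0 < B ∧ ∀ r ∈ Icc a b, (Real.Gamma r)⁻¹ ≤ B := by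
  have hcont : ContinuousOn (fun r => (Real.Gamma r)⁻¹) (Icc a b) := fun r hr =>
    (tendsto_inv_Gamma (ha.trans_le hr.1) tendsto_id).mono_left nhdsWithin_le_nhds
  obtain ⟨B, hB⟩ := isCompact_Icc.exists_bound_of_continuousOn hcont
  exact ⟨max B 1, by positivity, fun r hr =>
    (le_abs_self _).trans ((hB r hr).trans (le_max_left _ _))⟩

theorem abs_parametrixError_le {k : ℕ} {s B B' S h : ℝ} (hη : 0 < η) (hs : s ≤ 1) (hr : 0 < k + s)
    (hB : (Real.Gamma (k + s))⁻¹ ≤ B) (hB' : (Real.Gamma (2 - s))⁻¹ ≤ B')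
    (hS : ∀ t ∈ Icc (0 : ℝ) 1, |cutKernel η (k + 3) (k + s, t)| ≤ S) (hG : ∀ x, |G x| ≤ h)
    (x : Fin N → ℝ) : |parametrixError η k s i G x| ≤ B * (B' * (S * h)) := by
  have hh : 0 ≤ h := (abs_nonneg _).trans (hG x)
  have hcut : ∀ y, |dirConv (cutKernel₁ η (k + s) (k + 3)) i G y| ≤ S * h := fun y =>
    (abs_dirConv_le (integrable_cutKernel₁ hη _ _) hG i y).trans
      (mul_le_mul_of_nonneg_right (integral_abs_cutKernel₁_le hη hS) hh)
  have hconv := abs_dirConv_le (integrable_rlKernel (a := 2 - s) (by linarith)) hcut i x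
  have hΓ : 0 < (Real.Gamma (k + s))⁻¹ := inv_pos.2 (Real.Gamma_pos_of_pos hr)
  rw [parametrixError, abs_mul, abs_of_pos hΓ]
  exact mul_le_mul hB (hconv.trans (mul_le_mul_of_nonneg_right
    ((integral_abs_rlKernel_le (by linarith)).trans hB') ((abs_nonneg _).trans (hcut x))))
    (abs_nonneg _) (hΓ.le.trans hB)

theorem continuous_parametrixError {k : ℕ} {s C : ℝ} (hη : 0 < η) (hs : s < 2)
    (hG : Continuous G) (hC : ∀ x, |G x| ≤ C) : Continuous (parametrixError η k s i G) := by
  have hcut := integrable_cutKernel₁ hη (k + s) (k + 3)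
  exact continuous_const.mul (continuous_dirConv (integrable_rlKernel (by linarith))
    (continuous_dirConv hcut hG hC i) (abs_dirConv_le hcut hC i) i)

end Parametrix

section Translation

variable {N : ℕ} {g G : (Fin N → ℝ) → ℝ} {i : Fin N} {δ ρ h η r : ℝ}

/-- The kernel averaging over the backward segment of length `h`: the derivative of its convolution
with `g` is the difference `g x - g (x - h eᵢ)`. -/
def boxKernel (h : ℝ) : ℝ → ℝ := (Ioc (-h) 0).indicator fun _ => 1

theorem integrable_boxKernel (h : ℝ) : Integrable (boxKernel h) := by
  rw [boxKernel, integrable_indicator_iff measurableSet_Ioc]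
  exact integrableOn_const (by simp)

theorem integral_abs_boxKernel (hh : 0 ≤ h) : ∫ t, |boxKernel h t| = h := by
  have habs : ∀ t, |boxKernel h t| = boxKernel h t := fun t =>
    abs_of_nonneg (indicator_nonneg (by simp) t)
  simp_rw [habs]
  rw [boxKernel, integral_indicator measurableSet_Ioc]
  simp [hh]

theorem partialD_dirConv_boxKernel (hg : ContDiff ℝ ∞ g) (hc : HasCompactSupport g) (hh : 0 ≤ h)
    (i : Fin N) (x : Fin N → ℝ) :
    partialD i (dirConv (boxKernel h) i g) x = g x - g (x - h • Pi.single i 1) := by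
  have hmul : ∀ t, boxKernel h t * partialD i g (x + t • Pi.single i 1)
      = (Ioc (-h) 0).indicator (fun t => partialD i g (x + t • Pi.single i 1)) t := fun t => by
    by_cases ht : t ∈ Ioc (-h) 0 <;> simp [boxKernel, ht]
  rw [partialD_dirConv (integrable_boxKernel h) hg hc, dirConv]
  simp_rw [hmul]
  rw [integral_indicator measurableSet_Ioc, ← intervalIntegral.integral_of_le (by linarith),
    intervalIntegral.integral_eq_sub_of_hasDerivAt (f := fun t => g (x + t • Pi.single i 1))
    (fun t _ => hasDerivAt_comp_add_smul_single hg x i t)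
    (((contDiff_partialD hg i).continuous.comp
      (continuous_add_smul_single x i)).intervalIntegrable _ _)]
  simp [sub_eq_add_neg]

theorem SuppIn.dirConv_boxKernel (hg : SuppIn δ g) (hhρ : h ≤ ρ) (i : Fin N) :
    SuppIn (δ - ρ) (FracTV.dirConv (boxKernel h) i g) :=
  hg.dirConv (fun t ht => by
    have hmem : t ∈ Ioc (-h) 0 := by_contra fun hcon => ht (indicator_of_notMem hcon _)
    rw [abs_of_nonpos hmem.2]
    linarith [hmem.1]) i

theorem SuppIn.dirConv_localKernel (hg : SuppIn δ g) (hη : 0 < η) (r : ℝ) (i : Fin N) :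
    SuppIn (δ - η) (FracTV.dirConv (localKernel η r) i g) :=
  hg.dirConv (fun t ht => by
    have hmem : t ∈ Ioc 0 η := by_contra fun hcon => ht (localKernel_eq_zero hη hcon)
    rw [abs_of_pos hmem.1]
    exact hmem.2) i

theorem abs_setIntegral_mul_le {u F : (Fin N → ℝ) → ℝ} {C A : ℝ} (hu : Integrable u (μQ N))
    (huC : ∫ x in Q N, |u x| ≤ C) (hA : 0 ≤ A) (hF : ∀ x, |F x| ≤ A) :
    |∫ x in Q N, u x * F x| ≤ C * A := by
  have hle : |∫ x in Q N, u x * F x| ≤ ∫ x in Q N, |u x| * A :=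
    norm_integral_le_of_norm_le (f := fun x => u x * F x) (hu.abs.mul_const _)
      (Eventually.of_forall fun x => by
        rw [norm_mul]
        exact mul_le_mul_of_nonneg_left (hF x) (abs_nonneg _))
  rw [integral_mul_const] at hle
  exact hle.trans (mul_le_mul_of_nonneg_right huC hA)

/-- The test function `dirConv (localKernel η (k + s)) i (partialD i G)` is small, and its
derivative of order `k + s` is `± partialD i G` up to a smoothing error. -/
theorem abs_integral_mul_partialD_le (hN : 1 ≤ N) {p : ℝ≥0∞} (hp : 1 ≤ p) {k : ℕ} {s : ℝ}
    (hs0 : 0 ≤ s) (hs1 : s < 1) (hr : 0 < k + s) {u : (Fin N → ℝ) → ℝ} {C : ℝ}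
    (hu : Integrable u (μQ N)) (huC : ∫ x in Q N, |u x| ≤ C)
    (hTV : splitTV p s k u ≤ ENNReal.ofReal C) (hη : 0 < η) (hηδ : η < δ) (hG : ContDiff ℝ ∞ G)
    (hGs : SuppIn δ G) {A B E : ℝ} (hA : 0 < A) (hGA : ∀ x, |partialD i G x| ≤ A)
    (hB : ∫ t, |localKernel η (k + s) t| ≤ B) (hB₀ : 0 < B)
    (hE : ∀ x, |parametrixError η k s i G x| ≤ E) :
    |∫ x in Q N, u x * partialD i G x| ≤ B * A * (N * C) + C * E := by
  have hGt : IsTest G := hGs.isTest (hη.trans hηδ) hG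
  have hft : IsTest (partialD i G) := hGt.partialD i
  have hK := integrable_localKernel hη hr
  have hψt : IsTest (dirConv (localKernel η (k + s)) i (partialD i G)) :=
    ((hGs.partialD i).dirConv_localKernel hη _ i).isTest (sub_pos.2 hηδ)
      (contDiff_dirConv hK hft.1 hft.2.1 i)
  have hψA : ∀ x, |dirConv (localKernel η (k + s)) i (partialD i G) x| ≤ B * A := fun x =>
    (abs_dirConv_le hK hGA i x).trans (mul_le_mul_of_nonneg_right hB hA.le)
  have hC : 0 ≤ C := (integral_nonneg fun _ => abs_nonneg _).trans huC
  have hmain := abs_integral_mul_dirConv_le_of_splitTV_le hN hp hs0 hs1 hC hTV hψt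
    (mul_pos hB₀ hA) hψA i
  obtain ⟨M, -, hM⟩ := hGt.exists_bound
  have hid : ∫ x in Q N, u x * dirConv (rlKernel (2 - s)) i
        ((partialD i)^[k + 2] (dirConv (localKernel η (k + s)) i (partialD i G))) x
      = (-1) ^ k * ((∫ x in Q N, u x * partialD i G x)
        + ∫ x in Q N, u x * parametrixError η k s i G x) := by
    rw [← integral_add (hu.mul_bdd hft.continuous.aestronglyMeasurable (Eventually.of_forall hGA))
      (hu.mul_bdd (continuous_parametrixError hη (by linarith) hGt.continuous
        hM).aestronglyMeasurable (Eventually.of_forall hE)), ← integral_const_mul]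
    refine setIntegral_congr_fun measurableSet_Q fun x hx => ?_
    simp only [dirConv_iterate_partialD_localKernel hη hs1 hr hGt (pos_of_mem_Q hx i)]
    ring
  rw [hid, abs_mul, abs_pow, abs_neg, abs_one, one_pow, one_mul] at hmain
  have herror := abs_setIntegral_mul_le hu huC ((abs_nonneg _).trans (hE 0)) hE
  rw [abs_le] at hmain herror ⊢
  constructor <;> linarith [hmain.1, hmain.2, herror.1, herror.2]

theorem exists_mul_rpow_lt {a ε : ℝ} (ha : 0 < a) (hρ : 0 < ρ) (c : ℝ) (hε : 0 < ε) :
    ∃ η ∈ Ioo 0 ρ, c * η ^ a < ε := by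
  have hlim : Tendsto (fun η : ℝ => c * η ^ a) (𝓝[>] 0) (𝓝 0) := by
    have hpow := ((Real.continuousAt_rpow_const 0 a (Or.inr ha.le)).tendsto.const_mul c)
    rw [Real.zero_rpow ha.ne', mul_zero] at hpow
    exact hpow.mono_left nhdsWithin_le_nhds
  obtain ⟨η, hlt, hmem⟩ :=
    ((hlim.eventually (gt_mem_nhds hε)).and (Ioo_mem_nhdsGT hρ)).exists
  exact ⟨η, hmem, hlt⟩

theorem abs_integral_mul_sub_translate_le (hN : 1 ≤ N) {p : ℝ≥0∞} (hp : 1 ≤ p) (hr : 0 < r)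
    {u : (Fin N → ℝ) → ℝ} {C : ℝ} (hu : Integrable u (μQ N)) (huC : ∫ x in Q N, |u x| ≤ C)
    (hTV : fracTV p r u ≤ ENNReal.ofReal C) (hη : 0 < η) (hηδ : η < δ / 2) (hg : ContDiff ℝ ∞ g)
    (hgs : SuppIn δ g) (hg1 : ∀ x, |g x| ≤ 1) (hh : 0 ≤ h) (hhδ : h ≤ δ / 2) {B₁ B₂ S B : ℝ}
    (hB₁ : (Real.Gamma r)⁻¹ ≤ B₁) (hB₂ : ∀ a ∈ Icc (1 : ℝ) 2, (Real.Gamma a)⁻¹ ≤ B₂)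
    (hS : ∀ t ∈ Icc (0 : ℝ) 1, |cutKernel η (⌊r⌋₊ + 3) (r, t)| ≤ S)
    (hB : ∫ t, |localKernel η r t| ≤ B) (hB₀ : 0 < B) (i : Fin N) :
    |∫ x in Q N, u x * (g x - g (x - h • Pi.single i 1))|
      ≤ B * 2 * (N * C) + C * (B₁ * (B₂ * (S * h))) := by
  obtain ⟨s, hrs⟩ : ∃ s, r = ⌊r⌋₊ + s := ⟨r - ⌊r⌋₊, by ring⟩
  have hs0 : 0 ≤ s := by linarith [Nat.floor_le hr.le]
  have hs1 : s < 1 := by linarith [Nat.lt_floor_add_one r]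
  have hgt : IsTest g := hgs.isTest (by linarith) hg
  have hG : ContDiff ℝ ∞ (dirConv (boxKernel h) i g) :=
    contDiff_dirConv (integrable_boxKernel h) hgt.1 hgt.2.1 i
  have hGs : SuppIn (δ / 2) (dirConv (boxKernel h) i g) := by
    simpa only [sub_half] using hgs.dirConv_boxKernel hhδ i
  have hGh : ∀ x, |dirConv (boxKernel h) i g x| ≤ h := fun x => by
    simpa only [integral_abs_boxKernel hh, mul_one] using
      abs_dirConv_le (integrable_boxKernel h) hg1 i x
  have hdiff : ∀ x, partialD i (dirConv (boxKernel h) i g) x = g x - g (x - h • Pi.single i 1) :=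
    partialD_dirConv_boxKernel hgt.1 hgt.2.1 hh i
  have hdiff2 : ∀ x, |partialD i (dirConv (boxKernel h) i g) x| ≤ 2 := fun x => by
    rw [hdiff]
    exact (abs_sub _ _).trans (by linarith [hg1 x, hg1 (x - h • Pi.single i 1)])
  rw [fracTV_eq_splitTV p rfl, show r - ⌊r⌋₊ = s by linarith] at hTV
  rw [hrs] at hr hB hB₁
  have hE := abs_parametrixError_le (i := i) hη hs1.le hr hB₁
    (hB₂ _ ⟨by linarith, by linarith⟩) (by rwa [← hrs]) hGh
  simpa only [hdiff] using abs_integral_mul_partialD_le hN hp hs0 hs1 hr hu huC hTV hη hηδ hG hGs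
    two_pos hdiff2 hB hB₀ hE

theorem integral_abs_localKernel_le_of_le {a b B₁ : ℝ} (ha : 0 < a) (hη : 0 < η) (hη1 : η ≤ 1)
    (hB₁ : ∀ r ∈ Icc a b, (Real.Gamma r)⁻¹ ≤ B₁) (hr : r ∈ Icc a b) :
    ∫ t, |localKernel η r t| ≤ B₁ * (η ^ a / a) := by
  have hr0 : 0 < r := ha.trans_le hr.1
  refine (integral_abs_localKernel_le hη hr0).trans (mul_le_mul (hB₁ r hr) ?_ (by positivity) ?_)
  · exact div_le_div₀ (by positivity) (Real.rpow_le_rpow_of_exponent_ge hη hη1 hr.1) ha hr.1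
  · exact (inv_pos.2 (Real.Gamma_pos_of_pos hr0)).le.trans (hB₁ r hr)

theorem exists_translation_bound (hN : 1 ≤ N) {a b C ε : ℝ} (ha : 0 < a) (hC : 0 ≤ C)
    (hδ : 0 < δ) (hε : 0 < ε) :
    ∃ h₀ : ℝ, 0 < h₀ ∧ ∀ u : (Fin N → ℝ) → ℝ, Integrable u (μQ N) → ∫ x in Q N, |u x| ≤ C →
      ∀ r ∈ Icc a b, ∀ p, 1 ≤ p → fracTV p r u ≤ ENNReal.ofReal C →
      ∀ (i : Fin N) (g : (Fin N → ℝ) → ℝ), ContDiff ℝ ∞ g → SuppIn δ g → (∀ x, |g x| ≤ 1) →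
      ∀ h ∈ Icc (0 : ℝ) h₀, |∫ x in Q N, u x * (g x - g (x - h • Pi.single i 1))| ≤ ε := by
  obtain ⟨B₁, hB₁, hΓ₁⟩ := exists_inv_Gamma_le (b := b) ha
  obtain ⟨B₂, hB₂, hΓ₂⟩ := exists_inv_Gamma_le (a := 1) (b := 2) one_pos
  obtain ⟨η, ⟨hη, hηmin⟩, hηε⟩ := exists_mul_rpow_lt ha (lt_min one_pos (half_pos hδ))
    (B₁ / a * 2 * (N * C)) (half_pos hε)
  rw [lt_min_iff] at hηmin
  obtain ⟨S, hS0, hS⟩ := exists_cutKernel_bound hη a b (⌊b⌋₊ + 3)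
  refine ⟨min (δ / 2) (ε / (2 * (C * (B₁ * (B₂ * S)) + 1))), by positivity, ?_⟩
  intro u hu huC r hr p hp hTV i g hg hgs hg1 h hh
  have hfloor : ⌊r⌋₊ + 3 ≤ ⌊b⌋₊ + 3 := Nat.add_le_add_right (Nat.floor_le_floor hr.2) 3
  have herror : C * (B₁ * (B₂ * (S * h))) ≤ ε / 2 := by
    have hle := hh.2.trans (min_le_right _ _)
    rw [le_div_iff₀ (by positivity)] at hle
    linarith [hh.1]
  calc |∫ x in Q N, u x * (g x - g (x - h • Pi.single i 1))|
      ≤ B₁ * (η ^ a / a) * 2 * (N * C) + C * (B₁ * (B₂ * (S * h))) :=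
        abs_integral_mul_sub_translate_le hN hp (ha.trans_le hr.1) hu huC hTV hη hηmin.2 hg hgs hg1
          hh.1 (hh.2.trans (min_le_left _ _)) (hΓ₁ r hr) hΓ₂ (hS _ hfloor r hr)
          (integral_abs_localKernel_le_of_le ha hη hηmin.1.le hΓ₁ hr) (by positivity) i
    _ = B₁ / a * 2 * (N * C) * η ^ a + C * (B₁ * (B₂ * (S * h))) := by ring
    _ ≤ ε := by linarith

end Translation

section Duality

variable {N : ℕ} {f w : (Fin N → ℝ) → ℝ} {δ η : ℝ}

/-- The closed cube `[δ, 1-δ]^N`. -/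
def innerCube (N : ℕ) (δ : ℝ) : Set (Fin N → ℝ) := Icc (fun _ => δ) (fun _ => 1 - δ)

theorem measurableSet_innerCube : MeasurableSet (innerCube N δ) := measurableSet_Icc

theorem innerCube_subset_Q (hδ : 0 < δ) : innerCube N δ ⊆ Q N := fun _ hx j _ =>
  ⟨hδ.trans_le (hx.1 j), (hx.2 j).trans_lt (by linarith)⟩

theorem suppIn_indicator_innerCube (f : (Fin N → ℝ) → ℝ) : SuppIn δ ((innerCube N δ).indicator f) :=
  fun _ hx j => by
    have hmem := mem_of_indicator_ne_zero hx
    exact ⟨hmem.1 j, hmem.2 j⟩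

theorem abs_convolution_normed_le (φ : ContDiffBump (0 : Fin N → ℝ)) (hf : ∀ x, |f x| ≤ 1)
    (x : Fin N → ℝ) :
    |(convolution (φ.normed volume) f (ContinuousLinearMap.lsmul ℝ ℝ) volume) x| ≤ 1 := by
  simp only [convolution_def, ContinuousLinearMap.lsmul_apply, smul_eq_mul]
  refine (norm_integral_le_of_norm_le (f := fun t => φ.normed volume t * f (x - t))
    (φ.integrable_normed (μ := volume)) (Eventually.of_forall fun t => ?_)).trans
    φ.integral_normed.le
  rw [norm_mul, Real.norm_eq_abs, Real.norm_eq_abs, abs_of_nonneg (φ.nonneg_normed t)]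
  exact mul_le_of_le_one_right (φ.nonneg_normed t) (hf _)

theorem SuppIn.convolution_normed (hf : SuppIn (2 * δ) f) (φ : ContDiffBump (0 : Fin N → ℝ))
    (hφ : φ.rOut ≤ δ) :
    SuppIn δ (convolution (φ.normed volume) f (ContinuousLinearMap.lsmul ℝ ℝ) volume) := by
  intro x hx j
  obtain ⟨t, ht⟩ : ∃ t, φ.normed volume t * f (x - t) ≠ 0 := by
    by_contra! hcon
    exact hx (by simp [convolution_def, hcon])
  have hball : t ∈ Function.support (φ.normed volume) := left_ne_zero_of_mul ht
  rw [φ.support_normed_eq, mem_ball_zero_iff] at hball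
  have hcube := hf _ (right_ne_zero_of_mul ht) j
  have htj := abs_le.1 ((norm_le_pi_norm t j).trans (hball.le.trans hφ))
  simp only [Pi.sub_apply] at hcube
  constructor <;> linarith [htj.1, htj.2]

theorem exists_contDiffBump_tendsto (hδ : 0 < δ) : ∃ φ : ℕ → ContDiffBump (0 : Fin N → ℝ),
    (∀ n, (φ n).rOut ≤ δ) ∧ (∀ n, (φ n).rOut ≤ 2 * (φ n).rIn) ∧
      Tendsto (fun n => (φ n).rOut) atTop (𝓝 0) := by
  have hpos : ∀ n : ℕ, 0 < δ / ((n : ℝ) + 2) := fun n => by positivity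
  refine ⟨fun n => ⟨δ / (n + 2), 2 * (δ / (n + 2)), hpos n, by linarith [hpos n]⟩,
    fun n => ?_, fun n => le_rfl, ?_⟩
  · change 2 * (δ / ((n : ℝ) + 2)) ≤ δ
    rw [← mul_div_assoc, div_le_iff₀ (by positivity), mul_comm]
    gcongr
    linarith [(Nat.cast_nonneg n : (0 : ℝ) ≤ n)]
  · have hlim : Tendsto (fun n : ℕ => (n : ℝ) + 2) atTop atTop :=
      tendsto_atTop_add_const_right _ _ tendsto_natCast_atTop_atTop
    simpa using (hlim.const_div_atTop δ).const_mul 2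

theorem exists_smooth_tendsto (hδ : 0 < δ) (hfm : Measurable f) (hf : ∀ x, |f x| ≤ 1)
    (hfs : SuppIn (2 * δ) f) : ∃ g : ℕ → (Fin N → ℝ) → ℝ,
      (∀ n, ContDiff ℝ ∞ (g n) ∧ SuppIn δ (g n) ∧ ∀ x, |g n x| ≤ 1) ∧
        ∀ᵐ x, Tendsto (fun n => g n x) atTop (𝓝 (f x)) := by
  have hfl : LocallyIntegrable f volume :=
    (locallyIntegrable_const (1 : ℝ)).mono hfm.aestronglyMeasurable
      (Eventually.of_forall fun x => by simpa using hf x)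
  obtain ⟨φ, hφδ, hφ2, hφ0⟩ := exists_contDiffBump_tendsto (N := N) hδ
  exact ⟨fun n => convolution ((φ n).normed volume) f (ContinuousLinearMap.lsmul ℝ ℝ) volume,
    fun n => ⟨(φ n).hasCompactSupport_normed.contDiff_convolution_left _ (φ n).contDiff_normed hfl,
      hfs.convolution_normed (φ n) (hφδ n), abs_convolution_normed_le (φ n) hf⟩,
    ContDiffBump.ae_convolution_tendsto_right_of_locallyIntegrable hφ0
      (Eventually.of_forall hφ2) hfl⟩

theorem exists_measurable_sign {α : Type*} [MeasurableSpace α] {μ : Measure α} {w : α → ℝ}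
    (hw : AEStronglyMeasurable w μ) : ∃ σ : α → ℝ,
      Measurable σ ∧ (∀ x, |σ x| ≤ 1) ∧ (fun x => w x * σ x) =ᵐ[μ] fun x => |w x| := by
  refine ⟨fun x => if 0 ≤ hw.mk w x then 1 else -1,
    Measurable.ite (measurableSet_le measurable_const hw.stronglyMeasurable_mk.measurable)
      measurable_const measurable_const, fun x => by dsimp only; split_ifs <;> simp, ?_⟩
  filter_upwards [hw.ae_eq_mk] with x hx
  rw [← hx]
  split_ifs with hpos
  · rw [abs_of_nonneg hpos, mul_one]
  · rw [abs_of_neg (not_le.1 hpos), mul_neg_one]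

theorem integral_abs_le_of_forall_smooth (hw : Integrable w (μQ N)) (hδ : 0 < δ)
    (h : ∀ g : (Fin N → ℝ) → ℝ, ContDiff ℝ ∞ g → SuppIn δ g → (∀ x, |g x| ≤ 1) →
      ∫ x in Q N, w x * g x ≤ η) :
    ∫ x in innerCube N (2 * δ), |w x| ≤ η := by
  obtain ⟨σ, hσm, hσ1, hσ⟩ := exists_measurable_sign hw.aestronglyMeasurable
  have habs : ∫ x in innerCube N (2 * δ), |w x|
      = ∫ x in Q N, w x * (innerCube N (2 * δ)).indicator σ x := by
    have hind : (fun x => w x * (innerCube N (2 * δ)).indicator σ x)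
        =ᵐ[μQ N] (innerCube N (2 * δ)).indicator fun x => |w x| := by
      filter_upwards [hσ] with x hx
      by_cases hmem : x ∈ innerCube N (2 * δ)
      · rw [indicator_of_mem hmem, indicator_of_mem hmem, hx]
      · rw [indicator_of_notMem hmem, indicator_of_notMem hmem, mul_zero]
    rw [integral_congr_ae hind, integral_indicator measurableSet_innerCube,
      Measure.restrict_restrict measurableSet_innerCube,
      inter_eq_left.2 (innerCube_subset_Q (by positivity))]
  have hind1 : ∀ x, |(innerCube N (2 * δ)).indicator σ x| ≤ 1 := fun x => by
    by_cases hmem : x ∈ innerCube N (2 * δ) <;> simp [hmem, hσ1 x]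
  obtain ⟨g, hg, hlim⟩ := exists_smooth_tendsto hδ (hσm.indicator measurableSet_innerCube) hind1
    (suppIn_indicator_innerCube σ)
  rw [habs]
  refine le_of_tendsto' (tendsto_integral_of_dominated_convergence (fun x => |w x|) (fun n =>
      hw.aestronglyMeasurable.mul (hg n).1.continuous.aestronglyMeasurable) hw.abs
    (fun n => Eventually.of_forall fun x => ?_) ?_) fun n => h _ (hg n).1 (hg n).2.1 (hg n).2.2
  · rw [Pi.mul_apply, norm_mul]
    exact mul_le_of_le_one_right (abs_nonneg _) ((hg n).2.2 x)
  · filter_upwards [ae_restrict_of_ae hlim] with x hx using hx.const_mul _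

end Duality

section Mollification

variable {N : ℕ} {u : ℕ → (Fin N → ℝ) → ℝ} {v w g ρ : (Fin N → ℝ) → ℝ} {y : Fin N → ℝ}
  {δ ε h B : ℝ}

theorem SuppIn.mono {δ' : ℝ} (hg : SuppIn δ g) (hδ : δ' ≤ δ) : SuppIn δ' g := fun x hx j =>
  ⟨hδ.trans (hg x hx j).1, (hg x hx j).2.trans (by linarith)⟩

theorem SuppIn.translate (hg : SuppIn δ g) (hy : ∀ j, y j ∈ Icc 0 h) :
    SuppIn (δ - h) fun x => g (x - y) := fun x hx j => by
  have hxy := hg _ hx j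
  simp only [Pi.sub_apply] at hxy
  constructor <;> linarith [hxy.1, hxy.2, (hy j).1, (hy j).2]

theorem abs_sub_translate_le (hg1 : ∀ x, |g x| ≤ 1) (x y : Fin N → ℝ) :
    |g x - g (x - y)| ≤ 2 :=
  (abs_sub _ _).trans (by linarith [hg1 x, hg1 (x - y)])

theorem integrable_mul_sub_translate (hw : Integrable w (μQ N)) (hg : Continuous g)
    (hg1 : ∀ x, |g x| ≤ 1) (y : Fin N → ℝ) :
    Integrable (fun x => w x * (g x - g (x - y))) (μQ N) :=
  hw.mul_bdd (c := 2) (hg.sub (hg.comp (by fun_prop))).aestronglyMeasurable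
    (Eventually.of_forall fun x => abs_sub_translate_le hg1 x y)

theorem abs_integral_mul_sub_translate_le_dim_mul (hw : Integrable w (μQ N))
    (hg : ContDiff ℝ ∞ g) (hgs : SuppIn δ g) (hg1 : ∀ x, |g x| ≤ 1) (hh : 0 ≤ h)
    (H : ∀ (i : Fin N) (g : (Fin N → ℝ) → ℝ), ContDiff ℝ ∞ g → SuppIn (δ - h) g →
      (∀ x, |g x| ≤ 1) → ∀ t ∈ Icc 0 h,
        |∫ x in Q N, w x * (g x - g (x - t • Pi.single i 1))| ≤ ε)
    (hy : ∀ j, y j ∈ Icc 0 h) :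
    |∫ x in Q N, w x * (g x - g (x - y))| ≤ N * ε := by
  classical
  suffices hS : ∀ S : Finset (Fin N),
      |∫ x in Q N, w x * (g x - g (x - ∑ i ∈ S, Pi.single i (y i)))| ≤ S.card * ε by
    simpa [Finset.univ_sum_single] using hS Finset.univ
  intro S
  induction S using Finset.induction_on with
  | empty => simp
  | insert i S hi ih =>
    set z : Fin N → ℝ := ∑ i ∈ S, Pi.single i (y i) with hz
    have hzh : ∀ j, z j ∈ Icc 0 h := fun j => by
      have hzj : z j = if j ∈ S then y j else 0 := by
        simp [hz, Finset.sum_apply, Pi.single_apply]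
      rw [hzj]
      split_ifs
      exacts [hy j, ⟨le_rfl, hh⟩]
    have hgz : ContDiff ℝ ∞ fun x => g (x - z) := hg.comp (contDiff_id.sub contDiff_const)
    have hsum : ∑ i ∈ insert i S, Pi.single i (y i) = y i • Pi.single i 1 + z := by
      rw [Finset.sum_insert hi, ← Pi.single_smul, smul_eq_mul, mul_one]
    have htelescope : ∀ x, w x * (g x - g (x - ∑ i ∈ insert i S, Pi.single i (y i)))
        = w x * (g x - g (x - z))
          + w x * (g (x - z) - g (x - y i • Pi.single i 1 - z)) := fun x => by
      rw [hsum, sub_add_eq_sub_sub]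
      ring
    simp_rw [htelescope]
    rw [integral_add (integrable_mul_sub_translate hw hg.continuous hg1 z)
      (integrable_mul_sub_translate hw hgz.continuous (fun x => hg1 _) _),
      Finset.card_insert_of_notMem hi, Nat.cast_succ, add_one_mul]
    exact (abs_add_le _ _).trans
      (add_le_add ih (H i _ hgz (hgs.translate hzh) (fun x => hg1 _) (y i) (hy i)))

/-- A bounded continuous probability density that vanishes off `[0,h]^N`. -/
structure IsMollifier (h : ℝ) (ρ : (Fin N → ℝ) → ℝ) : Prop where
  continuous : Continuous ρ
  nonneg : ∀ x, 0 ≤ ρ x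
  integrable : Integrable ρ
  integral_eq_one : ∫ x, ρ x = 1
  exists_bound : ∃ B, ∀ x, |ρ x| ≤ B
  mem_Icc : ∀ y, ρ y ≠ 0 → ∀ j, y j ∈ Icc 0 h

theorem exists_isMollifier (hh : 0 < h) : ∃ ρ : (Fin N → ℝ) → ℝ, IsMollifier h ρ := by
  let φ : ContDiffBump (fun _ : Fin N => h / 2) := ⟨h / 4, h / 2, by positivity, by linarith⟩
  refine ⟨φ.normed volume, φ.continuous_normed, φ.nonneg_normed, φ.integrable_normed,
    φ.integral_normed, φ.continuous_normed.bounded_above_of_compact_support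
      φ.hasCompactSupport_normed, fun y hy j => ?_⟩
  have hball : y ∈ Function.support (φ.normed volume) := hy
  rw [φ.support_normed_eq, mem_ball_iff_norm] at hball
  have hyj : |y j - h / 2| ≤ h / 2 := (norm_le_pi_norm _ j).trans hball.le
  constructor <;> linarith [abs_le.1 hyj]

theorem integral_mul_comp_sub_eq_setIntegral (hgs : SuppIn δ g) (hδ : 0 < δ)
    (ρ : (Fin N → ℝ) → ℝ) (x : Fin N → ℝ) :
    ∫ y, ρ y * g (x - y) = ∫ z in Q N, ρ (x - z) * g z := by
  rw [setIntegral_eq_integral_of_forall_compl_eq_zero, ← integral_sub_left_eq_self _ volume x]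
  · simp only [sub_sub_cancel]
  · intro z hz
    by_contra hne
    have hgz := hgs z (right_ne_zero_of_mul hne)
    exact hz (innerCube_subset_Q hδ ⟨fun j => (hgz j).1, fun j => (hgz j).2⟩)

theorem integrable_uncurry_mul_sub_translate (hw : Integrable w (μQ N)) (hg : Continuous g)
    (hg1 : ∀ x, |g x| ≤ 1) (hρ : Integrable ρ) :
    Integrable (Function.uncurry fun x y => w x * ρ y * (g x - g (x - y)))
      ((μQ N).prod volume) :=
  (hw.mul_prod hρ).mul_bdd (c := 2)
    (Continuous.aestronglyMeasurable (f := fun z : (Fin N → ℝ) × (Fin N → ℝ) =>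
      g z.1 - g (z.1 - z.2)) (by fun_prop))
    (Eventually.of_forall fun z => abs_sub_translate_le hg1 z.1 z.2)

theorem integrable_uncurry_mul_translate (hw : Integrable w (μQ N)) (hρ : Continuous ρ)
    (hρB : ∀ x, |ρ x| ≤ B) :
    Integrable (Function.uncurry fun x z => w x * ρ (x - z)) ((μQ N).prod (μQ N)) := by
  have hprod := (hw.mul_prod (integrable_const (μ := μQ N) (1 : ℝ))).mul_bdd (c := B)
    (Continuous.aestronglyMeasurable (f := fun z : (Fin N → ℝ) × (Fin N → ℝ) =>
      ρ (z.1 - z.2)) (by fun_prop)) (Eventually.of_forall fun z => hρB _)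
  simpa [Function.uncurry_def] using hprod

theorem IsMollifier.abs_integral_oscillation_le (hρ : IsMollifier h ρ)
    (hw : Integrable w (μQ N)) (hg : Continuous g) (hg1 : ∀ x, |g x| ≤ 1)
    (H : ∀ y : Fin N → ℝ, (∀ j, y j ∈ Icc 0 h) → |∫ x in Q N, w x * (g x - g (x - y))| ≤ ε) :
    |∫ x in Q N, ∫ y, w x * ρ y * (g x - g (x - y))| ≤ ε := by
  rw [integral_integral_swap (integrable_uncurry_mul_sub_translate hw hg hg1 hρ.integrable)]
  have hy : ∀ y, ‖∫ x in Q N, w x * ρ y * (g x - g (x - y))‖ ≤ ρ y * ε := fun y => by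
    simp_rw [mul_comm (w _) (ρ y), mul_assoc]
    rw [integral_const_mul, norm_mul, Real.norm_eq_abs, abs_of_nonneg (hρ.nonneg y)]
    by_cases hρy : ρ y = 0
    · simp [hρy]
    · exact mul_le_mul_of_nonneg_left (H y (hρ.mem_Icc y hρy)) (hρ.nonneg y)
  refine (norm_integral_le_of_norm_le (hρ.integrable.mul_const ε)
    (Eventually.of_forall hy)).trans ?_
  rw [integral_mul_const, hρ.integral_eq_one, one_mul]

theorem integrable_uncurry_mul_translate_mul (hw : Integrable w (μQ N)) (hg : Continuous g)
    (hg1 : ∀ x, |g x| ≤ 1) (hρ : Continuous ρ) (hρB : ∀ x, |ρ x| ≤ B) :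
    Integrable (Function.uncurry fun x z => w x * ρ (x - z) * g z) ((μQ N).prod (μQ N)) :=
  (integrable_uncurry_mul_translate hw hρ hρB).mul_bdd (c := 1)
    (hg.comp continuous_snd).aestronglyMeasurable (Eventually.of_forall fun z => hg1 z.2)

theorem abs_integral_mul_translate_mul_le (hw : Integrable w (μQ N)) (hg : Continuous g)
    (hg1 : ∀ x, |g x| ≤ 1) (hρ : Continuous ρ) (hρB : ∀ x, |ρ x| ≤ B) :
    |∫ x in Q N, ∫ z in Q N, w x * ρ (x - z) * g z|
      ≤ ∫ z in Q N, |∫ x in Q N, w x * ρ (x - z)| := by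
  rw [integral_integral_swap (integrable_uncurry_mul_translate_mul hw hg hg1 hρ hρB)]
  simp_rw [integral_mul_const]
  refine norm_integral_le_of_norm_le (f := fun z => (∫ x in Q N, w x * ρ (x - z)) * g z)
    (integrable_uncurry_mul_translate hw hρ hρB).integral_prod_right.abs
    (Eventually.of_forall fun z => ?_)
  rw [norm_mul]
  exact mul_le_of_le_one_right (norm_nonneg _) (hg1 z)

theorem IsMollifier.mul_eq_integral_add_integral (hρ : IsMollifier h ρ) (hg : Continuous g)
    (hgs : SuppIn δ g) (hδ : 0 < δ) (hg1 : ∀ x, |g x| ≤ 1) (w : (Fin N → ℝ) → ℝ)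
    (x : Fin N → ℝ) :
    w x * g x = (∫ y, w x * ρ y * (g x - g (x - y))) + ∫ z in Q N, w x * ρ (x - z) * g z := by
  have hρg : Integrable fun y => ρ y * g (x - y) :=
    hρ.integrable.mul_bdd (c := 1) (hg.comp (by fun_prop)).aestronglyMeasurable
      (Eventually.of_forall fun y => hg1 _)
  simp_rw [mul_assoc]
  rw [integral_const_mul, integral_const_mul, ← integral_mul_comp_sub_eq_setIntegral hgs hδ]
  simp_rw [mul_sub]
  rw [integral_sub (hρ.integrable.mul_const _) hρg, integral_mul_const, hρ.integral_eq_one]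
  ring

theorem IsMollifier.abs_integral_mul_le (hρ : IsMollifier h ρ) (hw : Integrable w (μQ N))
    (hg : Continuous g) (hgs : SuppIn δ g) (hδ : 0 < δ) (hg1 : ∀ x, |g x| ≤ 1)
    (H : ∀ y : Fin N → ℝ, (∀ j, y j ∈ Icc 0 h) → |∫ x in Q N, w x * (g x - g (x - y))| ≤ ε) :
    |∫ x in Q N, w x * g x| ≤ ε + ∫ z in Q N, |∫ x in Q N, w x * ρ (x - z)| := by
  obtain ⟨B, hB⟩ := hρ.exists_bound
  simp_rw [hρ.mul_eq_integral_add_integral hg hgs hδ hg1 w]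
  have hosc : Integrable (fun x => ∫ y, w x * ρ y * (g x - g (x - y))) (μQ N) :=
    (integrable_uncurry_mul_sub_translate hw hg hg1 hρ.integrable).integral_prod_left
  have hmoll : Integrable (fun x => ∫ z in Q N, w x * ρ (x - z) * g z) (μQ N) :=
    (integrable_uncurry_mul_translate_mul hw hg hg1 hρ.continuous hB).integral_prod_left
  rw [integral_add hosc hmoll]
  exact (abs_add_le _ _).trans (add_le_add (hρ.abs_integral_oscillation_le hw hg hg1 H)
    (abs_integral_mul_translate_mul_le hw hg hg1 hρ.continuous hB))

theorem WeakL1.sub_limit {ι : Type*} {l : Filter ι} {u : ι → (Fin N → ℝ) → ℝ}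
    (hW : WeakL1 l u v) (hv : Integrable v (μQ N)) :
    WeakL1 l (fun n x => u n x - v x) 0 := by
  obtain ⟨A, hA⟩ := hW.bdd
  refine ⟨fun n => (hW.int n).sub hv, ⟨A + ∫ x in Q N, |v x|, fun n => ?_⟩, fun g hg hgB => ?_⟩
  · calc ∫ x in Q N, |u n x - v x| ≤ ∫ x in Q N, (|u n x| + |v x|) :=
          integral_mono ((hW.int n).sub hv).abs ((hW.int n).abs.add hv.abs) fun x => abs_sub _ _
      _ = (∫ x in Q N, |u n x|) + ∫ x in Q N, |v x| := integral_add (hW.int n).abs hv.abs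
      _ ≤ A + ∫ x in Q N, |v x| := by gcongr; exact hA n
  · have hlim := (hW.lim g hg hgB).sub_const (∫ x in Q N, v x * g x)
    obtain ⟨B, hB⟩ := hgB
    have hmul : ∀ f, Integrable f (μQ N) → Integrable (fun x => f x * g x) (μQ N) := fun f hf =>
      hf.mul_bdd hg.aestronglyMeasurable (Eventually.of_forall hB)
    simp only [sub_self] at hlim
    simp only [Pi.zero_apply, zero_mul, integral_zero]
    refine hlim.congr fun n => ?_
    simp_rw [sub_mul]
    rw [integral_sub (hmul _ (hW.int n)) (hmul _ hv)]

theorem WeakL1.tendsto_mollified {w : ℕ → (Fin N → ℝ) → ℝ} (hW : WeakL1 atTop w 0)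
    (hρ : Continuous ρ) (hρB : ∀ x, |ρ x| ≤ B) :
    Tendsto (fun n => ∫ z in Q N, |∫ x in Q N, w n x * ρ (x - z)|) atTop (𝓝 0) := by
  obtain ⟨A, hA⟩ := hW.bdd
  have hB : 0 ≤ B := (abs_nonneg _).trans (hρB 0)
  have hpointwise : ∀ z, Tendsto (fun n => |∫ x in Q N, w n x * ρ (x - z)|) atTop (𝓝 0) :=
    fun z => by
      simpa using (hW.lim _ (hρ.comp (continuous_sub_right z)) ⟨B, fun x => hρB _⟩).abs
  rw [← integral_zero (Fin N → ℝ) ℝ (μ := μQ N)]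
  refine tendsto_integral_of_dominated_convergence (fun _ => A * B)
    (fun n => ?_) (integrable_const _) (fun n => Eventually.of_forall fun z => ?_)
    (Eventually.of_forall hpointwise)
  · exact (integrable_uncurry_mul_translate (hW.int n) hρ
      hρB).integral_prod_right.abs.aestronglyMeasurable
  · rw [Real.norm_eq_abs, abs_abs]
    exact abs_setIntegral_mul_le (hW.int n) (hA n) hB fun x => hρB _

end Mollification

section StrongConvergence

variable {N : ℕ} {u : ℕ → (Fin N → ℝ) → ℝ} {v w : (Fin N → ℝ) → ℝ} {a b C δ ε : ℝ}
  {r : ℕ → ℝ} {m : ℕ → ℝ≥0∞}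

theorem setIntegral_Q_eq_innerCube_add (hw : Integrable w (μQ N)) (hδ : 0 < δ) :
    ∫ x in Q N, w x = (∫ x in innerCube N δ, w x) + ∫ x in Q N \ innerCube N δ, w x := by
  have hsub := innerCube_subset_Q (N := N) hδ
  rw [← setIntegral_union disjoint_sdiff_right (measurableSet_Q.diff measurableSet_innerCube)
    (hw.mono_measure (Measure.restrict_mono hsub le_rfl))
    (hw.mono_measure (Measure.restrict_mono sdiff_subset le_rfl)), union_sdiff_cancel hsub]

theorem WeakL1.exists_translation_bound_sub (hN : 1 ≤ N) (hW : WeakL1 atTop u v)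
    (hv : Integrable v (μQ N)) (ha : 0 < a) (hr : ∀ n, r n ∈ Icc a b) (hm : ∀ n, 1 ≤ m n)
    (huC : ∀ n, ∫ x in Q N, |u n x| ≤ C)
    (hTV : ∀ n, fracTV (m n) (r n) (u n) ≤ ENNReal.ofReal C) (hδ : 0 < δ) (hε : 0 < ε) :
    ∃ h > 0, ∀ n g, ContDiff ℝ ∞ g → SuppIn δ g → (∀ x, |g x| ≤ 1) →
      ∀ y : Fin N → ℝ, (∀ j, y j ∈ Icc 0 h) →
        |∫ x in Q N, (u n x - v x) * (g x - g (x - y))| ≤ 2 * N * ε := by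
  have hC : 0 ≤ C := (integral_nonneg fun x => abs_nonneg _).trans (huC 0)
  obtain ⟨h₀, hh₀, H⟩ := exists_translation_bound (b := b) hN ha hC (half_pos hδ) hε
  refine ⟨min h₀ (δ / 2), lt_min hh₀ (half_pos hδ), fun n g hg hgs hg1 y hy => ?_⟩
  have hu : ∀ n, |∫ x in Q N, u n x * (g x - g (x - y))| ≤ N * ε := fun n =>
    abs_integral_mul_sub_translate_le_dim_mul (hW.int n) hg hgs hg1
      (lt_min hh₀ (half_pos hδ)).le
      (fun i f hf hfs hf1 t ht => H (u n) (hW.int n) (huC n) (r n) (hr n) (m n) (hm n) (hTV n)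
        i f hf (hfs.mono (by linarith [min_le_right h₀ (δ / 2)])) hf1 t
        ⟨ht.1, ht.2.trans (min_le_left _ _)⟩) hy
  have hv' : |∫ x in Q N, v x * (g x - g (x - y))| ≤ N * ε :=
    le_of_tendsto' (hW.lim _ (hg.continuous.sub (hg.continuous.comp (continuous_sub_right y)))
      ⟨2, fun x => abs_sub_translate_le hg1 x y⟩).abs hu
  simp_rw [sub_mul (u n _) (v _)]
  rw [integral_sub (integrable_mul_sub_translate (hW.int n) hg.continuous hg1 y)
    (integrable_mul_sub_translate hv hg.continuous hg1 y), mul_assoc, two_mul]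
  exact (abs_sub _ _).trans (add_le_add (hu n) hv')

theorem WeakL1.exists_integral_innerCube_le (hN : 1 ≤ N) (hW : WeakL1 atTop u v)
    (hv : Integrable v (μQ N)) (ha : 0 < a) (hr : ∀ n, r n ∈ Icc a b) (hm : ∀ n, 1 ≤ m n)
    (huC : ∀ n, ∫ x in Q N, |u n x| ≤ C)
    (hTV : ∀ n, fracTV (m n) (r n) (u n) ≤ ENNReal.ofReal C) (hδ : 0 < δ) (hε : 0 < ε) :
    ∃ e : ℕ → ℝ, Tendsto e atTop (𝓝 0) ∧
      ∀ n, ∫ x in innerCube N (2 * δ), |u n x - v x| ≤ 2 * N * ε + e n := by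
  obtain ⟨h, hh, H⟩ := hW.exists_translation_bound_sub hN hv ha hr hm huC hTV hδ hε
  obtain ⟨ρ, hρ⟩ := exists_isMollifier (N := N) hh
  obtain ⟨B, hB⟩ := hρ.exists_bound
  have hw := hW.sub_limit hv
  exact ⟨_, hw.tendsto_mollified hρ.continuous hB, fun n =>
    integral_abs_le_of_forall_smooth (hw.int n) hδ fun g hg hgs hg1 => (le_abs_self _).trans
      (hρ.abs_integral_mul_le (hw.int n) hg.continuous hgs hδ hg1 (H n g hg hgs hg1))⟩

theorem WeakL1.tendsto_integral_abs_sub (hN : 1 ≤ N) (hW : WeakL1 atTop u v)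
    (hv : Integrable v (μQ N)) (ha : 0 < a) (hr : ∀ n, r n ∈ Icc a b) (hm : ∀ n, 1 ≤ m n)
    (huC : ∀ n, ∫ x in Q N, |u n x| ≤ C)
    (hTV : ∀ n, fracTV (m n) (r n) (u n) ≤ ENNReal.ofReal C)
    (hbd : ∀ ε > 0, ∃ δ > 0, ∀ n, ∫ x in Q N \ innerCube N (2 * δ), |u n x - v x| ≤ ε) :
    Tendsto (fun n => ∫ x in Q N, |u n x - v x|) atTop (𝓝 0) := by
  rw [Metric.tendsto_atTop]
  intro ε hε
  set η := ε / (2 * (2 * N + 1)) with hη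
  have hηpos : 0 < η := by positivity
  have hηε : 2 * N * η + η = ε / 2 := by rw [hη]; field_simp
  obtain ⟨δ, hδ, houter⟩ := hbd η hηpos
  obtain ⟨e, he, hinner⟩ := hW.exists_integral_innerCube_le hN hv ha hr hm huC hTV hδ hηpos
  obtain ⟨n₀, hn₀⟩ := eventually_atTop.1 (he.eventually (gt_mem_nhds (half_pos hε)))
  refine ⟨n₀, fun n hn => ?_⟩
  have hw : Integrable (fun x => |u n x - v x|) (μQ N) := ((hW.int n).sub hv).abs
  rw [Real.dist_0_eq_abs, abs_of_nonneg (integral_nonneg fun x => abs_nonneg _),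
    setIntegral_Q_eq_innerCube_add hw (by positivity : 0 < 2 * δ)]
  linarith [hinner n, houter n, hn₀ n hn]

end StrongConvergence

section Boundary

variable {N : ℕ} {q K : ℝ≥0∞} {ε : ℝ}

theorem tendsto_volume_sdiff_innerCube :
    Tendsto (fun δ : ℝ => volume (Q N \ innerCube N (2 * δ))) (𝓝[>] 0) (𝓝 0) := by
  have hcont : Continuous fun δ : ℝ => ENNReal.ofReal (1 - 2 * δ - 2 * δ) ^ N :=
    (ENNReal.continuous_pow N).comp (ENNReal.continuous_ofReal.comp (by fun_prop))
  have hinner : Tendsto (fun δ : ℝ => ENNReal.ofReal (1 - 2 * δ - 2 * δ) ^ N) (𝓝[>] 0) (𝓝 1) := by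
    simpa using (hcont.tendsto 0).mono_left nhdsWithin_le_nhds
  have hdiff : Tendsto (fun δ : ℝ => 1 - ENNReal.ofReal (1 - 2 * δ - 2 * δ) ^ N)
      (𝓝[>] 0) (𝓝 0) := by
    simpa using ENNReal.Tendsto.sub tendsto_const_nhds hinner (Or.inl ENNReal.one_ne_top)
  refine hdiff.congr' ?_
  filter_upwards [self_mem_nhdsWithin] with δ hδ
  have hδ : (0 : ℝ) < δ := hδ
  have hsub : innerCube N (2 * δ) ⊆ Q N := innerCube_subset_Q (by positivity)
  have hvol : volume (innerCube N (2 * δ)) = ENNReal.ofReal (1 - 2 * δ - 2 * δ) ^ N := by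
    rw [innerCube, Real.volume_Icc_pi]
    simp
  rw [measure_sdiff hsub measurableSet_innerCube.nullMeasurableSet
    ((measure_mono hsub).trans_lt (by simp [volume_Q])).ne, volume_Q, hvol]

theorem one_div_toReal_lt_one (hq : 1 < q) : 1 / q.toReal < 1 := by
  rcases eq_or_ne q ⊤ with rfl | hq_top
  · simp
  · have hq1 : 1 < q.toReal := by
      simpa using (ENNReal.toReal_lt_toReal ENNReal.one_ne_top hq_top).2 hq
    rwa [div_lt_one (by linarith)]

theorem exists_integral_boundary_le (hq : 1 < q) (hK : K ≠ ⊤) (hε : 0 < ε) :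
    ∃ δ > 0, ∀ f : (Fin N → ℝ) → ℝ, AEStronglyMeasurable f (μQ N) → eLpNorm f q (μQ N) ≤ K →
      ∫ x in Q N \ innerCube N (2 * δ), |f x| ≤ ε := by
  set s : ℝ := 1 / (1 : ℝ≥0∞).toReal - 1 / q.toReal with hs
  have hspos : 0 < s := by simpa [hs] using one_div_toReal_lt_one hq
  have hlim : Tendsto (fun δ : ℝ => K * volume (Q N \ innerCube N (2 * δ)) ^ s)
      (𝓝[>] 0) (𝓝 0) := by
    have hmul := ENNReal.Tendsto.const_mul (a := K)
      (((ENNReal.continuous_rpow_const (y := s)).tendsto _).comp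
        (tendsto_volume_sdiff_innerCube (N := N))) (Or.inr hK)
    rwa [ENNReal.zero_rpow_of_pos hspos, mul_zero] at hmul
  obtain ⟨δ, hsmall, hδ⟩ := ((hlim.eventually (gt_mem_nhds (ENNReal.ofReal_pos.2 hε))).and
    self_mem_nhdsWithin).exists
  refine ⟨δ, hδ, fun f hf hfK => ?_⟩
  have hle : volume.restrict (Q N \ innerCube N (2 * δ)) ≤ μQ N :=
    Measure.restrict_mono sdiff_subset le_rfl
  have hfs := hf.mono_measure hle
  have hnorm : eLpNorm f 1 (volume.restrict (Q N \ innerCube N (2 * δ))) ≤ ENNReal.ofReal ε :=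
    calc eLpNorm f 1 (volume.restrict (Q N \ innerCube N (2 * δ)))
        ≤ eLpNorm f q (volume.restrict (Q N \ innerCube N (2 * δ)))
            * volume (Q N \ innerCube N (2 * δ)) ^ s := by
          simpa only [Measure.restrict_apply_univ] using
            eLpNorm_le_eLpNorm_mul_rpow_measure_univ hq.le hfs
      _ ≤ K * volume (Q N \ innerCube N (2 * δ)) ^ s := by
          gcongr
          exact (eLpNorm_mono_measure f hle).trans hfK
      _ ≤ ENNReal.ofReal ε := hsmall.le
  rw [eLpNorm_one_eq_lintegral_enorm] at hnorm
  simp_rw [← Real.norm_eq_abs]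
  rw [integral_norm_eq_lintegral_enorm hfs]
  exact ENNReal.toReal_le_of_le_ofReal hε.le hnorm

theorem integral_abs_le_toReal_eLpNorm {α : Type*} [MeasurableSpace α] {μ : Measure α}
    [IsProbabilityMeasure μ] (hq : 1 ≤ q) (hK : K ≠ ⊤) {f : α → ℝ}
    (hf : AEStronglyMeasurable f μ) (hfK : eLpNorm f q μ ≤ K) : ∫ x, |f x| ∂μ ≤ K.toReal := by
  simp_rw [← Real.norm_eq_abs]
  rw [integral_norm_eq_lintegral_enorm hf, ← eLpNorm_one_eq_lintegral_enorm]
  exact ENNReal.toReal_mono hK ((eLpNorm_le_eLpNorm_of_exponent_le hq hf).trans hfK)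

end Boundary

section Limits

variable {N : ℕ} {q K : ℝ≥0∞} {u : ℕ → (Fin N → ℝ) → ℝ} {v : (Fin N → ℝ) → ℝ} {r : ℕ → ℝ} {r₀ : ℝ}
  {m p : ℕ → ℝ≥0∞} {p₀ : ℝ≥0∞}

theorem WeakConv.weakL1 (h : WeakConv q u v) (hq : 1 < q) (hK : K ≠ ⊤)
    (hu : ∀ n, eLpNorm (u n) q (μQ N) ≤ K) : WeakL1 atTop u v where
  int n := (h.1 n).integrable hq.le
  bdd := ⟨K.toReal, fun n => integral_abs_le_toReal_eLpNorm hq.le hK (h.1 n).1 (hu n)⟩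
  lim g hg hgB := by
    obtain ⟨B, hB⟩ := hgB
    refine h.2.2 (1 - q⁻¹)⁻¹ ?_ g (MemLp.of_bound hg.aestronglyMeasurable B
      (Eventually.of_forall hB))
    rw [inv_inv]
    exact add_tsub_cancel_of_le (ENNReal.inv_le_one.2 hq.le)

theorem WeakL1.mem_BVr (h : WeakL1 atTop u v) (hN : 1 ≤ N) (hv : Integrable v (μQ N))
    (hr : ∀ n, 0 ≤ r n) (hr₀ : 0 ≤ r₀) (hlimr : Tendsto r atTop (𝓝 r₀)) (hm : ∀ n, 1 ≤ m n)
    (hK : K ≠ ⊤) (hTV : ∀ n, fracTV (m n) (r n) (u n) ≤ K) : v ∈ BVr N r₀ := by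
  refine ⟨hv, fun p hp => ?_⟩
  set B : ℝ≥0∞ := ENNReal.ofReal ((N : ℝ) ^ (⌊r₀ + 1⌋₊ + 1)) * K
  refine lt_of_le_of_lt (not_lt.1 fun hlt => ?_)
    (show B < ⊤ from ENNReal.mul_lt_top ENNReal.ofReal_lt_top hK.lt_top)
  have hlsc : ∀ᶠ n in atTop, B < fracTV p (r n) (u n) :=
    h.eventually_lt_fracTV hN (fun _ => hp) hp tendsto_const_nhds hr hr₀ hlimr hlt
  obtain ⟨n, hn, hrn⟩ := (hlsc.and (hlimr.eventually (gt_mem_nhds (lt_add_one r₀)))).exists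
  have hN' : (1 : ℝ) ≤ N := by exact_mod_cast hN
  have hfloor : ⌊r n⌋₊ + 1 ≤ ⌊r₀ + 1⌋₊ + 1 := Nat.succ_le_succ (Nat.floor_le_floor hrn.le)
  have hle : fracTV p (r n) (u n) ≤ B := (fracTV_le_mul hN (hm n) hp (r n) (u n)).trans
    (mul_le_mul' (ENNReal.ofReal_le_ofReal (pow_le_pow_right₀ hN' hfloor)) (hTV n))
  exact hle.not_gt hn

theorem WeakConv.tendsto_eLpNorm_sub (h : WeakConv q u v) (hN : 1 ≤ N) (hq : 1 < q)
    (hr₀ : 0 < r₀) (hlimr : Tendsto r atTop (𝓝 r₀)) (hm : ∀ n, 1 ≤ m n)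
    (hK : K ≠ ⊤) (hu : ∀ n, eLpNorm (u n) q (μQ N) ≤ K)
    (hTV : ∀ n, fracTV (m n) (r n) (u n) ≤ K) :
    Tendsto (fun n => eLpNorm (u n - v) 1 (μQ N)) atTop (𝓝 0) := by
  have hW := h.weakL1 hq hK hu
  have hv : Integrable v (μQ N) := h.2.1.integrable hq.le
  obtain ⟨n₀, hn₀⟩ := eventually_atTop.1 (hlimr.eventually
    (Icc_mem_nhds (half_lt_self hr₀) (lt_add_one r₀)))
  have hW_shift : WeakL1 atTop (fun n => u (n + n₀)) v :=
    ⟨fun n => hW.int _, hW.bdd.imp fun A hA n => hA _,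
      fun g hg hgB => (hW.lim g hg hgB).comp (tendsto_add_atTop_nat n₀)⟩
  have hL : K + eLpNorm v q (μQ N) ≠ ⊤ := ENNReal.add_ne_top.2 ⟨hK, h.2.1.2.ne⟩
  have hreal : Tendsto (fun n => ∫ x in Q N, |u (n + n₀) x - v x|) atTop (𝓝 0) :=
    hW_shift.tendsto_integral_abs_sub hN hv (half_pos hr₀) (r := fun n => r (n + n₀))
      (fun n => hn₀ _ (Nat.le_add_left _ _)) (m := fun n => m (n + n₀)) (fun n => hm _)
      (fun n => integral_abs_le_toReal_eLpNorm hq.le hK (h.1 _).1 (hu _))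
      (fun n => (hTV _).trans (ENNReal.ofReal_toReal hK).ge) fun ε hε => by
        obtain ⟨δ, hδ, H⟩ := exists_integral_boundary_le (N := N) hq hL hε
        exact ⟨δ, hδ, fun n => H (u (n + n₀) - v) ((h.1 _).1.sub h.2.1.1)
          ((eLpNorm_sub_le (h.1 _).1 h.2.1.1 hq.le).trans (add_le_add_left (hu _) _))⟩
  rw [← tendsto_add_atTop_iff_nat n₀]
  have henn := ENNReal.tendsto_ofReal hreal
  rw [ENNReal.ofReal_zero] at henn
  refine henn.congr fun n => ?_
  rw [eLpNorm_one_eq_lintegral_enorm, ← ofReal_integral_norm_eq_lintegral_enorm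
    ((hW.int _).sub hv)]
  rfl

theorem le_of_eventually_lt_of_tendsto {f : ℕ → ℝ≥0∞} {a L : ℝ≥0∞}
    (hf : Tendsto f atTop (𝓝 L)) (h : ∀ y < a, ∀ᶠ n in atTop, y < f n) : a ≤ L :=
  le_of_forall_lt_imp_le_of_dense fun y hy => ge_of_tendsto hf ((h y hy).mono fun _ hn => hn.le)

theorem fracTV_le_liminf_of_mixedTV_le (hN : 1 ≤ N) (hp : ∀ n, 1 ≤ p n) (hp₀ : 1 ≤ p₀)
    (hlimp : Tendsto p atTop (𝓝 p₀)) (hlimr : Tendsto r atTop (𝓝 r₀))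
    (h : mixedTV p₀ r₀ v ≤ liminf (fun n => mixedTV (p n) (r n) (u n)) atTop) :
    fracTV p₀ r₀ v ≤ liminf (fun n => fracTV (p n) (r n) (u n)) atTop := by
  by_cases hInt : ∃ k : ℕ, r₀ = k
  · obtain ⟨k, rfl⟩ := hInt
    have hratio : Tendsto (fun n => ENNReal.ofReal (intRatio N (p n))) atTop
        (𝓝 (ENNReal.ofReal (intRatio N p₀))) :=
      ENNReal.tendsto_ofReal (tendsto_intRatio hN (zero_lt_one.trans_le hp₀).ne' hlimp)
    rw [fracTV_natCast hN hp₀, ← mixedTV_natCast, ← hratio.liminf_eq]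
    exact (mul_le_mul_right h _).trans (ENNReal.le_liminf_mul.trans
      (liminf_le_liminf (Eventually.of_forall fun n => intRatio_mul_mixedTV_le hN (hp n) _ _)))
  · push Not at hInt
    rw [mixedTV_of_forall_ne hInt] at h
    refine h.trans (liminf_congr ?_).le
    have hopen : IsOpen (range ((↑) : ℕ → ℝ))ᶜ :=
      Nat.isClosedEmbedding_coe_real.isClosed_range.isOpen_compl
    filter_upwards [hlimr.eventually (hopen.mem_nhds fun ⟨k, hk⟩ => hInt k hk.symm)] with n hn
    exact mixedTV_of_forall_ne (fun k hk => hn ⟨k, hk.symm⟩) _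

theorem exists_weakConv_subseq_tendsto_liminf (hq : 1 < q) (hK : K ≠ ⊤)
    (hu : ∀ n, AEStronglyMeasurable (u n) (μQ N)) (huK : ∀ n, eLpNorm (u n) q (μQ N) ≤ K)
    (f : ℕ → ℝ≥0∞) :
    ∃ (v : (Fin N → ℝ) → ℝ) (σ : ℕ → ℕ), StrictMono σ ∧ WeakConv q (fun n => u (σ n)) v ∧
      Tendsto (fun n => f (σ n)) atTop (𝓝 (liminf f atTop)) := by
  obtain ⟨x, hxf, hx⟩ := exists_seq_tendsto_liminf (f := atTop) (u := f)
  obtain ⟨φ, hφ, hxφ⟩ := strictMono_subseq_of_tendsto_atTop hx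
  obtain ⟨v, τ, hτ, hv, hlim⟩ := exists_weakly_convergent_subseq hq (fun n => hu (x (φ n))) hK
    fun n => huK (x (φ n))
  exact ⟨v, fun n => x (φ (τ n)), hxφ.comp hτ,
    ⟨fun n => ⟨hu _, (huK _).trans_lt hK.lt_top⟩, hv, hlim⟩,
    hxf.comp (hφ.comp hτ).tendsto_atTop⟩

theorem exists_weakConv_TV_le_liminf (hN : 1 ≤ N) (hr : ∀ n, 0 ≤ r n) (hr₀ : 0 ≤ r₀)
    (hlimr : Tendsto r atTop (𝓝 r₀)) (hp : ∀ n, 1 ≤ p n) (hp₀ : 1 ≤ p₀)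
    (hlimp : Tendsto p atTop (𝓝 p₀)) (hu : ∀ n, AEStronglyMeasurable (u n) (μQ N))
    (hq : 1 < q) (hK : K ≠ ⊤) (huK : ∀ n, eLpNorm (u n) q (μQ N) ≤ K) :
    ∃ (v : (Fin N → ℝ) → ℝ) (σ : ℕ → ℕ), StrictMono σ ∧ WeakConv q (fun n => u (σ n)) v ∧
      fracTV p₀ r₀ v ≤ liminf (fun n => fracTV (p n) (r n) (u n)) atTop ∧
      ((N = 1 ∨ p₀ = 1 ∨ (∀ k : ℕ, r₀ ≠ k) ∨ ∀ᶠ n in atTop, r n ≤ r₀) →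
        mixedTV p₀ r₀ v ≤ liminf (fun n => mixedTV (p n) (r n) (u n)) atTop) := by
  by_cases hcond : N = 1 ∨ p₀ = 1 ∨ (∀ k : ℕ, r₀ ≠ k) ∨ ∀ᶠ n in atTop, r n ≤ r₀
  · obtain ⟨v, σ, hσ, hv, hlim⟩ := exists_weakConv_subseq_tendsto_liminf hq hK hu huK
      fun n => mixedTV (p n) (r n) (u n)
    have hσt := hσ.tendsto_atTop
    have hmixed : mixedTV p₀ r₀ v ≤ liminf (fun n => mixedTV (p n) (r n) (u n)) atTop :=
      le_of_eventually_lt_of_tendsto hlim fun y hy =>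
        (hv.weakL1 hq hK fun n => huK _).eventually_lt_mixedTV hN (fun n => hp (σ n)) hp₀
          (hlimp.comp hσt) (fun n => hr (σ n)) hr₀ (hlimr.comp hσt)
          (hcond.imp_right (Or.imp_right (Or.imp_right fun h => hσt.eventually h))) hy
    exact ⟨v, σ, hσ, hv, fracTV_le_liminf_of_mixedTV_le hN hp hp₀ hlimp hlimr hmixed,
      fun _ => hmixed⟩
  · obtain ⟨v, σ, hσ, hv, hlim⟩ := exists_weakConv_subseq_tendsto_liminf hq hK hu huK
      fun n => fracTV (p n) (r n) (u n)
    have hσt := hσ.tendsto_atTop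
    exact ⟨v, σ, hσ, hv, le_of_eventually_lt_of_tendsto hlim fun y hy =>
        (hv.weakL1 hq hK fun n => huK _).eventually_lt_fracTV hN (fun n => hp (σ n)) hp₀
          (hlimp.comp hσt) (fun n => hr (σ n)) hr₀ (hlimr.comp hσt) hy,
      fun h => absurd h hcond⟩

end Limits

end FracTV

end

theorem theorem4p10_general (N : ℕ) (hN : 1 ≤ N)
    (r : ℕ → ℝ) (hr : ∀ n, 0 ≤ r n) (r₀ : ℝ) (hr₀ : 0 ≤ r₀) (hlimr : Tendsto r atTop (𝓝 r₀))
    (p : ℕ → ℝ≥0∞) (hp : ∀ n, 1 ≤ p n) (p₀ : ℝ≥0∞) (hp₀ : 1 ≤ p₀)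
    (hlimp : Tendsto p atTop (𝓝 p₀))
    (u : ℕ → (Fin N → ℝ) → ℝ) (hu : ∀ n, IntegrableOn (u n) (FracTV.Q N))
    (q : ℝ≥0∞) (hq : 1 < q) (m : ℕ → ℝ≥0∞) (hm : ∀ n, 1 ≤ m n)
    (hbound : (⨆ n, (eLpNorm (u n) q (FracTV.μQ N) + FracTV.fracTV (m n) (r n) (u n))) < ⊤) :
    ∃ (v : (Fin N → ℝ) → ℝ) (σ : ℕ → ℕ), StrictMono σ ∧
      v ∈ FracTV.BVr N r₀ ∧
      FracTV.WeakConv q (fun n => u (σ n)) v ∧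
      FracTV.fracTV p₀ r₀ v ≤ liminf (fun n => FracTV.fracTV (p n) (r n) (u n)) atTop ∧
      ((N = 1 ∨ p₀ = 1 ∨ (∀ k : ℕ, r₀ ≠ k) ∨ ∀ᶠ n in atTop, r n ≤ r₀) →
        FracTV.mixedTV p₀ r₀ v ≤ liminf (fun n => FracTV.mixedTV (p n) (r n) (u n)) atTop) ∧
      (0 < r₀ → Tendsto (fun n => eLpNorm (u (σ n) - v) 1 (FracTV.μQ N)) atTop (𝓝 0)) := by
  have hK := hbound.ne
  have hsum := le_iSup fun n => eLpNorm (u n) q (FracTV.μQ N) + FracTV.fracTV (m n) (r n) (u n)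
  have huK := fun n => le_self_add.trans (hsum n)
  have hTV := fun n => le_add_self.trans (hsum n)
  obtain ⟨v, σ, hσ, hv, hfrac, hmixed⟩ := FracTV.exists_weakConv_TV_le_liminf hN hr hr₀ hlimr
    hp hp₀ hlimp (fun n => (hu n).aestronglyMeasurable) hq hK huK
  have hlimσ := hlimr.comp hσ.tendsto_atTop
  have hBV : v ∈ FracTV.BVr N r₀ := (hv.weakL1 hq hK fun n => huK (σ n)).mem_BVr hN
    (hv.2.1.integrable hq.le) (fun n => hr (σ n)) hr₀ hlimσ (fun n => hm (σ n)) hK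
    fun n => hTV (σ n)
  exact ⟨v, σ, hσ, hBV, hv, hfrac, hmixed, fun hr₀_pos => hv.tendsto_eLpNorm_sub hN hq hr₀_pos
    hlimσ (fun n => hm (σ n)) hK (fun n => huK (σ n)) fun n => hTV (σ n)⟩

theorem theorem4p10 (N : ℕ) (hN : 1 ≤ N)
    (r : ℕ → ℝ) (hr : ∀ n, 0 < r n) (r₀ : ℝ) (hr₀ : 0 ≤ r₀) (hlimr : Tendsto r atTop (𝓝 r₀))
    (p : ℕ → ℝ≥0∞) (hp : ∀ n, 1 ≤ p n) (p₀ : ℝ≥0∞) (hp₀ : 1 ≤ p₀)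
    (hlimp : Tendsto p atTop (𝓝 p₀))
    (u : ℕ → (Fin N → ℝ) → ℝ) (hu : ∀ n, IntegrableOn (u n) (FracTV.Q N))
    (q : ℝ≥0∞) (hq : 1 < q)
    -- the norms `ℓ^{m n}` underlying the total variations in the bound are arbitrary
    (m : ℕ → ℝ≥0∞) (hm : ∀ n, 1 ≤ m n)
    (hbound : (⨆ n, (eLpNorm (u n) q (FracTV.μQ N) + FracTV.fracTV (m n) (r n) (u n))) < ⊤) :
    ∃ (v : (Fin N → ℝ) → ℝ) (σ : ℕ → ℕ), StrictMono σ ∧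
      v ∈ FracTV.BVr N r₀ ∧
      FracTV.WeakConv q (fun n => u (σ n)) v ∧
      FracTV.fracTV p₀ r₀ v ≤ liminf (fun n => FracTV.fracTV (p n) (r n) (u n)) atTop ∧
      ((N = 1 ∨ p₀ = 1 ∨ (∀ k : ℕ, r₀ ≠ k) ∨ ∀ᶠ n in atTop, r n ≤ r₀) →
        FracTV.mixedTV p₀ r₀ v ≤ liminf (fun n => FracTV.mixedTV (p n) (r n) (u n)) atTop) ∧
      (0 < r₀ → (∃ M : ℝ, ∀ n, u n ∈ FracTV.IM N M ∩ FracTV.SVr N (r n)) →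
        Tendsto (fun n => eLpNorm (u (σ n) - v) 1 (FracTV.μQ N)) atTop (𝓝 0)) := by
  obtain ⟨v, σ, hσ, hBV, hv, hfrac, hmixed, hstrong⟩ := theorem4p10_general N hN r
    (fun n => (hr n).le) r₀ hr₀ hlimr p hp p₀ hp₀ hlimp u hu q hq m hm hbound
  exact ⟨v, σ, hσ, hBV, hv, hfrac, hmixed, fun hr₀_pos _ => hstrong hr₀_pos⟩
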